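/- **Theorem 5.1.** Let $0<\alpha<1$, $\theta>0$, and let $H$ be a probability measure on $(0,\infty)$ with $\int_0^\infty\log(1+r)\,H(dr)<\infty$. For $\vartheta>0$ and a probability measure $G$ on $(0,\infty)$ with $\int\log(1+y)\,G(dy)<\infty$, let $M_\vartheta(G)=\int_0^\infty y\,P(dy)$ be the mean of a Dirichlet process $P$ with shape parameter $\vartheta G$, and put $$\Delta_\vartheta(t|G)=\frac1\pi\sin\big(\pi\vartheta\,G((0,t])\big)\,e^{-\vartheta\Phi_G(t)},\qquad \Phi_G(t)=\int_0^\infty \log|t-y|\,\mathbb I(y\ne t)\,G(dy).$$ For $x>0$ let $$\varrho_\alpha(x)=\frac{\sin(\pi\alpha)}{\pi}\,\frac{x^{\alpha-1}}{x^{2\alpha}+2x^\alpha\cos(\alpha\pi)+1},\qquad \varrho_{\alpha,H}(x)=\frac{\sin(\pi\alpha)}{\pi}\int_0^\infty\frac{x^{\alpha-1}r}{x^{2\alpha}+2x^\alpha r\cos(\alpha\pi)+r^2}\,H(dr),$$ and use the same symbols for the measures on $(0,\infty)$ with these densities. Let $X_\alpha$ (with density $\varrho_\alpha$) and $R$ (with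 law $H$) be independent, and let $\Upsilon_\alpha(x)=\mathbb P(X_\alpha R^{1/\alpha}\le x)$ and $\mathscr S^H_\alpha(x)=\mathbb E[\log|x-X_\alpha R^{1/\alpha}|\,\mathbb I(X_\alpha R^{1/\alpha}\neq x)]$. Then: 1. $M_{\alpha\theta}(\varrho_{\alpha,H})\overset{d}{=}M_{\alpha\theta}(\varrho_\alpha)\,[M_\theta(H)]^{1/\alpha}$, with independent factors on the right. 2. For all $x\ge0$ (with an absolutely convergent integral), $$\mathbb P\big(M_{\alpha\theta}(\varrho_{\alpha,H})\le x\big)=\int_0^x(x-t)^{\alpha\theta-1}\Delta_{\alpha\theta}(t|\varrho_{\alpha,H})\,dt .$$ 3. For all $x>0$, $$\Delta_{\alpha\theta}(x|\varrho_{\alpha,H})=\frac1\pi\sin\big(\pi\theta\alpha\Upsilon_\alpha(x)\big)e^{-\theta\alpha\mathscr S^H_\alpha(x)},$$ where, with $\cot^{-1}$ taking values in $(0,\pi)$, $$\Upsilon_\alpha(x)=1-\frac1{\pi\alpha}\int_0^\infty\cot^{-1}\Big(\cot(\pi\alpha)+\frac{x^\alpha/r}{\sin(\pi\alpha)}\Big)H(dr),\quad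 \mathscr S^H_\alpha(x)=\frac1{2\alpha}\int_0^\infty\log\big(x^{2\alpha}+2x^\alpha r\cos(\alpha\pi)+r^2\big)H(dr).$$ 4. $\Delta_1(\cdot|\varrho_{\alpha,H})$ is the density of $M_1(\varrho_{\alpha,H})$ on $(0,\infty)$. 5. For all $x>0$, the derivative $d_{\alpha\theta}(x|\varrho_{\alpha,H})=\frac{d}{dx}\Delta_{\alpha\theta}(x|\varrho_{\alpha,H})$ exists and equals $$\frac{\alpha\theta}{\pi}e^{-\theta\alpha\mathscr S^H_\alpha(x)}\Big[\sin\big(\pi\alpha[1-\theta\Upsilon_\alpha(x)]\big)B^H_{\alpha,1}(x)-\sin\big(\pi\theta\alpha\Upsilon_\alpha(x)\big)B^H_{\alpha,2}(x)\Big],$$ $$B^H_{\alpha,1}(x)=\int_0^\infty\frac{x^{\alpha-1}r}{x^{2\alpha}+2x^\alpha r\cos(\alpha\pi)+r^2}H(dr),\qquad B^H_{\alpha,2}(x)=\int_0^\infty\frac{x^{2\alpha-1}}{x^{2\alpha}+2x^\alpha r\cos(\alpha\pi)+r^2}H(dr).$$ 6. If $\Delta_{\alpha\theta}(t|\varrho_{\alpha,H})\to0$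 as $t\downarrow0$, then $M_{\alpha\theta}(\varrho_{\alpha,H})$ has on $(0,\infty)$ the nonnegative density $$f(x)=\int_0^x(x-t)^{\alpha\theta-1}d_{\alpha\theta}(t|\varrho_{\alpha,H})\,dt,$$ the integral being absolutely convergent on each $[\varepsilon,x]$, $0<\varepsilon<x$, and improper at $0$ (the limit of $\int_\varepsilon^x$ as $\varepsilon\downarrow0$). If $\int_0^\infty|\log r|\,H(dr)<\infty$, then $\Delta_{\alpha\theta}(t|\varrho_{\alpha,H})\to0$ as $t\downarrow0$, so this holds, and the integral is absolutely convergent on $[0,x]$. -/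

import Mathlib

open MeasureTheory ProbabilityTheory Set Filter Topology

/-- Stick-breaking weights `V k * ∏_{j < k} (1 - V j)`. -/
noncomputable def stickWeight (V : ℕ → ℝ) (k : ℕ) : ℝ :=
  V k * ∏ j ∈ Finset.range k, (1 - V j)

open Classical in
/-- The law of the Dirichlet mean functional `M_θ(H) = ∫ y P(dy)`, where
`P = ∑ k, stickWeight V k • δ_{W k}` is the Dirichlet process with shape parameter `θ H`: the
`V k` are iid Beta(1, θ), the `W k` are iid with law `H`, and the two sequences are independent.
(The definition is meant for `θ > 0` and a probability measure `H`.) -/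
noncomputable def dirichletMean (θ : ℝ) (H : Measure ℝ) : Measure ℝ :=
  if h : 0 < θ ∧ IsProbabilityMeasure H then
    haveI := isProbabilityMeasureBeta one_pos h.1
    haveI := h.2
    Measure.map (fun ω : (ℕ → ℝ) × (ℕ → ℝ) => ∑' k, stickWeight ω.1 k * ω.2 k)
      ((Measure.infinitePi fun _ : ℕ => betaMeasure 1 θ).prod (Measure.infinitePi fun _ : ℕ => H))
  else 0

/-- The absolutely continuous measure on `(0, ∞)` with density `f`. -/
noncomputable def densityMeasure (f : ℝ → ℝ) : Measure ℝ :=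
  (volume.restrict (Ioi 0)).withDensity fun x => ENNReal.ofReal (f x)

/-- The logarithmic potential `Φ(t) = ∫ log |t - y| 1{y ≠ t} H(dy)` (the indicator is built into
the convention `Real.log 0 = 0`). -/
noncomputable def logPotential (H : Measure ℝ) (t : ℝ) : ℝ :=
  ∫ y, Real.log |t - y| ∂H

/-- The Cifarelli–Regazzini function `Δ_θ(t | H) = (1/π) sin(π θ H((0, t])) exp(-θ Φ(t))`. -/
noncomputable def crDelta (θ : ℝ) (H : Measure ℝ) (t : ℝ) : ℝ :=
  1 / Real.pi * Real.sin (Real.pi * θ * H.real (Ioc 0 t)) * Real.exp (-θ * logPotential H t)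

/-- The common denominator `x^{2α} + 2 x^α r cos(απ) + r²`. -/
noncomputable def lampertiDenom (α x r : ℝ) : ℝ :=
  x ^ (2 * α) + 2 * x ^ α * r * Real.cos (α * Real.pi) + r ^ 2

/-- The density `ϱ_α` on `(0, ∞)` of `X_α`, the ratio of two iid positive `α`-stable variables. -/
noncomputable def rho (α x : ℝ) : ℝ :=
  Real.sin (Real.pi * α) / Real.pi * (x ^ (α - 1) / lampertiDenom α x 1)

/-- The density `ϱ_{α,H}` on `(0, ∞)`. -/
noncomputable def rhoMix (α : ℝ) (H : Measure ℝ) (x : ℝ) : ℝ :=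
  Real.sin (Real.pi * α) / Real.pi * ∫ r, x ^ (α - 1) * r / lampertiDenom α x r ∂H

/-- `Υ_α(x) = P(X_α R^{1/α} ≤ x)`, where `X_α` has density `ϱ_α`, `R` has law `H`, and `X_α`, `R`
are independent. -/
noncomputable def upsilon (α : ℝ) (H : Measure ℝ) (x : ℝ) : ℝ :=
  ((densityMeasure (rho α)).prod H).real {p | p.1 * p.2 ^ (1 / α) ≤ x}

/-- `𝒮^H_α(x) = E[log |x - X_α R^{1/α}| 1{X_α R^{1/α} ≠ x}]`, with `X_α`, `R` as in `upsilon`. -/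
noncomputable def logS (α : ℝ) (H : Measure ℝ) (x : ℝ) : ℝ :=
  ∫ p : ℝ × ℝ, Real.log |x - p.1 * p.2 ^ (1 / α)| ∂((densityMeasure (rho α)).prod H)

/-- The inverse cotangent with values in `(0, π)`. -/
noncomputable def arccot (y : ℝ) : ℝ := Real.pi / 2 - Real.arctan y

/-- `B^H_{α,1}(x)`. -/
noncomputable def bOne (α : ℝ) (H : Measure ℝ) (x : ℝ) : ℝ :=
  ∫ r, x ^ (α - 1) * r / lampertiDenom α x r ∂H

/-- `B^H_{α,2}(x)`. -/
noncomputable def bTwo (α : ℝ) (H : Measure ℝ) (x : ℝ) : ℝ :=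
  ∫ r, x ^ (2 * α - 1) / lampertiDenom α x r ∂H

/-- The explicit function `d_{αθ}(x | ϱ_{α,H})`. -/
noncomputable def dFun (α θ : ℝ) (H : Measure ℝ) (x : ℝ) : ℝ :=
  α * θ / Real.pi * Real.exp (-(θ * α) * logS α H x) *
    (Real.sin (Real.pi * α * (1 - θ * upsilon α H x)) * bOne α H x
      - Real.sin (Real.pi * θ * α * upsilon α H x) * bTwo α H x)

/-! A law on (0, ∞) is determined by its generalized Stieltjes transform ∫ (s + x)^(-p), s > 0, of
any fixed order p > 0: differentiation in s raises the order, and at s = 1 the orders p + k are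
weighted moments of 1/(1 + x) (`Measure.ext_of_integral_rpow_neg_add`). The transform of a Dirichlet
mean is explicit by the Markov–Krein identity E (s + M_θ(G))^(-θ) = exp(-θ ∫ log(s + y) G(dy))
(`integral_dirichletMean_rpow`). It comes from stick-breaking: M = V W + (1 - V) M' in law, and the
Beta integral over V turns this into a linear differential equation in s.

The special feature of ϱ_α is ∫ log(s + y) ϱ_α(dy) = α⁻¹ log(1 + s^α), so the potential of ϱ_{α,H}
at s is α⁻¹ times that of H at s^α. Hence the order αθ transform of M_{αθ}(ϱ_{α,H}) is F(s) = exp(-θ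
∫ log(s^α + r) H(dr)), which is the order θ transform of M_θ(H) at s^α. Since (s^α + b)^(-θ) is
itself the order αθ transform of b^(1/α) M_{αθ}(ϱ_α), the factorization in law follows by
uniqueness.

For the distribution function, write z = e^w with |Im w| ≤ π. Because α < 1, z^α keeps away from the
negative axis even on both edges of the cut, so F is holomorphic up to and across the edges. On the
upper edge over -x its modulus is exp(-θα 𝒮(x)) and its argument -πθα Υ(x), so -(1/π) Im F is
exactly Δ there. Cauchy's formula gives F(s) = ∫ Δ(t)/(s + t) dt (`stieltjes_crDelta`). With p = αθ,
1/(s + t) is p times the order p + 1 transform of (x - t)_+^(p-1), and F is p times the order p + 1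
transform of the distribution function. Uniqueness identifies the latter with the Abel integral of Δ
almost everywhere, and continuity does so everywhere (`measureReal_Iic_eq_abel`).

For the density, Υ and 𝒮 are differentiated under the integral over H, which gives Δ' = d. The Abel
integral is differentiated after a cut at δ > 0: the kernel is differentiated on [0, δ], the
function on [δ, x] (`hasDerivAt_abel`). As δ → 0 the remaining boundary term (x - δ)^(p-1) Δ(δ)
vanishes when Δ(0+) = 0. If log is H-integrable, 𝒮 stays bounded near 0 while Υ(0) = 0, so Δ(0+) =
0; and d is integrable at 0 because B₁ and B₂ are, up to constants, nonnegative derivatives of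
continuous functions. -/

/-! ### Calculus of lower integrals and differentiation of the transforms -/

/-- Fundamental theorem of calculus for the lower integral of a nonnegative derivative. -/
theorem lintegral_Ioc_ofReal_deriv {g g' : ℝ → ℝ} {a b : ℝ} (hab : a ≤ b)
    (hc : ContinuousOn g (Icc a b)) (hd : ∀ x ∈ Ioo a b, HasDerivAt g (g' x) x)
    (h0 : ∀ x ∈ Ioo a b, 0 ≤ g' x) :
    ∫⁻ x in Ioc a b, ENNReal.ofReal (g' x) = ENNReal.ofReal (g b - g a) := by
  have hi : IntegrableOn g' (Ioc a b) :=
    intervalIntegral.integrableOn_deriv_of_nonneg hc hd h0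
  rw [← ofReal_integral_eq_lintegral_ofReal hi, ← intervalIntegral.integral_of_le hab,
    intervalIntegral.integral_eq_sub_of_hasDerivAt_of_le hab hc hd
      ((intervalIntegrable_iff_integrableOn_Ioc_of_le hab).2 hi)]
  rw [← restrict_Ioo_eq_restrict_Ioc]
  exact ae_restrict_of_forall_mem measurableSet_Ioo h0

theorem lintegral_Ioi_ofReal_deriv {g g' : ℝ → ℝ} {a l : ℝ}
    (hc : ContinuousWithinAt g (Ici a) a) (hd : ∀ x ∈ Ioi a, HasDerivAt g (g' x) x)
    (h0 : ∀ x ∈ Ioi a, 0 ≤ g' x) (hl : Tendsto g atTop (𝓝 l)) :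
    ∫⁻ x in Ioi a, ENNReal.ofReal (g' x) = ENNReal.ofReal (l - g a) := by
  have hi : IntegrableOn g' (Ioi a) := integrableOn_Ioi_deriv_of_nonneg hc hd h0 hl
  rw [← ofReal_integral_eq_lintegral_ofReal hi,
    integral_Ioi_of_hasDerivAt_of_nonneg hc hd h0 hl]
  exact ae_restrict_of_forall_mem measurableSet_Ioi h0

theorem measurable_add_rpow (s p : ℝ) : Measurable fun x : ℝ => (s + x) ^ p :=
  (measurable_const.add measurable_id).pow_const _

theorem add_ge_min_mul_one_add {c s x : ℝ} (hs : c ≤ s) (hx : 0 ≤ x) :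
    min c 1 * (1 + x) ≤ s + x := by
  have h1 : min c 1 ≤ c := min_le_left _ _
  have h2 : min c 1 ≤ 1 := min_le_right _ _
  nlinarith

/-- Uniform in s ≥ c, so integrability at s = 1 yields both integrability at every s > 0 and the
domination needed to differentiate in s. -/
theorem rpow_neg_add_le {c s x p : ℝ} (hc : 0 < c) (hs : c ≤ s) (hx : 0 ≤ x) (hp : 0 ≤ p) :
    (s + x) ^ (-p) ≤ (min c 1) ^ (-p) * (1 + x) ^ (-p) := by
  have hm : 0 < min c 1 := lt_min hc one_pos
  rw [← Real.mul_rpow hm.le (by linarith)]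
  exact Real.rpow_le_rpow_of_nonpos (by positivity) (add_ge_min_mul_one_add hs hx) (by linarith)

theorem integrable_rpow_neg_add {μ : Measure ℝ} {p s : ℝ} (hμ : ∀ᵐ x ∂μ, 0 ≤ x) (hp : 0 ≤ p)
    (hi : Integrable (fun x => (1 + x) ^ (-p)) μ) (hs : 0 < s) :
    Integrable (fun x => (s + x) ^ (-p)) μ := by
  refine (hi.const_mul ((min s 1) ^ (-p))).mono' (measurable_add_rpow _ _).aestronglyMeasurable ?_
  filter_upwards [hμ] with x hx
  rw [Real.norm_of_nonneg (Real.rpow_nonneg (by linarith) _)]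
  exact rpow_neg_add_le hs le_rfl hx hp

theorem integrable_rpow_neg_add_one {μ : Measure ℝ} {p : ℝ} (hμ : ∀ᵐ x ∂μ, 0 ≤ x)
    (hi : Integrable (fun x => (1 + x) ^ (-p)) μ) :
    Integrable (fun x => (1 + x) ^ (-(p + 1))) μ := by
  refine hi.mono' (measurable_add_rpow _ _).aestronglyMeasurable ?_
  filter_upwards [hμ] with x hx
  rw [Real.norm_of_nonneg (Real.rpow_nonneg (by linarith) _)]
  exact Real.rpow_le_rpow_of_exponent_le (by linarith) (by linarith)

/-- Differentiation in s raises the order of the transform by one; this drives both the uniqueness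
theorem and the differential equation of the Markov–Krein identity. -/
theorem hasDerivAt_integral_rpow_neg_add {μ : Measure ℝ} {p s : ℝ} (hμ : ∀ᵐ x ∂μ, 0 ≤ x)
    (hp : 0 ≤ p) (hi : Integrable (fun x => (1 + x) ^ (-p)) μ) (hs : 0 < s) :
    HasDerivAt (fun s => ∫ x, (s + x) ^ (-p) ∂μ) (-p * ∫ x, (s + x) ^ (-(p + 1)) ∂μ) s := by
  rw [← integral_const_mul]
  have hi' := integrable_rpow_neg_add_one hμ hi
  refine (hasDerivAt_integral_of_dominated_loc_of_deriv_le (s := Ioi (s / 2))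
    (F := fun s x => (s + x) ^ (-p)) (F' := fun s x => -p * (s + x) ^ (-(p + 1)))
    (bound := fun x => p * ((min (s / 2) 1) ^ (-(p + 1)) * (1 + x) ^ (-(p + 1))))
    (Ioi_mem_nhds (by linarith)) (Eventually.of_forall fun t => ?_)
    (integrable_rpow_neg_add hμ hp hi hs) ?_ ?_ ?_ ?_).2
  · exact (measurable_add_rpow _ _).aestronglyMeasurable
  · exact ((measurable_add_rpow _ _).const_mul _).aestronglyMeasurable
  · filter_upwards [hμ] with x hx t ht
    have ht' : s / 2 < t := ht
    rw [norm_mul, norm_neg, Real.norm_of_nonneg hp,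
      Real.norm_of_nonneg (Real.rpow_nonneg (by linarith) _)]
    exact mul_le_mul_of_nonneg_left
      (rpow_neg_add_le (by linarith) ht'.le hx (by linarith)) hp
  · exact (hi'.const_mul _).const_mul _
  · filter_upwards [hμ] with x hx t ht
    have ht' : s / 2 < t := ht
    have h : HasDerivAt (fun y => (y + x) ^ (-p)) (1 * -p * (t + x) ^ (-p - 1)) t :=
      ((hasDerivAt_id' t).add_const x).rpow_const (p := -p) (Or.inl (by linarith))
    exact h.congr_deriv (by rw [one_mul, neg_add'])

/-! ### Uniqueness for the generalized Stieltjes transform -/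

open BoundedContinuousFunction in
/-- Finite measures on `[0, 1]` with equal moments are equal. -/
theorem Measure.ext_of_moments {μ ν : Measure (Icc (0 : ℝ) 1)} [IsFiniteMeasure μ]
    [IsFiniteMeasure ν] (h : ∀ k : ℕ, ∫ x, (x : ℝ) ^ k ∂μ = ∫ x, (x : ℝ) ^ k ∂ν) : μ = ν := by
  let e : Icc (0 : ℝ) 1 →ᵇ ℝ := mkOfCompact ⟨fun x => (x : ℝ), continuous_subtype_val⟩
  let A : StarSubalgebra ℝ (Icc (0 : ℝ) 1 →ᵇ ℝ) :=
    { toSubalgebra := Algebra.adjoin ℝ {e}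
      star_mem' := fun {a} ha => by
        have hs : star a = a := by
          ext x
          simp
        rwa [hs] }
  refine ext_of_forall_mem_subalgebra_integral_eq_of_polish (𝕜 := ℝ) (A := A) ?_ ?_
  · intro x y hxy
    refine ⟨fun x => (x : ℝ), ⟨toContinuousMapStarₐ ℝ e, ?_, ?_⟩, ?_⟩
    · exact ⟨e, Algebra.subset_adjoin rfl, rfl⟩
    · ext x; rfl
    · exact fun h => hxy (Subtype.ext h)
  · intro g hg
    have hg' : g ∈ Algebra.adjoin ℝ {e} := hg
    -- The algebra generated by the coordinate consists of polynomials, whose integrals are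
    -- combinations of moments.
    rw [Algebra.adjoin_singleton_eq_range_aeval] at hg'
    obtain ⟨p, rfl⟩ := hg'
    have key : ∀ x, (Polynomial.aeval e p) x = p.eval (x : ℝ) := by
      intro x
      clear hg
      induction p using Polynomial.induction_on with
      | C a => simp
      | add p q hp hq =>
        simp only [map_add, coe_add, Pi.add_apply, Polynomial.eval_add]
        rw [hp, hq]
      | monomial n a _ => simp [e]
    change ∫ x, (Polynomial.aeval e p) x ∂μ = ∫ x, (Polynomial.aeval e p) x ∂ν
    simp_rw [key, Polynomial.eval_eq_sum_range]
    have hint : ∀ (κ : Measure (Icc (0 : ℝ) 1)) [IsFiniteMeasure κ] (k : ℕ) (c : ℝ),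
        Integrable (fun x : Icc (0 : ℝ) 1 => c * (x : ℝ) ^ k) κ := by
      intro κ _ k c
      refine Integrable.of_bound (by fun_prop) |c| (Eventually.of_forall fun x => ?_)
      rw [norm_mul, Real.norm_eq_abs, norm_pow, Real.norm_of_nonneg x.2.1]
      exact mul_le_of_le_one_right (abs_nonneg _) (pow_le_one₀ x.2.1 x.2.2)
    rw [integral_finsetSum _ fun k _ => hint μ k _, integral_finsetSum _ fun k _ => hint ν k _]
    simp_rw [integral_const_mul, h]

/-- The transforms `∫ (s + x) ^ (-p) dμ`, `s > 0`, determine `μ` on `[0, ∞)`. -/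
theorem Measure.ext_of_integral_rpow_neg_add {μ ν : Measure ℝ} {p : ℝ} (hp : 0 < p)
    (hμ : ∀ᵐ x ∂μ, 0 ≤ x) (hν : ∀ᵐ x ∂ν, 0 ≤ x)
    (hμi : Integrable (fun x => (1 + x) ^ (-p)) μ) (hνi : Integrable (fun x => (1 + x) ^ (-p)) ν)
    (h : ∀ s, 0 < s → ∫ x, (s + x) ^ (-p) ∂μ = ∫ x, (s + x) ^ (-p) ∂ν) : μ = ν := by
  -- Differentiating the hypothesis k times in s gives equality of the transforms of every order p +
  -- k.
  have step : ∀ k : ℕ, Integrable (fun x => (1 + x) ^ (-(p + k))) μ ∧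
      Integrable (fun x => (1 + x) ^ (-(p + k))) ν ∧
      ∀ s, 0 < s → ∫ x, (s + x) ^ (-(p + k)) ∂μ = ∫ x, (s + x) ^ (-(p + k)) ∂ν := by
    intro k
    induction k with
    | zero => simpa using ⟨hμi, hνi, h⟩
    | succ k ih =>
      obtain ⟨h1, h2, h3⟩ := ih
      rw [Nat.cast_succ, ← add_assoc]
      refine ⟨integrable_rpow_neg_add_one hμ h1, integrable_rpow_neg_add_one hν h2, fun s hs => ?_⟩
      have hpk : 0 < p + k := by positivity
      have d1 := hasDerivAt_integral_rpow_neg_add hμ hpk.le h1 hs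
      have d2 := hasDerivAt_integral_rpow_neg_add hν hpk.le h2 hs
      have d3 := d2.congr_of_eventuallyEq
        (Filter.eventuallyEq_of_mem (Ioi_mem_nhds hs) fun t ht => h3 t ht)
      have := d1.unique d3
      exact mul_left_cancel₀ (a := -(p + k)) (neg_ne_zero.2 hpk.ne') this
  -- In the variable u = 1/(1 + x) and with the weight (1 + x)^(-p), the transform of order p + k at
  -- s = 1 is the k-th moment. The projection to [0, 1] acts only on a null set of negative x.
  let φ : ℝ → Icc (0 : ℝ) 1 := fun x => projIcc 0 1 zero_le_one (1 / (1 + x))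
  have hφ : Measurable φ := continuous_projIcc.measurable.comp (by fun_prop)
  have hφv : ∀ x, 0 ≤ x → (φ x : ℝ) = (1 + x)⁻¹ := by
    intro x hx
    have : 1 / (1 + x) ∈ Icc (0 : ℝ) 1 := ⟨by positivity, by
      rw [div_le_one (by linarith)]; linarith⟩
    simp only [φ, projIcc_of_mem _ this]
    exact one_div _
  let w : ℝ → ENNReal := fun x => ENNReal.ofReal ((1 + x) ^ (-p))
  have hw : Measurable w := (measurable_add_rpow 1 (-p)).ennreal_ofReal
  have hψ : Measurable fun u : Icc (0 : ℝ) 1 => (u : ℝ)⁻¹ - 1 := by fun_prop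
  have fin : ∀ {κ : Measure ℝ}, Integrable (fun x => (1 + x) ^ (-p)) κ →
      IsFiniteMeasure (κ.withDensity w) := fun hi => isFiniteMeasure_withDensity_ofReal hi.2
  have mom : ∀ {κ : Measure ℝ}, (∀ᵐ x ∂κ, 0 ≤ x) → ∀ k : ℕ,
      ∫ x, (x : ℝ) ^ k ∂((κ.withDensity w).map φ) = ∫ x, (1 + x) ^ (-(p + k)) ∂κ := by
    intro κ hκ k
    rw [integral_map hφ.aemeasurable (by fun_prop), integral_withDensity_eq_integral_toReal_smul
      hw (Eventually.of_forall fun x => ENNReal.ofReal_lt_top)]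
    refine integral_congr_ae ?_
    filter_upwards [hκ] with x hx
    have h1 : 0 < 1 + x := by linarith
    rw [ENNReal.toReal_ofReal (Real.rpow_nonneg h1.le _), hφv x hx, smul_eq_mul, neg_add,
      Real.rpow_add h1, Real.rpow_neg h1.le (k : ℝ), Real.rpow_natCast, inv_pow]
  -- Nothing is lost in this passage: u ↦ 1/u - 1 inverts φ on x ≥ 0, and the weight is positive and
  -- finite there.
  have back : ∀ {κ : Measure ℝ}, (∀ᵐ x ∂κ, 0 ≤ x) →
      (((κ.withDensity w).map φ).map fun u : Icc (0 : ℝ) 1 => (u : ℝ)⁻¹ - 1).withDensity w⁻¹ = κ := by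
    intro κ hκ
    have h1 : ((κ.withDensity w).map φ).map (fun u : Icc (0 : ℝ) 1 => (u : ℝ)⁻¹ - 1) = κ.withDensity w := by
      rw [Measure.map_map hψ hφ]
      conv_rhs => rw [← Measure.map_id (μ := κ.withDensity w)]
      refine Measure.map_congr ?_
      filter_upwards [(withDensity_absolutelyContinuous κ w).ae_le hκ] with x hx
      simp [hφv x hx]
    rw [h1]
    refine withDensity_inv_same hw ?_ (Eventually.of_forall fun x => ENNReal.ofReal_ne_top)
    filter_upwards [hκ] with x hx
    exact (ENNReal.ofReal_pos.2 (Real.rpow_pos_of_pos (by linarith) _)).ne'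
  have := fin hμi
  have := fin hνi
  have e : (μ.withDensity w).map φ = (ν.withDensity w).map φ :=
    Measure.ext_of_moments fun k => by rw [mom hμ, mom hν, (step k).2.2 1 one_pos]
  rw [← back hμ, e, back hν]

/-- `Measure.ext_of_integral_rpow_neg_add` in terms of lower integrals. -/
theorem Measure.ext_of_lintegral_rpow_neg_add {μ ν : Measure ℝ} {p : ℝ} (hp : 0 < p)
    (hμ : ∀ᵐ x ∂μ, 0 ≤ x) (hν : ∀ᵐ x ∂ν, 0 ≤ x)
    (hfin : ∫⁻ x, ENNReal.ofReal ((1 + x) ^ (-p)) ∂μ ≠ ⊤)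
    (h : ∀ s, 0 < s → ∫⁻ x, ENNReal.ofReal ((s + x) ^ (-p)) ∂μ =
      ∫⁻ x, ENNReal.ofReal ((s + x) ^ (-p)) ∂ν) : μ = ν := by
  have nn : ∀ {κ : Measure ℝ}, (∀ᵐ x ∂κ, 0 ≤ x) → ∀ s, 0 < s →
      0 ≤ᵐ[κ] fun x => (s + x) ^ (-p) := fun hκ s hs => by
    filter_upwards [hκ] with x hx
    exact Real.rpow_nonneg (by linarith) _
  have int : ∀ {κ : Measure ℝ}, (∀ᵐ x ∂κ, 0 ≤ x) →
      ∫⁻ x, ENNReal.ofReal ((1 + x) ^ (-p)) ∂κ ≠ ⊤ → Integrable (fun x => (1 + x) ^ (-p)) κ :=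
    fun hκ hf => ⟨(measurable_add_rpow _ _).aestronglyMeasurable,
      (hasFiniteIntegral_iff_ofReal (nn hκ 1 one_pos)).2 hf.lt_top⟩
  refine Measure.ext_of_integral_rpow_neg_add hp hμ hν (int hμ hfin)
    (int hν (h 1 one_pos ▸ hfin)) fun s hs => ?_
  rw [integral_eq_lintegral_of_nonneg_ae (nn hμ s hs) (measurable_add_rpow _ _).aestronglyMeasurable,
    integral_eq_lintegral_of_nonneg_ae (nn hν s hs) (measurable_add_rpow _ _).aestronglyMeasurable,
    h s hs]

/-! ### Stick-breaking series -/

/-- Prepend a value to a sequence. -/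
def seqCons {X : Type*} (p : X × (ℕ → X)) : ℕ → X
  | 0 => p.1
  | n + 1 => p.2 n

theorem measurable_seqCons {X : Type*} [MeasurableSpace X] :
    Measurable (seqCons : X × (ℕ → X) → ℕ → X) := by
  refine measurable_pi_iff.2 fun n => ?_
  cases n with
  | zero => exact measurable_fst
  | succ n => exact (measurable_pi_apply n).comp measurable_snd

/-- It suffices to compare cylinder boxes. A box over s is a condition on coordinate 0, empty when 0
∉ s, times a box over the remaining indices shifted down by one. -/
theorem map_seqCons_infinitePi {X : Type*} [MeasurableSpace X] (μ : Measure X)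
    [IsProbabilityMeasure μ] :
    (μ.prod (Measure.infinitePi fun _ : ℕ => μ)).map seqCons = Measure.infinitePi fun _ => μ := by
  classical
  refine Measure.eq_infinitePi _ fun s t ht => ?_
  rw [Measure.map_apply measurable_seqCons (.pi s.countable_toSet fun i _ => ht i)]
  set s' : Finset ℕ := s.preimage Nat.succ Nat.succ_injective.injOn
  have h1 : seqCons ⁻¹' (Set.pi s t) =
      (if 0 ∈ s then t 0 else univ) ×ˢ Set.pi (s' : Set ℕ) fun i => t (i + 1) := by
    ext ⟨x, ω⟩
    simp only [mem_preimage, Set.mem_pi, mem_prod, s', Finset.coe_preimage, Finset.mem_coe]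
    constructor
    · intro h
      refine ⟨?_, fun i hi => h (i + 1) hi⟩
      split_ifs with h0
      · exact h 0 h0
      · trivial
    · rintro ⟨h0, h⟩ i hi
      cases i with
      | zero => rwa [if_pos hi] at h0
      | succ n => exact h n hi
  rw [h1, Measure.prod_prod, Measure.infinitePi_pi _ fun i _ => ht _]
  have h2 : ∏ i ∈ s', μ (t (i + 1)) = ∏ i ∈ s.erase 0, μ (t i) := by
    refine Finset.prod_bij (fun i _ => i + 1) (fun i hi => ?_) (fun _ _ _ _ h => by omega)
      (fun b hb => ?_) fun _ _ => rfl
    · simpa [s'] using hi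
    · obtain ⟨hb0, hb⟩ := Finset.mem_erase.1 hb
      obtain ⟨n, rfl⟩ := Nat.exists_eq_succ_of_ne_zero hb0
      exact ⟨n, by simpa [s'] using hb, rfl⟩
  rw [h2]
  split_ifs with h0
  · rw [Finset.mul_prod_erase s (fun i => μ (t i)) h0]
  · rw [measure_univ, one_mul, Finset.erase_eq_of_notMem h0]

theorem lintegral_infinitePi_eq_seqCons {X : Type*} [MeasurableSpace X] (μ : Measure X)
    [IsProbabilityMeasure μ] {f : (ℕ → X) → ENNReal} (hf : Measurable f) :
    ∫⁻ ω, f ω ∂Measure.infinitePi (fun _ : ℕ => μ) =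
      ∫⁻ x, ∫⁻ ω, f (seqCons (x, ω)) ∂Measure.infinitePi (fun _ : ℕ => μ) ∂μ := by
  conv_lhs => rw [← map_seqCons_infinitePi]
  rw [lintegral_map hf measurable_seqCons,
    lintegral_prod (fun p => f (seqCons p)) (hf.comp measurable_seqCons).aemeasurable]

theorem ae_infinitePi_of_ae {X : Type*} [MeasurableSpace X] {μ : Measure X}
    [IsProbabilityMeasure μ] {P : X → Prop} (h : ∀ᵐ x ∂μ, P x) :
    ∀ᵐ ω ∂Measure.infinitePi (fun _ : ℕ => μ), ∀ k, P (ω k) :=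
  ae_all_iff.2 fun k =>
    (measurePreserving_eval_infinitePi (fun _ : ℕ => μ) k).quasiMeasurePreserving.ae h

theorem measurable_betaPDF (a b : ℝ) : Measurable (betaPDF a b) :=
  (measurable_betaPDFReal a b).ennreal_ofReal

theorem ae_betaMeasure_mem_Ioo (a b : ℝ) : ∀ᵐ v ∂betaMeasure a b, v ∈ Ioo (0 : ℝ) 1 := by
  rw [betaMeasure, ae_withDensity_iff (measurable_betaPDF a b)]
  refine Eventually.of_forall fun v hv => ?_
  by_contra h
  refine hv ?_
  rw [betaPDF_eq, if_neg (show ¬(0 < v ∧ v < 1) from h), ENNReal.ofReal_zero]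

theorem betaPDF_one_left {θ v : ℝ} (hθ : 0 < θ) (hv : v ∈ Ioo (0 : ℝ) 1) :
    betaPDF 1 θ v = ENNReal.ofReal (θ * (1 - v) ^ (θ - 1)) := by
  have h : beta 1 θ = θ⁻¹ := by
    rw [beta, Real.Gamma_one, one_mul, add_comm, Real.Gamma_add_one hθ.ne']
    have := Real.Gamma_pos_of_pos hθ
    field_simp
  rw [betaPDF_of_pos_lt_one hv.1 hv.2, h]
  simp

/-- `∫ (v a + (1 - v) b) ^ (-(1 + θ)) Beta(1, θ)(dv) = a⁻¹ b ^ (-θ)`. -/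
theorem lintegral_betaMeasure_rpow {θ a b : ℝ} (hθ : 0 < θ) (ha : 0 < a) (hb : 0 < b) :
    ∫⁻ v, ENNReal.ofReal ((v * a + (1 - v) * b) ^ (-(θ + 1))) ∂betaMeasure 1 θ =
      ENNReal.ofReal (a⁻¹) * ENNReal.ofReal (b ^ (-θ)) := by
  have hden : ∀ v ∈ Icc (0 : ℝ) 1, 0 < v * a + (1 - v) * b := by
    rintro v ⟨h0, h1⟩
    rcases h0.eq_or_lt with rfl | h0
    · simpa using hb
    · have : 0 ≤ (1 - v) * b := mul_nonneg (by linarith) hb.le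
      positivity
  have hsplit : ∫⁻ v, ENNReal.ofReal ((v * a + (1 - v) * b) ^ (-(θ + 1))) ∂betaMeasure 1 θ =
      ∫⁻ v in Ioc 0 1, ENNReal.ofReal
        (θ * (1 - v) ^ (θ - 1) * (v * a + (1 - v) * b) ^ (-(θ + 1))) := by
    rw [betaMeasure, lintegral_withDensity_eq_lintegral_mul _
      (measurable_betaPDF 1 θ) (Measurable.ennreal_ofReal (Measurable.pow_const
        (f := fun v : ℝ => v * a + (1 - v) * b) (by fun_prop) _)),
      ← restrict_Ioo_eq_restrict_Ioc, ← lintegral_indicator measurableSet_Ioo]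
    refine lintegral_congr fun v => ?_
    by_cases hv : v ∈ Ioo (0 : ℝ) 1
    · have h1 : 0 ≤ θ * (1 - v) ^ (θ - 1) :=
        mul_nonneg hθ.le (Real.rpow_nonneg (by linarith [hv.2]) _)
      rw [indicator_of_mem hv, ENNReal.ofReal_mul h1, Pi.mul_apply, betaPDF_one_left hθ hv]
    · rw [indicator_of_notMem hv, Pi.mul_apply, betaPDF_eq,
        if_neg (show ¬(0 < v ∧ v < 1) from hv), ENNReal.ofReal_zero,
        zero_mul]
  rw [hsplit, ← ENNReal.ofReal_mul (by positivity)]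
  -- The integrand has an explicit primitive: the quotient (1 - v)/(v a + (1 - v) b) has derivative
  -- -a/(v a + (1 - v) b)², so its θ-th power divided by -a works. The primitive vanishes at v = 1
  -- and equals -a⁻¹ b^(-θ) at v = 0.
  have hcont : ContinuousOn (fun v : ℝ => -a⁻¹ * ((1 - v) / (v * a + (1 - v) * b)) ^ θ)
      (Icc 0 1) := by
    refine ContinuousOn.mul continuousOn_const (ContinuousOn.rpow_const ?_ fun _ _ => Or.inr hθ.le)
    exact ContinuousOn.div (by fun_prop) (by fun_prop) fun v hv => (hden v hv).ne'
  rw [lintegral_Ioc_ofReal_deriv (g := fun v => -a⁻¹ * ((1 - v) / (v * a + (1 - v) * b)) ^ θ)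
    zero_le_one hcont]
  · congr 1
    simp [Real.zero_rpow hθ.ne', Real.inv_rpow hb.le, Real.rpow_neg hb.le]
  · intro v hv
    have hd := hden v ⟨hv.1.le, hv.2.le⟩
    have h1 : 0 < 1 - v := by linarith [hv.2]
    have e1 : HasDerivAt (fun v : ℝ => 1 - v) (-1) v := by
      simpa using (hasDerivAt_id' v).const_sub 1
    have e2 : HasDerivAt (fun v : ℝ => v * a + (1 - v) * b) (1 * a + -1 * b) v :=
      ((hasDerivAt_id' v).mul_const a).add (e1.mul_const b)
    have e3 := ((e1.div e2 hd.ne').rpow_const (p := θ)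
      (Or.inl (div_pos h1 hd).ne')).const_mul (-a⁻¹)
    refine e3.congr_deriv ?_
    simp only [Pi.div_apply]
    set d := v * a + (1 - v) * b with hdd
    have e4 : (-1 * d - (1 - v) * (1 * a + -1 * b)) = -a := by rw [hdd]; ring
    rw [e4, Real.div_rpow h1.le hd.le, Real.rpow_neg hd.le, Real.rpow_sub_one hd.ne',
      Real.rpow_add_one hd.ne']
    have := (Real.rpow_pos_of_pos hd θ).ne'
    field_simp
  · intro v hv
    exact mul_nonneg (mul_nonneg hθ.le (Real.rpow_nonneg (by linarith [hv.2]) _))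
      (Real.rpow_nonneg (hden v ⟨hv.1.le, hv.2.le⟩).le _)

theorem stickWeight_seqCons_zero (v : ℝ) (V : ℕ → ℝ) : stickWeight (seqCons (v, V)) 0 = v := by
  simp [stickWeight, seqCons]

theorem stickWeight_seqCons_succ (v : ℝ) (V : ℕ → ℝ) (k : ℕ) :
    stickWeight (seqCons (v, V)) (k + 1) = (1 - v) * stickWeight V k := by
  simp only [stickWeight, Finset.prod_range_succ', seqCons]
  ring

theorem measurable_stickWeight (k : ℕ) : Measurable fun V : ℕ → ℝ => stickWeight V k := by
  unfold stickWeight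
  exact (measurable_pi_apply k).mul
    (Finset.measurable_prod _ fun j _ => measurable_const.sub (measurable_pi_apply j))

/-- The stick-breaking series as an extended nonnegative number. -/
noncomputable def stickSum (ω : (ℕ → ℝ) × (ℕ → ℝ)) : ENNReal :=
  ∑' k, ENNReal.ofReal (stickWeight ω.1 k * ω.2 k)

theorem measurable_stickSum : Measurable stickSum :=
  Measurable.tsum fun k => (((measurable_stickWeight k).comp measurable_fst).mul
    ((measurable_pi_apply k).comp measurable_snd)).ennreal_ofReal

/-- The pathwise form of M = V W + (1 - V) M'. In `ENNReal` it needs no summability. -/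
theorem stickSum_seqCons {v w : ℝ} {V W : ℕ → ℝ} (hv : v ≤ 1) :
    stickSum (seqCons (v, V), seqCons (w, W)) =
      ENNReal.ofReal (v * w) + ENNReal.ofReal (1 - v) * stickSum (V, W) := by
  simp only [stickSum]
  rw [tsum_eq_zero_add' ENNReal.summable, ← ENNReal.tsum_mul_left]
  congr 1
  · simp only [stickWeight_seqCons_zero, seqCons]
  · refine tsum_congr fun k => ?_
    simp only [stickWeight_seqCons_succ, seqCons]
    rw [← ENNReal.ofReal_mul (by linarith), mul_assoc]

/-- V > 0 almost surely, so the expected factor by which each break shrinks the remaining stick is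
strictly below 1. -/
theorem lintegral_one_sub_betaMeasure_lt_one {θ : ℝ} (hθ : 0 < θ) :
    ∫⁻ v, ENNReal.ofReal (1 - v) ∂betaMeasure 1 θ < 1 := by
  have := isProbabilityMeasureBeta one_pos hθ
  have h1 : ∫⁻ v, ENNReal.ofReal (1 - v) ∂betaMeasure 1 θ +
      ∫⁻ v, ENNReal.ofReal v ∂betaMeasure 1 θ = 1 := by
    rw [← lintegral_add_right _ (by fun_prop)]
    rw [← measure_univ (μ := betaMeasure 1 θ), ← lintegral_one]
    refine lintegral_congr_ae ?_
    filter_upwards [ae_betaMeasure_mem_Ioo 1 θ] with v hv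
    rw [← ENNReal.ofReal_add (by linarith [hv.2]) hv.1.le]
    simp
  have h2 : ∫⁻ v, ENNReal.ofReal v ∂betaMeasure 1 θ ≠ 0 := by
    intro h
    rw [lintegral_eq_zero_iff (by fun_prop)] at h
    have : ∀ᵐ v ∂betaMeasure 1 θ, False := by
      filter_upwards [h, ae_betaMeasure_mem_Ioo 1 θ] with v h1 h2
      exact (ENNReal.ofReal_pos.2 h2.1).ne' h1
    simp at this
    exact IsProbabilityMeasure.ne_zero _ this
  rw [← h1]
  exact ENNReal.lt_add_right (fun h => by simp [h] at h1) h2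

theorem lintegral_prod_one_sub {θ : ℝ} [IsProbabilityMeasure (betaMeasure 1 θ)]
    (k : ℕ) :
    ∫⁻ V, ENNReal.ofReal (∏ j ∈ Finset.range k, (1 - V j))
      ∂Measure.infinitePi (fun _ : ℕ => betaMeasure 1 θ) =
      (∫⁻ v, ENNReal.ofReal (1 - v) ∂betaMeasure 1 θ) ^ k := by
  have hm : ∀ k, Measurable fun V : ℕ → ℝ =>
      ENNReal.ofReal (∏ j ∈ Finset.range k, (1 - V j)) := fun k =>
    (Finset.measurable_prod _ fun j _ =>
      measurable_const.sub (measurable_pi_apply j)).ennreal_ofReal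
  induction k with
  | zero => simp
  | succ k ih =>
    rw [lintegral_infinitePi_eq_seqCons _ (hm _), pow_succ', ← ih, ← lintegral_mul_const _
      (by fun_prop)]
    refine lintegral_congr_ae ?_
    filter_upwards [ae_betaMeasure_mem_Ioo 1 θ] with v hv
    rw [← lintegral_const_mul _ (hm k)]
    refine lintegral_congr fun V => ?_
    rw [← ENNReal.ofReal_mul (by linarith [hv.2]), Finset.prod_range_succ', mul_comm]
    rfl

/-- The sticks decay geometrically. -/
theorem ae_eventually_prod_one_sub_le {θ : ℝ} (hθ : 0 < θ)
    [IsProbabilityMeasure (betaMeasure 1 θ)] :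
    ∃ r : ℝ, 0 < r ∧ r < 1 ∧ ∀ᵐ V ∂Measure.infinitePi (fun _ : ℕ => betaMeasure 1 θ),
      ∀ᶠ k in atTop, ∏ j ∈ Finset.range k, (1 - V j) ≤ r ^ k := by
  obtain ⟨q, hq⟩ : ∃ q, q = ∫⁻ v, ENNReal.ofReal (1 - v) ∂betaMeasure 1 θ := ⟨_, rfl⟩
  have hq1 : q < 1 := hq ▸ lintegral_one_sub_betaMeasure_lt_one hθ
  -- With q the mean of 1 - V, any r strictly between q and 1 makes the expectation of ∑ r^(-k) ∏ (1
  -- - V j) equal to the convergent series ∑ (q/r)^k. The terms then tend to 0 almost surely, and in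
  -- particular are eventually below 1.
  obtain ⟨r, hr0, hqr, hr1⟩ : ∃ r : ℝ, 0 < r ∧ q < ENNReal.ofReal r ∧ r < 1 := by
    obtain ⟨r, h1, h2⟩ := ENNReal.lt_iff_exists_nnreal_btwn.1 hq1
    refine ⟨r, ?_, by simpa using h1, by exact_mod_cast h2⟩
    exact_mod_cast (zero_le.trans_lt h1)
  refine ⟨r, hr0, hr1, ?_⟩
  have hm : ∀ k, Measurable fun V : ℕ → ℝ =>
      ENNReal.ofReal (∏ j ∈ Finset.range k, (1 - V j)) := fun k =>
    (Finset.measurable_prod _ fun j _ =>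
      measurable_const.sub (measurable_pi_apply j)).ennreal_ofReal
  have hR0 : ENNReal.ofReal r ≠ 0 := (ENNReal.ofReal_pos.2 hr0).ne'
  have hRt : ENNReal.ofReal r ≠ ⊤ := ENNReal.ofReal_ne_top
  have hfin : ∫⁻ V, ∑' k, ENNReal.ofReal (∏ j ∈ Finset.range k, (1 - V j)) *
      (ENNReal.ofReal r ^ k)⁻¹ ∂Measure.infinitePi (fun _ : ℕ => betaMeasure 1 θ) ≠ ⊤ := by
    rw [lintegral_tsum fun k => ((hm k).mul_const _).aemeasurable]
    simp_rw [lintegral_mul_const _ (hm _), lintegral_prod_one_sub, ← hq, ENNReal.inv_pow,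
      ← mul_pow, ENNReal.tsum_geometric]
    refine ENNReal.inv_ne_top.2 (tsub_pos_of_lt ?_).ne'
    rw [← div_eq_mul_inv]
    exact (ENNReal.div_lt_iff (Or.inl hR0) (Or.inl hRt)).2 (by simpa using hqr)
  filter_upwards [ae_lt_top (Measurable.tsum fun k => (hm k).mul_const _) hfin] with V hV
  have ht := ENNReal.tendsto_atTop_zero_of_tsum_ne_top hV.ne
  filter_upwards [ht.eventually_lt_const (zero_lt_one)] with k hk
  have h1 : ENNReal.ofReal (∏ j ∈ Finset.range k, (1 - V j)) < ENNReal.ofReal (r ^ k) := by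
    rw [← ENNReal.ofReal_pow hr0.le] at hk
    have h2 := (ENNReal.div_lt_iff (Or.inl (ENNReal.ofReal_pos.2 (pow_pos hr0 k)).ne')
      (Or.inl ENNReal.ofReal_ne_top)).1 hk
    simpa using h2
  exact ((ENNReal.ofReal_lt_ofReal_iff (pow_pos hr0 k)).1 h1).le

/-- Logarithmic moments force subexponential growth of iid sequences. -/
theorem ae_eventually_le_pow {G : Measure ℝ} [IsProbabilityMeasure G]
    (hpos : ∀ᵐ y ∂G, 0 < y) (hlog : Integrable (fun y => Real.log (1 + y)) G)
    {κ : ℝ} (hκ : 1 < κ) :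
    ∀ᵐ W ∂Measure.infinitePi (fun _ : ℕ => G), ∀ᶠ k in atTop, W k ≤ κ ^ k := by
  have hc : 0 < Real.log κ := Real.log_pos hκ
  -- Finiteness of the mean of X makes ∑ P(X > j) converge; Borel–Cantelli then gives log(1 + W k) ≤
  -- k log κ eventually.
  let X : ℝ → ℝ := fun y => |Real.log (1 + y)| / Real.log κ
  have hX : Measurable X := by fun_prop
  have h1 : (∑' j : ℕ, G {y | X y ∈ Ioi (j : ℝ)}) < ⊤ :=
    @tsum_prob_mem_Ioi_lt_top ℝ ⟨G⟩ ‹_› X (hlog.abs.div_const _)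
      (fun y => div_nonneg (abs_nonneg _) hc.le)
  have h2 : (∑' j : ℕ, Measure.infinitePi (fun _ : ℕ => G) {W | X (W j) ∈ Ioi (j : ℝ)}) ≠ ⊤ := by
    have h3 : ∀ j : ℕ, Measure.infinitePi (fun _ : ℕ => G) {W | X (W j) ∈ Ioi (j : ℝ)} =
        G {y | X y ∈ Ioi (j : ℝ)} := fun j =>
      (measurePreserving_eval_infinitePi (fun _ : ℕ => G) j).measure_preimage
        (hX measurableSet_Ioi).nullMeasurableSet
    simpa only [h3] using h1.ne
  filter_upwards [ae_eventually_notMem h2, ae_infinitePi_of_ae hpos] with W hW hW0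
  filter_upwards [hW] with k hk
  have h3 : X (W k) ≤ k := by simpa using hk
  have h4 : Real.log (1 + W k) ≤ k * Real.log κ :=
    (le_abs_self _).trans ((div_le_iff₀ hc).1 h3)
  rw [← Real.log_pow] at h4
  have := (Real.log_le_log_iff (by linarith [hW0 k]) (by positivity)).1 h4
  linarith

/-- The remaining sticks are eventually at most r^k, and the logarithmic moment allows W k to be at
most r^(-k/2) eventually, so the terms are dominated by r^(k/2). -/
theorem ae_summable_stick {θ : ℝ} (hθ : 0 < θ) [IsProbabilityMeasure (betaMeasure 1 θ)]
    {G : Measure ℝ} [IsProbabilityMeasure G]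
    (hpos : ∀ᵐ y ∂G, 0 < y) (hlog : Integrable (fun y => Real.log (1 + y)) G) :
    ∀ᵐ ω ∂(Measure.infinitePi fun _ : ℕ => betaMeasure 1 θ).prod
      (Measure.infinitePi fun _ : ℕ => G),
      (∀ k, 0 < stickWeight ω.1 k * ω.2 k) ∧ Summable fun k => stickWeight ω.1 k * ω.2 k := by
  obtain ⟨r, hr0, hr1, hr⟩ := ae_eventually_prod_one_sub_le hθ
  have hs0 : 0 < √r := Real.sqrt_pos.2 hr0
  have hs1 : √r < 1 := (Real.sqrt_lt' one_pos).2 (by simpa using hr1)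
  have hs2 : 1 < (√r)⁻¹ := (one_lt_inv₀ hs0).2 hs1
  filter_upwards [Measure.quasiMeasurePreserving_fst.ae hr,
    Measure.quasiMeasurePreserving_fst.ae (ae_infinitePi_of_ae (ae_betaMeasure_mem_Ioo 1 θ)),
    Measure.quasiMeasurePreserving_snd.ae (ae_eventually_le_pow hpos hlog hs2),
    Measure.quasiMeasurePreserving_snd.ae (ae_infinitePi_of_ae hpos)] with ω h1 h2 h3 h4
  have hP : ∀ k, 0 < ∏ j ∈ Finset.range k, (1 - ω.1 j) := fun k =>
    Finset.prod_pos fun j _ => by linarith [(h2 j).2]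
  have hpos' : ∀ k, 0 < stickWeight ω.1 k * ω.2 k := fun k =>
    mul_pos (mul_pos (h2 k).1 (hP k)) (h4 k)
  refine ⟨hpos', ?_⟩
  refine Summable.of_norm_bounded_eventually_nat (summable_geometric_of_lt_one hs0.le hs1) ?_
  filter_upwards [h1, h3] with k hk1 hk3
  rw [Real.norm_of_nonneg (hpos' k).le]
  calc stickWeight ω.1 k * ω.2 k ≤ (r ^ k) * ((√r)⁻¹) ^ k := by
        refine mul_le_mul ?_ hk3 (h4 k).le (by positivity)
        refine le_trans ?_ hk1
        exact mul_le_of_le_one_left (hP k).le (h2 k).2.le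
    _ = √r ^ k := by
        rw [← mul_pow]
        congr 1
        rw [← div_eq_mul_inv, Real.div_sqrt]

/-! ### The Markov–Krein identity -/

/-- The extended series may replace the real one because the terms are almost surely positive and
summable, so neither `tsum` nor `toReal` takes its default value. -/
theorem dirichletMean_eq_map {θ : ℝ} (hθ : 0 < θ) [IsProbabilityMeasure (betaMeasure 1 θ)]
    {G : Measure ℝ} [IsProbabilityMeasure G]
    (hpos : ∀ᵐ y ∂G, 0 < y) (hlog : Integrable (fun y => Real.log (1 + y)) G) :
    dirichletMean θ G = ((Measure.infinitePi fun _ : ℕ => betaMeasure 1 θ).prod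
      (Measure.infinitePi fun _ : ℕ => G)).map fun ω => (stickSum ω).toReal := by
  rw [dirichletMean, dif_pos ⟨hθ, ‹_›⟩]
  refine Measure.map_congr ?_
  filter_upwards [ae_summable_stick hθ hpos hlog] with ω hω
  rw [stickSum, ← ENNReal.ofReal_tsum_of_nonneg (fun k => (hω.1 k).le) hω.2,
    ENNReal.toReal_ofReal (tsum_nonneg fun k => (hω.1 k).le)]

theorem isProbabilityMeasure_dirichletMean {θ : ℝ} (hθ : 0 < θ)
    {G : Measure ℝ} [IsProbabilityMeasure G]
    (hpos : ∀ᵐ y ∂G, 0 < y) (hlog : Integrable (fun y => Real.log (1 + y)) G) :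
    IsProbabilityMeasure (dirichletMean θ G) := by
  have := isProbabilityMeasureBeta one_pos hθ
  rw [dirichletMean_eq_map hθ hpos hlog]
  exact Measure.isProbabilityMeasure_map measurable_stickSum.ennreal_toReal.aemeasurable

theorem ae_stickSum_lt_top {θ : ℝ} (hθ : 0 < θ) [IsProbabilityMeasure (betaMeasure 1 θ)]
    {G : Measure ℝ} [IsProbabilityMeasure G]
    (hpos : ∀ᵐ y ∂G, 0 < y) (hlog : Integrable (fun y => Real.log (1 + y)) G) :
    ∀ᵐ ω ∂(Measure.infinitePi fun _ : ℕ => betaMeasure 1 θ).prod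
      (Measure.infinitePi fun _ : ℕ => G), 0 < stickSum ω ∧ stickSum ω < ⊤ := by
  filter_upwards [ae_summable_stick hθ hpos hlog] with ω hω
  rw [stickSum, ← ENNReal.ofReal_tsum_of_nonneg (fun k => (hω.1 k).le) hω.2]
  exact ⟨ENNReal.ofReal_pos.2 (hω.2.tsum_pos (fun k => (hω.1 k).le) 0 (hω.1 0)),
    ENNReal.ofReal_lt_top⟩

theorem ae_dirichletMean_pos {θ : ℝ} (hθ : 0 < θ)
    {G : Measure ℝ} [IsProbabilityMeasure G]
    (hpos : ∀ᵐ y ∂G, 0 < y) (hlog : Integrable (fun y => Real.log (1 + y)) G) :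
    ∀ᵐ x ∂dirichletMean θ G, 0 < x := by
  have := isProbabilityMeasureBeta one_pos hθ
  rw [dirichletMean_eq_map hθ hpos hlog,
    ae_map_iff measurable_stickSum.ennreal_toReal.aemeasurable measurableSet_Ioi]
  filter_upwards [ae_stickSum_lt_top hθ hpos hlog] with ω hω
  exact ENNReal.toReal_pos hω.1.ne' hω.2.ne

/-- The distributional equation `M = V W + (1 - V) M'`. -/
theorem lintegral_dirichletMean_eq {θ : ℝ} (hθ : 0 < θ)
    {G : Measure ℝ} [IsProbabilityMeasure G]
    (hpos : ∀ᵐ y ∂G, 0 < y) (hlog : Integrable (fun y => Real.log (1 + y)) G)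
    {f : ℝ → ENNReal} (hf : Measurable f) :
    ∫⁻ x, f x ∂dirichletMean θ G =
      ∫⁻ v, ∫⁻ w, ∫⁻ m, f (v * w + (1 - v) * m) ∂dirichletMean θ G ∂G ∂betaMeasure 1 θ := by
  have := isProbabilityMeasureBeta one_pos hθ
  have hS : Measurable fun ω => (stickSum ω).toReal := measurable_stickSum.ennreal_toReal
  have hfS : Measurable fun ω => f (stickSum ω).toReal := hf.comp hS
  have hc : Measurable (seqCons : ℝ × (ℕ → ℝ) → ℕ → ℝ) := measurable_seqCons
  rw [dirichletMean_eq_map hθ hpos hlog, lintegral_map hf hS,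
    lintegral_prod _ hfS.aemeasurable, lintegral_infinitePi_eq_seqCons _ hfS.lintegral_prod_right']
  refine lintegral_congr_ae ?_
  filter_upwards [ae_betaMeasure_mem_Ioo 1 θ] with v hv
  have h1 : ∀ V, ∫⁻ W, f (stickSum (seqCons (v, V), W)).toReal
      ∂Measure.infinitePi (fun _ : ℕ => G) =
      ∫⁻ w, ∫⁻ W, f (stickSum (seqCons (v, V), seqCons (w, W))).toReal
        ∂Measure.infinitePi (fun _ : ℕ => G) ∂G := fun V =>
    lintegral_infinitePi_eq_seqCons G (hfS.comp measurable_prodMk_left)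
  simp_rw [h1]
  have hmeas : Measurable fun p : ((ℕ → ℝ) × ℝ) × (ℕ → ℝ) =>
      f (stickSum (seqCons (v, p.1.1), seqCons (p.1.2, p.2))).toReal :=
    hfS.comp ((hc.comp (by fun_prop)).prodMk (hc.comp (by fun_prop)))
  rw [lintegral_lintegral_swap hmeas.lintegral_prod_right'.aemeasurable]
  refine lintegral_congr_ae ?_
  filter_upwards [hpos] with w hw
  have hg : Measurable fun m => f (v * w + (1 - v) * m) := by fun_prop
  rw [lintegral_map hg hS]
  have h2 := lintegral_prod (μ := Measure.infinitePi fun _ : ℕ => betaMeasure 1 θ)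
    (ν := Measure.infinitePi fun _ : ℕ => G)
    (fun ω => f (stickSum (seqCons (v, ω.1), seqCons (w, ω.2))).toReal)
    (hfS.comp ((hc.comp (by fun_prop)).prodMk (hc.comp (by fun_prop)))).aemeasurable
  rw [← h2]
  refine lintegral_congr_ae ?_
  filter_upwards [ae_stickSum_lt_top hθ hpos hlog] with ω hω
  rw [stickSum_seqCons hv.2.le, ENNReal.toReal_add ENNReal.ofReal_ne_top
    (ENNReal.mul_ne_top ENNReal.ofReal_ne_top hω.2.ne), ENNReal.toReal_mul,
    ENNReal.toReal_ofReal (mul_nonneg hv.1.le hw.le),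
    ENNReal.toReal_ofReal (by linarith [hv.2])]

/-- In the distributional equation, s + v w + (1 - v) m = v (s + w) + (1 - v)(s + m), and at the
exponent θ + 1 the Beta(1, θ) integral over v separates the factors in w and m. -/
theorem lintegral_dirichletMean_succ {θ : ℝ} (hθ : 0 < θ)
    {G : Measure ℝ} [IsProbabilityMeasure G]
    (hpos : ∀ᵐ y ∂G, 0 < y) (hlog : Integrable (fun y => Real.log (1 + y)) G)
    {s : ℝ} (hs : 0 < s) :
    ∫⁻ x, ENNReal.ofReal ((s + x) ^ (-(θ + 1))) ∂dirichletMean θ G =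
      (∫⁻ y, ENNReal.ofReal ((s + y) ^ (-1 : ℝ)) ∂G) *
        ∫⁻ x, ENNReal.ofReal ((s + x) ^ (-θ)) ∂dirichletMean θ G := by
  have := isProbabilityMeasureBeta one_pos hθ
  have := isProbabilityMeasure_dirichletMean hθ hpos hlog
  have hp : ∀ q : ℝ, Measurable fun x : ℝ => ENNReal.ofReal ((s + x) ^ q) := fun q =>
    (measurable_add_rpow s q).ennreal_ofReal
  have hm : Measurable fun p : (ℝ × ℝ) × ℝ =>
      ENNReal.ofReal ((s + (p.1.1 * p.1.2 + (1 - p.1.1) * p.2)) ^ (-(θ + 1))) :=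
    (hp _).comp (by fun_prop)
  rw [lintegral_dirichletMean_eq hθ hpos hlog (hp _),
    lintegral_lintegral_swap hm.lintegral_prod_right'.aemeasurable,
    ← lintegral_mul_const _ (hp _)]
  refine lintegral_congr_ae ?_
  filter_upwards [hpos] with w hw
  have hm' : Measurable fun p : ℝ × ℝ =>
      ENNReal.ofReal ((s + (p.1 * w + (1 - p.1) * p.2)) ^ (-(θ + 1))) :=
    (hp _).comp (by fun_prop)
  rw [lintegral_lintegral_swap hm'.aemeasurable, ← lintegral_const_mul _ (hp _)]
  refine lintegral_congr_ae ?_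
  filter_upwards [ae_dirichletMean_pos hθ hpos hlog] with m hm0
  rw [Real.rpow_neg_one, ← lintegral_betaMeasure_rpow hθ (by linarith : 0 < s + w)
    (by linarith : 0 < s + m)]
  refine lintegral_congr fun v => ?_
  congr 2
  ring

theorem measurable_log_add (s : ℝ) : Measurable fun y : ℝ => Real.log (s + y) :=
  Real.measurable_log.comp (by fun_prop)

theorem abs_log_add_le {s y : ℝ} (hs : 0 < s) (hy : 0 ≤ y) :
    |Real.log (s + y)| ≤ Real.log (1 + y) + |Real.log s| := by
  have h1 : 0 ≤ Real.log (1 + y) := Real.log_nonneg (by linarith)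
  rw [abs_le]
  constructor
  · have : Real.log s ≤ Real.log (s + y) := Real.log_le_log hs (by linarith)
    linarith [neg_abs_le (Real.log s)]
  · rcases le_total s 1 with h | h
    · have : Real.log (s + y) ≤ Real.log (1 + y) := Real.log_le_log (by linarith) (by linarith)
      linarith [abs_nonneg (Real.log s)]
    · have : Real.log (s + y) ≤ Real.log (s * (1 + y)) :=
        Real.log_le_log (by linarith) (by nlinarith)
      rw [Real.log_mul hs.ne' (by linarith)] at this
      linarith [le_abs_self (Real.log s)]

theorem integrable_log_add {G : Measure ℝ} [IsFiniteMeasure G] (hpos : ∀ᵐ y ∂G, 0 < y)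
    (hlog : Integrable (fun y => Real.log (1 + y)) G) {s : ℝ} (hs : 0 < s) :
    Integrable (fun y => Real.log (s + y)) G := by
  refine (hlog.add (integrable_const |Real.log s|)).mono'
    (measurable_log_add s).aestronglyMeasurable ?_
  filter_upwards [hpos] with y hy
  exact abs_log_add_le hs hy.le

theorem hasDerivAt_integral_log_add {G : Measure ℝ} [IsFiniteMeasure G] (hpos : ∀ᵐ y ∂G, 0 < y)
    (hlog : Integrable (fun y => Real.log (1 + y)) G) {s : ℝ} (hs : 0 < s) :
    HasDerivAt (fun s => ∫ y, Real.log (s + y) ∂G) (∫ y, (s + y) ^ (-1 : ℝ) ∂G) s := by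
  refine (hasDerivAt_integral_of_dominated_loc_of_deriv_le (s := Ioi (s / 2))
    (F := fun s y => Real.log (s + y)) (F' := fun s y => (s + y) ^ (-1 : ℝ))
    (bound := fun _ => (s / 2)⁻¹) (Ioi_mem_nhds (by linarith))
    (Eventually.of_forall fun t => (measurable_log_add t).aestronglyMeasurable) (integrable_log_add hpos hlog hs)
    (measurable_add_rpow _ _).aestronglyMeasurable ?_ (integrable_const _) ?_).2
  · filter_upwards [hpos] with y hy t ht
    have ht' : s / 2 < t := ht
    rw [Real.rpow_neg_one, Real.norm_of_nonneg (inv_nonneg.2 (by linarith))]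
    exact inv_anti₀ (by linarith) (by linarith)
  · filter_upwards [hpos] with y hy t ht
    have ht' : s / 2 < t := ht
    have h := ((hasDerivAt_id' t).add_const y).log (by linarith)
    exact h.congr_deriv (by rw [Real.rpow_neg_one, one_div])

/-- Normalization at infinity: log(s + y) - log s = log(1 + y/s) is dominated by log(1 + y) once s ≥
1. -/
theorem tendsto_integral_log_add_sub_log {G : Measure ℝ} [IsProbabilityMeasure G]
    (hpos : ∀ᵐ y ∂G, 0 < y) (hlog : Integrable (fun y => Real.log (1 + y)) G) :
    Tendsto (fun s => ∫ y, Real.log (s + y) ∂G - Real.log s) atTop (𝓝 0) := by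
  have h : Tendsto (fun s => ∫ y, (Real.log (s + y) - Real.log s) ∂G) atTop
      (𝓝 (∫ _, (0 : ℝ) ∂G)) := by
    refine tendsto_integral_filter_of_dominated_convergence (fun y => Real.log (1 + y))
      (Eventually.of_forall fun s =>
        ((measurable_log_add s).sub_const _).aestronglyMeasurable) ?_ hlog ?_
    · filter_upwards [eventually_ge_atTop (1 : ℝ)] with s hs
      filter_upwards [hpos] with y hy
      have h0 : 0 < s := by linarith
      rw [← Real.log_div (by linarith) h0.ne', Real.norm_of_nonneg
        (Real.log_nonneg (by rw [le_div_iff₀ h0]; linarith))]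
      refine Real.log_le_log (by positivity) ?_
      rw [div_le_iff₀ h0]
      nlinarith
    · filter_upwards [hpos] with y hy
      have h1 : Tendsto (fun s : ℝ => Real.log (1 + y / s)) atTop (𝓝 (Real.log (1 + 0))) :=
        ((tendsto_const_nhds.div_atTop tendsto_id).const_add 1).log (by norm_num)
      rw [add_zero, Real.log_one] at h1
      refine h1.congr' ?_
      filter_upwards [eventually_gt_atTop (0 : ℝ)] with s hs
      rw [← Real.log_div (by linarith) hs.ne', add_div, div_self hs.ne']
  rw [integral_zero] at h
  refine h.congr' ?_
  filter_upwards [eventually_gt_atTop (0 : ℝ)] with s hs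
  rw [integral_sub (integrable_log_add hpos hlog hs) (integrable_const _)]
  simp

theorem integrable_one_add_rpow {μ : Measure ℝ} [IsFiniteMeasure μ] (hpos : ∀ᵐ x ∂μ, 0 < x)
    {p : ℝ} (hp : 0 ≤ p) : Integrable (fun x => (1 + x) ^ (-p)) μ := by
  refine Integrable.of_bound (measurable_add_rpow _ _).aestronglyMeasurable 1 ?_
  filter_upwards [hpos] with x hx
  rw [Real.norm_of_nonneg (Real.rpow_nonneg (by linarith) _)]
  exact Real.rpow_le_one_of_one_le_of_nonpos (by linarith) (by linarith)

/-- The **Markov–Krein identity** for Dirichlet means. -/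
theorem integral_dirichletMean_rpow {θ : ℝ} (hθ : 0 < θ)
    {G : Measure ℝ} [IsProbabilityMeasure G]
    (hpos : ∀ᵐ y ∂G, 0 < y) (hlog : Integrable (fun y => Real.log (1 + y)) G)
    {s : ℝ} (hs : 0 < s) :
    ∫ x, (s + x) ^ (-θ) ∂dirichletMean θ G = Real.exp (-θ * ∫ y, Real.log (s + y) ∂G) := by
  have := isProbabilityMeasure_dirichletMean hθ hpos hlog
  have hD := ae_dirichletMean_pos hθ hpos hlog
  have hD0 : ∀ᵐ x ∂dirichletMean θ G, 0 ≤ x := hD.mono fun x hx => hx.le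
  have nn : ∀ (κ : Measure ℝ), (∀ᵐ x ∂κ, 0 < x) → ∀ s, 0 < s → ∀ q : ℝ,
      0 ≤ᵐ[κ] fun x => (s + x) ^ q := fun κ hκ s hs q => by
    filter_upwards [hκ] with x hx
    exact Real.rpow_nonneg (by linarith) _
  let m : ℝ → ℝ := fun s => ∫ x, (s + x) ^ (-θ) ∂dirichletMean θ G
  let Ψ : ℝ → ℝ := fun s => ∫ y, Real.log (s + y) ∂G
  -- The derivative of the order θ transform is -θ times the order θ + 1 transform, and the latter
  -- factors through m itself: a linear differential equation.
  have hm : ∀ s, 0 < s → HasDerivAt m (-θ * ((∫ y, (s + y) ^ (-1 : ℝ) ∂G) * m s)) s := by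
    intro s hs
    refine (hasDerivAt_integral_rpow_neg_add hD0 hθ.le
      (integrable_one_add_rpow hD hθ.le) hs).congr_deriv ?_
    congr 1
    simp only [m]
    rw [integral_eq_lintegral_of_nonneg_ae (nn _ hD s hs _)
      (measurable_add_rpow _ _).aestronglyMeasurable, lintegral_dirichletMean_succ hθ hpos hlog hs,
      ENNReal.toReal_mul, integral_eq_lintegral_of_nonneg_ae (nn _ hD s hs _)
      (measurable_add_rpow _ _).aestronglyMeasurable, integral_eq_lintegral_of_nonneg_ae
      (nn _ hpos s hs _) (measurable_add_rpow _ _).aestronglyMeasurable]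
  have hΨ : ∀ s, 0 < s → HasDerivAt Ψ (∫ y, (s + y) ^ (-1 : ℝ) ∂G) s := fun s hs =>
    hasDerivAt_integral_log_add hpos hlog hs
  -- The quotient of m by the claimed solution; it is constant, and its value is found as s → ∞,
  -- where s^θ m(s) → 1.
  let h : ℝ → ℝ := fun s => m s * Real.exp (θ * Ψ s)
  have hh : ∀ s ∈ Ioi (0 : ℝ), HasDerivAt h 0 s := by
    intro s hs
    refine ((hm s hs).mul ((hΨ s hs).const_mul θ).exp).congr_deriv ?_
    ring
  have hconst : ∀ x ∈ Ioi (0 : ℝ), ∀ y ∈ Ioi (0 : ℝ), h x = h y := fun x hx y hy =>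
    (convex_Ioi (0 : ℝ)).is_const_of_fderivWithin_eq_zero (𝕜 := ℝ)
      (fun x hx => (hh x hx).differentiableAt.differentiableWithinAt)
      (fun x hx => by
        rw [fderivWithin_of_isOpen isOpen_Ioi hx]
        ext
        simp [(hh x hx).deriv]) hx hy
  have hlim1 : Tendsto (fun s => ∫ x, s ^ θ * (s + x) ^ (-θ) ∂dirichletMean θ G) atTop (𝓝 1) := by
    have h1 : Tendsto (fun s => ∫ x, s ^ θ * (s + x) ^ (-θ) ∂dirichletMean θ G) atTop
        (𝓝 (∫ _, (1 : ℝ) ∂dirichletMean θ G)) := by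
      refine tendsto_integral_filter_of_dominated_convergence (fun _ => 1)
        (Eventually.of_forall fun s =>
          ((measurable_add_rpow s (-θ)).const_mul _).aestronglyMeasurable) ?_
        (integrable_const _) ?_
      · filter_upwards [eventually_gt_atTop (0 : ℝ)] with s hs
        filter_upwards [hD] with x hx
        rw [Real.norm_of_nonneg (by positivity), Real.rpow_neg (by linarith), ← div_eq_mul_inv,
          div_le_one (by positivity)]
        exact Real.rpow_le_rpow hs.le (by linarith) hθ.le
      · filter_upwards [hD] with x hx
        have h1 : Tendsto (fun s : ℝ => (1 + x / s) ^ (-θ)) atTop (𝓝 ((1 + 0) ^ (-θ))) :=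
          ((tendsto_const_nhds.div_atTop tendsto_id).const_add 1).rpow_const
            (Or.inl (by norm_num))
        rw [add_zero, Real.one_rpow] at h1
        refine h1.congr' ?_
        filter_upwards [eventually_gt_atTop (0 : ℝ)] with s hs
        have e : 1 + x / s = s⁻¹ * (s + x) := by field_simp
        rw [e, Real.mul_rpow (by positivity) (by linarith), Real.inv_rpow hs.le,
          Real.rpow_neg hs.le, inv_inv]
    simpa using h1
  have hlim2 : Tendsto h atTop (𝓝 1) := by
    have h2 := (((tendsto_integral_log_add_sub_log hpos hlog).const_mul θ).rexp)
    have h3 := hlim1.mul h2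
    rw [mul_zero, Real.exp_zero, mul_one] at h3
    refine h3.congr' ?_
    filter_upwards [eventually_gt_atTop (0 : ℝ)] with s hs
    rw [integral_const_mul, mul_sub, Real.exp_sub, Real.rpow_def_of_pos hs, mul_comm (Real.log s)]
    have := (Real.exp_pos (θ * Real.log s)).ne'
    simp only [h, m, Ψ]
    field_simp
  have hs1 : h s = 1 := by
    refine tendsto_nhds_unique (tendsto_const_nhds.congr' ?_) hlim2
    filter_upwards [eventually_gt_atTop (0 : ℝ)] with t ht
    exact hconst s hs t ht
  have h4 : m s * Real.exp (θ * Ψ s) = 1 := hs1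
  rw [neg_mul, Real.exp_neg]
  exact eq_inv_of_mul_eq_one_left h4

theorem lintegral_dirichletMean_rpow {θ : ℝ} (hθ : 0 < θ)
    {G : Measure ℝ} [IsProbabilityMeasure G]
    (hpos : ∀ᵐ y ∂G, 0 < y) (hlog : Integrable (fun y => Real.log (1 + y)) G)
    {s : ℝ} (hs : 0 < s) :
    ∫⁻ x, ENNReal.ofReal ((s + x) ^ (-θ)) ∂dirichletMean θ G =
      ENNReal.ofReal (Real.exp (-θ * ∫ y, Real.log (s + y) ∂G)) := by
  have := isProbabilityMeasure_dirichletMean hθ hpos hlog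
  have hD := ae_dirichletMean_pos hθ hpos hlog
  have hD0 : ∀ᵐ x ∂dirichletMean θ G, 0 ≤ x := hD.mono fun x hx => hx.le
  rw [← integral_dirichletMean_rpow hθ hpos hlog hs, ofReal_integral_eq_lintegral_ofReal
    (integrable_rpow_neg_add hD0 hθ.le (integrable_one_add_rpow hD hθ.le) hs)]
  filter_upwards [hD] with x hx
  exact Real.rpow_nonneg (by linarith) _

/-! ### Cauchy's formula in a strip -/

theorem integrable_exp_neg_mul_abs {δ : ℝ} (hδ : 0 < δ) :
    Integrable fun u : ℝ => Real.exp (-δ * |u|) := by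
  rw [← integrableOn_univ, ← Iic_union_Ioi (a := (0 : ℝ))]
  refine IntegrableOn.union ?_ ?_
  · refine (integrableOn_exp_mul_Iic hδ 0).congr_fun (fun u hu => ?_) measurableSet_Iic
    rw [abs_of_nonpos hu, neg_mul_neg]
  · refine (integrableOn_exp_mul_Ioi (neg_lt_zero.2 hδ) 0).congr_fun (fun u hu => ?_)
      measurableSet_Ioi
    rw [abs_of_pos hu]

theorem cexp_add_pi_mul_I (u : ℝ) : Complex.exp (u + Real.pi * Complex.I) = -Real.exp u := by
  rw [Complex.exp_add, Complex.exp_pi_mul_I]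
  simp

theorem cexp_sub_pi_mul_I (u : ℝ) : Complex.exp (u - Real.pi * Complex.I) = -Real.exp u := by
  rw [sub_eq_add_neg, Complex.exp_add, Complex.exp_neg, Complex.exp_pi_mul_I]
  simp

/-- Two logarithms of one number differ by 2πin, and |Im w| ≤ π leaves only n = 0. So exp w - e^a
has the single zero a in the closed strip, edges included. -/
theorem cexp_eq_cexp_ofReal {w : ℂ} {a : ℝ} (hw : |w.im| ≤ Real.pi)
    (h : Complex.exp w = Complex.exp a) : w = a := by
  obtain ⟨n, hn⟩ := Complex.exp_eq_exp_iff_exists_int.1 h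
  have him : w.im = n * (2 * Real.pi) := by
    rw [hn]
    simp
  have hpi := Real.pi_pos
  have hn0 : n = 0 := by
    rw [him, abs_mul, abs_of_pos (by positivity : 0 < 2 * Real.pi)] at hw
    have h1 : |(n : ℝ)| < 1 := by nlinarith
    exact Int.abs_lt_one_iff.1 (by exact_mod_cast h1)
  simpa [hn0] using hn

theorem strip_mem_nhds (a : ℝ) : {w : ℂ | |w.im| ≤ Real.pi} ∈ 𝓝 (a : ℂ) := by
  have hc : Continuous fun w : ℂ => |w.im| := by fun_prop
  refine mem_of_superset ((isOpen_Iio (a := Real.pi)).preimage hc |>.mem_nhds ?_)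
    fun w (hw : |w.im| < Real.pi) => hw.le
  simpa using Real.pi_pos

theorem norm_le_of_strip_bound {p : ℂ → ℂ} {C δ : ℝ}
    (h1 : ∀ w : ℂ, |w.im| ≤ Real.pi → 0 ≤ w.re → ‖p w‖ ≤ C * Real.exp ((1 - δ) * w.re))
    (h2 : ∀ w : ℂ, |w.im| ≤ Real.pi → w.re ≤ 0 → ‖p w‖ ≤ C * Real.exp (δ * w.re))
    {w : ℂ} (hw : |w.im| ≤ Real.pi) :
    ‖p w‖ ≤ C * Real.exp (-δ * |w.re|) * max 1 (Real.exp w.re) := by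
  rcases le_total 0 w.re with h | h
  · rw [abs_of_nonneg h, max_eq_right (Real.one_le_exp h), mul_assoc, ← Real.exp_add]
    convert h1 w hw h using 3
    ring
  · rw [abs_of_nonpos h, max_eq_left (Real.exp_le_one_iff.2 h), mul_one, neg_mul_neg]
    exact h2 w hw h

/-- Since p(a) = 0, the quotient p(w)/(e^w - e^a) has a removable singularity, and Cauchy's theorem
applies on the rectangles [-R, R] × [-π, π]. The growth bounds make the quotient O(e^(-δ|Re w|)),
which kills the vertical sides; on the horizontal ones e^w = -e^u. -/
theorem strip_integral_eq_zero {p : ℂ → ℂ} {C δ a : ℝ} (hC : 0 ≤ C) (hδ : 0 < δ)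
    (hp : ∀ w : ℂ, |w.im| ≤ Real.pi → DifferentiableAt ℂ p w)
    (h1 : ∀ w : ℂ, |w.im| ≤ Real.pi → 0 ≤ w.re → ‖p w‖ ≤ C * Real.exp ((1 - δ) * w.re))
    (h2 : ∀ w : ℂ, |w.im| ≤ Real.pi → w.re ≤ 0 → ‖p w‖ ≤ C * Real.exp (δ * w.re))
    (h0 : p a = 0) :
    Integrable (fun u : ℝ => p (u - Real.pi * Complex.I) / (Real.exp u + Real.exp a : ℝ)) ∧
    Integrable (fun u : ℝ => p (u + Real.pi * Complex.I) / (Real.exp u + Real.exp a : ℝ)) ∧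
    ∫ u : ℝ, p (u - Real.pi * Complex.I) / (Real.exp u + Real.exp a : ℝ) =
      ∫ u : ℝ, p (u + Real.pi * Complex.I) / (Real.exp u + Real.exp a : ℝ) := by
  have hpi := Real.pi_pos
  set S : Set ℂ := {w : ℂ | |w.im| ≤ Real.pi} with hS
  -- The quotient of difference quotients is the holomorphic extension of p/(exp - e^a) through a;
  -- its denominator equals e^a at a and is nonzero elsewhere because a is the only zero in the
  -- strip.
  set F : ℂ → ℂ := fun w => dslope p a w / dslope Complex.exp a w with hF
  have hFd : DifferentiableOn ℂ F S := by
    refine DifferentiableOn.div ((Complex.differentiableOn_dslope (strip_mem_nhds a)).2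
      fun w hw => (hp w hw).differentiableWithinAt)
      ((Complex.differentiableOn_dslope (strip_mem_nhds a)).2
        Complex.differentiable_exp.differentiableOn) fun w hw => ?_
    by_cases hwa : w = a
    · rw [hwa, dslope_same]
      simp
    · rw [dslope_of_ne _ hwa, slope_def_field]
      refine div_ne_zero (sub_ne_zero.2 fun h => hwa (cexp_eq_cexp_ofReal hw h))
        (sub_ne_zero.2 hwa)
  have hFv : ∀ w : ℂ, w ≠ a → F w = p w / (Complex.exp w - Real.exp a) := by
    intro w hwa
    simp only [hF, dslope_of_ne _ hwa, slope_def_field, h0, sub_zero]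
    rw [div_div_div_cancel_right₀ (sub_ne_zero.2 hwa), Complex.ofReal_exp]
  have hne : ∀ (u y : ℝ), y ≠ 0 → (u + y * Complex.I : ℂ) ≠ a := fun u y hy h => by
    have := congrArg Complex.im h
    simp [hy] at this
  have hbot : ∀ u : ℝ, F (u + (-Real.pi : ℝ) * Complex.I) =
      -(p (u - Real.pi * Complex.I) / (Real.exp u + Real.exp a : ℝ)) := by
    intro u
    have e : (u + (-Real.pi : ℝ) * Complex.I : ℂ) = u - Real.pi * Complex.I := by push_cast; ring
    rw [hFv _ (hne u _ (neg_ne_zero.2 hpi.ne')), e, cexp_sub_pi_mul_I, ← div_neg]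
    push_cast
    ring
  have htop : ∀ u : ℝ, F (u + Real.pi * Complex.I) =
      -(p (u + Real.pi * Complex.I) / (Real.exp u + Real.exp a : ℝ)) := by
    intro u
    rw [hFv _ (hne u _ hpi.ne'), cexp_add_pi_mul_I, ← div_neg]
    push_cast
    ring
  have hstrip : ∀ (u y : ℝ), |y| ≤ Real.pi → |(u + y * Complex.I : ℂ).im| ≤ Real.pi := by
    intro u y hy
    simpa using hy
  have hre : ∀ u y : ℝ, (u + y * Complex.I : ℂ).re = u := fun u y => by simp
  have habs1 : |(-Real.pi : ℝ)| ≤ Real.pi := by rw [abs_neg, abs_of_pos hpi]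
  have habs2 : |Real.pi| ≤ Real.pi := by rw [abs_of_pos hpi]
  -- bounds on the horizontal sides
  have hlb : ∀ u : ℝ, min 1 (Real.exp a) * max 1 (Real.exp u) ≤ Real.exp u + Real.exp a := by
    intro u
    have := Real.exp_pos u
    have := Real.exp_pos a
    rcases le_total 1 (Real.exp u) with h | h
    · rw [max_eq_right h]
      nlinarith [min_le_left 1 (Real.exp a)]
    · rw [max_eq_left h, mul_one]
      linarith [min_le_right 1 (Real.exp a)]
  have hm0 : 0 < min 1 (Real.exp a) := lt_min one_pos (Real.exp_pos a)
  have hint : ∀ y : ℝ, |y| ≤ Real.pi →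
      Integrable fun u : ℝ => p (u + y * Complex.I) / (Real.exp u + Real.exp a : ℝ) := by
    intro y hy
    refine ((integrable_exp_neg_mul_abs hδ).const_mul (C / min 1 (Real.exp a))).mono' ?_ ?_
    · refine Continuous.aestronglyMeasurable ?_
      refine Continuous.div ?_ (by fun_prop) fun u => ?_
      · rw [continuous_iff_continuousAt]
        intro u
        have := (hp _ (hstrip u y hy)).continuousAt
        exact ContinuousAt.comp (f := fun u : ℝ => (u + y * Complex.I : ℂ)) this (by fun_prop)
      · exact_mod_cast (by positivity : (0 : ℝ) < Real.exp u + Real.exp a).ne'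
    · refine Eventually.of_forall fun u => ?_
      have hd : (0 : ℝ) < Real.exp u + Real.exp a := by positivity
      rw [norm_div, Complex.norm_real, Real.norm_of_nonneg hd.le, div_le_iff₀ hd]
      have := norm_le_of_strip_bound h1 h2 (hstrip u y hy)
      rw [hre] at this
      refine this.trans ?_
      calc C * Real.exp (-δ * |u|) * max 1 (Real.exp u) =
            C / min 1 (Real.exp a) * Real.exp (-δ * |u|) *
              (min 1 (Real.exp a) * max 1 (Real.exp u)) := by field_simp
        _ ≤ _ := mul_le_mul_of_nonneg_left (hlb u) (by positivity)
  have hi1 : Integrable fun u : ℝ => p (u - Real.pi * Complex.I) /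
      (Real.exp u + Real.exp a : ℝ) := by
    refine (hint _ habs1).congr (Eventually.of_forall fun u => ?_)
    simp only [Complex.ofReal_neg, neg_mul, sub_eq_add_neg]
  have hi2 := hint _ habs2
  refine ⟨hi1, hi2, ?_⟩
  -- the vertical sides vanish in the limit
  have hvert : ∀ σ : ℝ → ℝ, (∀ R, |σ R| = |R|) →
      (∃ c : ℝ, 0 < c ∧ ∀ᶠ R in atTop, ∀ w : ℂ, w.re = σ R →
        c * max 1 (Real.exp w.re) ≤ ‖Complex.exp w - Real.exp a‖) →
      Tendsto (fun R => ∫ y : ℝ in (-Real.pi)..Real.pi, F (σ R + y * Complex.I)) atTop (𝓝 0) := by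
    rintro σ hσ ⟨c, hc, hcw⟩
    have hlim : Tendsto (fun R : ℝ => C / c * Real.exp (-δ * |R|) * |Real.pi - -Real.pi|) atTop
        (𝓝 0) := by
      have : Tendsto (fun R : ℝ => -δ * |R|) atTop atBot :=
        tendsto_abs_atTop_atTop.const_mul_atTop_of_neg (neg_lt_zero.2 hδ)
      simpa using ((Real.tendsto_exp_atBot.comp this).const_mul (C / c)).mul_const
        |Real.pi - -Real.pi|
    refine squeeze_zero_norm' ?_ hlim
    filter_upwards [hcw] with R hR
    refine intervalIntegral.norm_integral_le_of_norm_le_const fun y hy => ?_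
    have hy' : |y| ≤ Real.pi := by
      rw [uIoc_of_le (by linarith)] at hy
      exact abs_le.2 ⟨hy.1.le, hy.2⟩
    have hb := hR (σ R + y * Complex.I) (hre _ _)
    have hpb := norm_le_of_strip_bound h1 h2 (hstrip (σ R) y hy')
    rw [hre] at hb hpb
    have hpos : 0 < ‖Complex.exp (σ R + y * Complex.I) - Real.exp a‖ :=
      lt_of_lt_of_le (by positivity) hb
    have hwa : (σ R + y * Complex.I : ℂ) ≠ a := by
      intro h
      rw [h, Complex.ofReal_exp, sub_self, norm_zero] at hpos
      exact hpos.false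
    rw [hFv _ hwa, norm_div, div_le_iff₀ hpos]
    refine hpb.trans ?_
    rw [hσ]
    calc C * Real.exp (-δ * |R|) * max 1 (Real.exp (σ R)) =
          C / c * Real.exp (-δ * |R|) * (c * max 1 (Real.exp (σ R))) := by field_simp
      _ ≤ _ := mul_le_mul_of_nonneg_left hb (by positivity)
  have hright : Tendsto (fun R : ℝ => ∫ y : ℝ in (-Real.pi)..Real.pi, F (R + y * Complex.I))
      atTop (𝓝 0) := by
    refine hvert (fun R => R) (fun R => rfl) ⟨1 / 2, by norm_num, ?_⟩
    filter_upwards [eventually_ge_atTop 0,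
      Real.tendsto_exp_atTop.eventually_ge_atTop (2 * Real.exp a)] with R hR0 hR w hw
    have hn := norm_sub_norm_le (Complex.exp w) (Real.exp a)
    rw [Complex.norm_exp, Complex.norm_real, Real.norm_of_nonneg (Real.exp_pos a).le, hw] at hn
    rw [hw, max_eq_right (Real.one_le_exp hR0)]
    linarith
  have hleft : Tendsto (fun R : ℝ => ∫ y : ℝ in (-Real.pi)..Real.pi,
      F ((-R : ℝ) + y * Complex.I)) atTop (𝓝 0) := by
    refine hvert (fun R => -R) (fun R => abs_neg R) ⟨Real.exp a / 2, by positivity, ?_⟩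
    have ht : Tendsto (fun R : ℝ => Real.exp (-R)) atTop (𝓝 0) :=
      Real.tendsto_exp_neg_atTop_nhds_zero
    filter_upwards [eventually_ge_atTop 0,
      ht.eventually_le_const (half_pos (Real.exp_pos a))] with R hR0 hR w hw
    have hn := norm_sub_norm_le (Real.exp a : ℂ) (Complex.exp w)
    rw [Complex.norm_exp, Complex.norm_real, Real.norm_of_nonneg (Real.exp_pos a).le, hw,
      norm_sub_rev] at hn
    rw [hw, max_eq_left (Real.exp_le_one_iff.2 (by linarith))]
    linarith
  have hrect : ∀ᶠ R : ℝ in atTop,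
      (∫ x : ℝ in (-R)..R, F (x + (-Real.pi : ℝ) * Complex.I)) -
        (∫ x : ℝ in (-R)..R, F (x + Real.pi * Complex.I)) +
        Complex.I • (∫ y : ℝ in (-Real.pi)..Real.pi, F (R + y * Complex.I)) -
        Complex.I • (∫ y : ℝ in (-Real.pi)..Real.pi, F ((-R : ℝ) + y * Complex.I)) = 0 := by
    refine Eventually.of_forall fun R => ?_
    have := Complex.integral_boundary_rect_eq_zero_of_differentiableOn F ⟨-R, -Real.pi⟩
      ⟨R, Real.pi⟩ (hFd.mono fun w hw => ?_)
    · simpa using this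
    · have h := hw.2
      simp only [mem_preimage] at h
      rw [uIcc_of_le (by linarith)] at h
      exact abs_le.2 h
  have hlimb : Tendsto (fun R : ℝ => ∫ x : ℝ in (-R)..R, F (x + (-Real.pi : ℝ) * Complex.I)) atTop
      (𝓝 (-∫ u : ℝ, p (u - Real.pi * Complex.I) / (Real.exp u + Real.exp a : ℝ))) := by
    simp_rw [hbot, intervalIntegral.integral_neg]
    exact (intervalIntegral_tendsto_integral hi1 tendsto_neg_atTop_atBot tendsto_id).neg
  have hlimt : Tendsto (fun R : ℝ => ∫ x : ℝ in (-R)..R, F (x + Real.pi * Complex.I)) atTop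
      (𝓝 (-∫ u : ℝ, p (u + Real.pi * Complex.I) / (Real.exp u + Real.exp a : ℝ))) := by
    simp_rw [htop, intervalIntegral.integral_neg]
    exact (intervalIntegral_tendsto_integral hi2 tendsto_neg_atTop_atBot tendsto_id).neg
  have hlim := ((hlimb.sub hlimt).add (hright.const_smul Complex.I)).sub
    (hleft.const_smul Complex.I)
  have := tendsto_nhds_unique (tendsto_const_nhds.congr' (hrect.mono fun R hR => hR.symm)) hlim
  simp only [smul_zero, add_zero, sub_zero] at this
  linear_combination this

theorem exp_half_div_le (x : ℝ) :
    Real.exp (x / 2) / (Real.exp x + 1) ≤ Real.exp (-(1 / 2) * |x|) := by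
  rw [div_le_iff₀ (by positivity), mul_add, mul_one, ← Real.exp_add]
  rcases le_total 0 x with h | h
  · rw [abs_of_nonneg h]
    have : Real.exp (x / 2) = Real.exp (-(1 / 2) * x + x) := by congr 1; ring
    rw [this]
    linarith [Real.exp_pos (-(1 / 2) * x)]
  · rw [abs_of_nonpos h]
    have : Real.exp (x / 2) = Real.exp (-(1 / 2) * -x) := by congr 1; ring
    rw [← this]
    linarith [Real.exp_pos (-(1 / 2) * -x + x)]

theorem integrable_exp_half_div :
    Integrable fun x : ℝ => Real.exp (x / 2) / (Real.exp x + 1) := by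
  refine (integrable_exp_neg_mul_abs (by norm_num : (0 : ℝ) < 1 / 2)).mono' ?_ ?_
  · exact (Continuous.div (by fun_prop) (by fun_prop) fun x => by positivity).aestronglyMeasurable
  · refine Eventually.of_forall fun x => ?_
    rw [Real.norm_of_nonneg (by positivity)]
    exact exp_half_div_le x

/-- A primitive is 2 arctan(e^(x/2)). The value π becomes the factor in Cauchy's formula below. -/
theorem integral_exp_half_div :
    ∫ x : ℝ, Real.exp (x / 2) / (Real.exp x + 1) = Real.pi := by
  have hd : ∀ x : ℝ, HasDerivAt (fun x => 2 * Real.arctan (Real.exp (x / 2)))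
      (Real.exp (x / 2) / (Real.exp x + 1)) x := by
    intro x
    refine ((((hasDerivAt_id' x).div_const 2).exp.arctan).const_mul 2).congr_deriv ?_
    rw [← Real.exp_nat_mul]
    push_cast
    rw [mul_div_cancel₀ x two_ne_zero]
    field_simp
    ring
  have hb : Tendsto (fun x : ℝ => 2 * Real.arctan (Real.exp (x / 2))) atBot
      (𝓝 (2 * Real.arctan 0)) :=
    ((Real.continuous_arctan.tendsto 0).comp (Real.tendsto_exp_atBot.comp
      (tendsto_id.atBot_div_const two_pos))).const_mul 2
  have ht : Tendsto (fun x : ℝ => 2 * Real.arctan (Real.exp (x / 2))) atTop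
      (𝓝 (2 * (Real.pi / 2))) :=
    ((tendsto_nhds_of_tendsto_nhdsWithin Real.tendsto_arctan_atTop).comp
      (Real.tendsto_exp_atTop.comp (tendsto_id.atTop_div_const two_pos))).const_mul 2
  rw [integral_of_hasDerivAt_of_tendsto hd integrable_exp_half_div hb ht, Real.arctan_zero]
  ring

/-- Cauchy's formula for a function on the slit plane, in the coordinate `w = log z`. -/
theorem strip_cauchy {k : ℂ → ℂ} {C δ : ℝ} (hC : 0 ≤ C) (hδ : 0 < δ)
    (hk : ∀ w : ℂ, |w.im| ≤ Real.pi → DifferentiableAt ℂ k w)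
    (h1 : ∀ w : ℂ, |w.im| ≤ Real.pi → 0 ≤ w.re → ‖k w‖ ≤ C * Real.exp (-δ * w.re))
    (h2 : ∀ w : ℂ, |w.im| ≤ Real.pi → w.re ≤ 0 → ‖k w‖ ≤ C * Real.exp ((δ - 1) * w.re))
    (a : ℝ) :
    Integrable (fun u : ℝ => (k (u - Real.pi * Complex.I) - k (u + Real.pi * Complex.I)) *
      (Real.exp u / (Real.exp u + Real.exp a) : ℝ)) ∧
    ∫ u : ℝ, (k (u - Real.pi * Complex.I) - k (u + Real.pi * Complex.I)) *
      (Real.exp u / (Real.exp u + Real.exp a) : ℝ) = 2 * Real.pi * Complex.I * k a := by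
  -- The correction term below grows like e^(Re w / 2) at both ends of the strip, so the usable rate
  -- is capped at 1/2.
  set δ' := min δ (1 / 2) with hδ'
  have hδ0 : 0 < δ' := lt_min hδ (by norm_num)
  have hδ1 : δ' ≤ δ := min_le_left _ _
  have hδ2 : δ' ≤ 1 / 2 := min_le_right _ _
  -- Subtracting k(a) exp((w + a)/2) forces a zero at a. On the edges w = u ± πi the subtracted
  -- exponential is ±i e^((u + a)/2), so its jump is explicit and integrates to the residue 2πi
  -- k(a).
  set p : ℂ → ℂ := fun w => k w * Complex.exp w - k a * Complex.exp ((w + a) / 2) with hp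
  set C' := C + ‖k a‖ * Real.exp (a / 2) with hC'
  have hn : ∀ w, ‖p w‖ ≤ ‖k w‖ * Real.exp w.re + ‖k a‖ * Real.exp (a / 2) * Real.exp (w.re / 2) := by
    intro w
    refine (norm_sub_le _ _).trans_eq ?_
    rw [norm_mul, norm_mul, Complex.norm_exp, Complex.norm_exp, mul_assoc, ← Real.exp_add]
    congr 3
    simp
    ring
  have hz := strip_integral_eq_zero (p := p) (C := C') (δ := δ') (a := a) (by positivity) hδ0
    (fun w hw => ((hk w hw).mul Complex.differentiableAt_exp).sub (by fun_prop))
    (fun w hw h => by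
      refine (hn w).trans ?_
      rw [hC', add_mul]
      refine add_le_add ?_ (mul_le_mul_of_nonneg_left
        (Real.exp_le_exp.2 (by nlinarith)) (by positivity))
      refine (mul_le_mul_of_nonneg_right (h1 w hw h) (Real.exp_pos _).le).trans ?_
      rw [mul_assoc, ← Real.exp_add]
      exact mul_le_mul_of_nonneg_left (Real.exp_le_exp.2 (by nlinarith)) hC)
    (fun w hw h => by
      refine (hn w).trans ?_
      rw [hC', add_mul]
      refine add_le_add ?_ (mul_le_mul_of_nonneg_left
        (Real.exp_le_exp.2 (by nlinarith)) (by positivity))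
      refine (mul_le_mul_of_nonneg_right (h2 w hw h) (Real.exp_pos _).le).trans ?_
      rw [mul_assoc, ← Real.exp_add]
      exact mul_le_mul_of_nonneg_left (Real.exp_le_exp.2 (by nlinarith)) hC)
    (by simp [hp])
  obtain ⟨i1, i2, heq⟩ := hz
  have hE : Integrable fun u : ℝ =>
      (Real.exp ((u - a) / 2) / (Real.exp (u - a) + 1) : ℝ) :=
    integrable_exp_half_div.comp_sub_right a
  have hEi : ∫ u : ℝ, (Real.exp ((u - a) / 2) / (Real.exp (u - a) + 1) : ℝ) = Real.pi := by
    rw [integral_sub_right_eq_self (fun x : ℝ => Real.exp (x / 2) / (Real.exp x + 1)) a,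
      integral_exp_half_div]
  have hpt : ∀ u : ℝ, (k (u - Real.pi * Complex.I) - k (u + Real.pi * Complex.I)) *
      (Real.exp u / (Real.exp u + Real.exp a) : ℝ) =
      2 * Complex.I * k a * ((Real.exp ((u - a) / 2) / (Real.exp (u - a) + 1) : ℝ) : ℂ) -
      (p (u - Real.pi * Complex.I) / (Real.exp u + Real.exp a : ℝ) -
        p (u + Real.pi * Complex.I) / (Real.exp u + Real.exp a : ℝ)) := by
    intro u
    have hd : ((Real.exp u + Real.exp a : ℝ) : ℂ) ≠ 0 := by
      exact_mod_cast (by positivity : (0 : ℝ) < Real.exp u + Real.exp a).ne'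
    have e1 : Real.exp ((u - a) / 2) / (Real.exp (u - a) + 1) =
        Real.exp ((u + a) / 2) / (Real.exp u + Real.exp a) := by
      rw [div_eq_div_iff (by positivity) (by positivity), mul_add, mul_add, ← Real.exp_add,
        ← Real.exp_add, ← Real.exp_add, mul_one]
      congr 2 <;> ring
    have e2 : Complex.exp ((u - Real.pi * Complex.I + a) / 2) =
        -Complex.I * Real.exp ((u + a) / 2) := by
      rw [show ((u - Real.pi * Complex.I + a) / 2 : ℂ) =
        -(Real.pi / 2 * Complex.I) + ((u + a) / 2 : ℝ) by push_cast; ring, Complex.exp_add,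
        Complex.exp_neg, Complex.exp_pi_div_two_mul_I, Complex.inv_I, Complex.ofReal_exp]
    have e3 : Complex.exp ((u + Real.pi * Complex.I + a) / 2) =
        Complex.I * Real.exp ((u + a) / 2) := by
      rw [show ((u + Real.pi * Complex.I + a) / 2 : ℂ) =
        (Real.pi / 2 * Complex.I) + ((u + a) / 2 : ℝ) by push_cast; ring, Complex.exp_add,
        Complex.exp_pi_div_two_mul_I, Complex.ofReal_exp]
    rw [e1]
    simp only [hp, e2, e3, cexp_add_pi_mul_I, cexp_sub_pi_mul_I]
    rw [Complex.ofReal_div, Complex.ofReal_div]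
    field_simp
    ring
  simp_rw [hpt]
  have iE : Integrable fun u : ℝ => 2 * Complex.I * k a *
      ((Real.exp ((u - a) / 2) / (Real.exp (u - a) + 1) : ℝ) : ℂ) := hE.ofReal.const_mul _
  have i3 : Integrable fun u : ℝ => p (u - Real.pi * Complex.I) / (Real.exp u + Real.exp a : ℝ) -
      p (u + Real.pi * Complex.I) / (Real.exp u + Real.exp a : ℝ) := i1.sub i2
  refine ⟨iE.sub i3, ?_⟩
  rw [integral_sub iE i3, integral_sub i1 i2, heq, sub_self, sub_zero,
    integral_const_mul, integral_complex_ofReal, hEi]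
  ring

/-- Cauchy's formula on the slit plane for a function that is real on `(0, ∞)`: it is the
Stieltjes transform of its jump across the cut. -/
theorem stieltjes_of_strip {k : ℂ → ℂ} {C δ : ℝ} (hC : 0 ≤ C) (hδ : 0 < δ)
    (hk : ∀ w : ℂ, |w.im| ≤ Real.pi → DifferentiableAt ℂ k w)
    (h1 : ∀ w : ℂ, |w.im| ≤ Real.pi → 0 ≤ w.re → ‖k w‖ ≤ C * Real.exp (-δ * w.re))
    (h2 : ∀ w : ℂ, |w.im| ≤ Real.pi → w.re ≤ 0 → ‖k w‖ ≤ C * Real.exp ((δ - 1) * w.re))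
    (hconj : ∀ u : ℝ, k (u - Real.pi * Complex.I) =
      (starRingEnd ℂ) (k (u + Real.pi * Complex.I)))
    {φ : ℝ → ℝ} (hφ : ∀ u : ℝ, φ (Real.exp u) = -(1 / Real.pi) * (k (u + Real.pi * Complex.I)).im)
    {s : ℝ} (hs : 0 < s) :
    IntegrableOn (fun t => φ t / (s + t)) (Ioi 0) ∧
      ∫ t in Ioi 0, φ t / (s + t) = (k (Real.log s)).re := by
  have hpi := Real.pi_pos.ne'
  obtain ⟨hi, he⟩ := strip_cauchy hC hδ hk h1 h2 (Real.log s)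
  rw [Real.exp_log hs] at hi he
  -- Conjugate symmetry makes the jump across the cut purely imaginary, equal to -2i Im k on the
  -- upper edge, that is 2πi φ.
  have hpt : ∀ u : ℝ, (k (u - Real.pi * Complex.I) - k (u + Real.pi * Complex.I)) *
      (Real.exp u / (Real.exp u + s) : ℝ) =
      2 * Real.pi * Complex.I * ((Real.exp u * (φ (Real.exp u) / (s + Real.exp u)) : ℝ) : ℂ) := by
    intro u
    have e1 : k (u - Real.pi * Complex.I) - k (u + Real.pi * Complex.I) =
        ((2 * Real.pi * φ (Real.exp u) : ℝ) : ℂ) * Complex.I := by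
      have e2 : 2 * Real.pi * φ (Real.exp u) = -(2 * (k (u + Real.pi * Complex.I)).im) := by
        rw [hφ]
        field_simp
      rw [e2, hconj, ← neg_sub, Complex.sub_conj]
      push_cast
      ring
    rw [e1]
    push_cast
    ring
  simp_rw [hpt] at hi he
  have hc : (2 * Real.pi * Complex.I : ℂ) ≠ 0 := by
    simp [hpi, Complex.I_ne_zero]
  have hi' : Integrable fun u : ℝ => Real.exp u * (φ (Real.exp u) / (s + Real.exp u)) := by
    have := (hi.const_mul (2 * Real.pi * Complex.I)⁻¹).re
    refine this.congr (Eventually.of_forall fun u => ?_)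
    simp only [inv_mul_cancel_left₀ hc]
    exact Complex.ofReal_re _
  have he' : ∫ u : ℝ, Real.exp u * (φ (Real.exp u) / (s + Real.exp u)) =
      (k (Real.log s)).re := by
    rw [integral_const_mul] at he
    rw [← mul_left_cancel₀ hc he, integral_complex_ofReal, Complex.ofReal_re]
  -- Substitution t = e^u from the line to (0, ∞).
  have himg : Real.exp '' univ = Ioi 0 := by rw [image_univ, Real.range_exp]
  have hder : ∀ x ∈ univ, HasDerivWithinAt Real.exp (Real.exp x) univ x := fun x _ =>
    (Real.hasDerivAt_exp x).hasDerivWithinAt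
  have habs : ∀ u : ℝ, |Real.exp u| • (φ (Real.exp u) / (s + Real.exp u)) =
      Real.exp u * (φ (Real.exp u) / (s + Real.exp u)) := fun u => by
    rw [abs_of_pos (Real.exp_pos u), smul_eq_mul]
  rw [← himg]
  constructor
  · rw [integrableOn_image_iff_integrableOn_abs_deriv_smul MeasurableSet.univ hder
      Real.exp_injective.injOn, integrableOn_univ]
    simpa only [habs] using hi'
  · rw [integral_image_eq_integral_abs_deriv_smul MeasurableSet.univ hder
      Real.exp_injective.injOn, setIntegral_univ]
    simpa only [habs] using he'

/-! ### The Lamperti laws -/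

theorem sin_pi_mul_pos {α : ℝ} (h0 : 0 < α) (h1 : α < 1) : 0 < Real.sin (Real.pi * α) :=
  Real.sin_pos_of_pos_of_lt_pi (mul_pos Real.pi_pos h0) (by nlinarith [Real.pi_pos])

/-- The ellipticity constant of the quadratic form `u² + 2 u r cos(απ) + r²`. -/
noncomputable def lampertiConst (α : ℝ) : ℝ := 1 - |Real.cos (α * Real.pi)|

theorem lampertiConst_pos {α : ℝ} (h0 : 0 < α) (h1 : α < 1) : 0 < lampertiConst α := by
  have h2 := sin_pi_mul_pos h0 h1
  have h3 := Real.sin_sq_add_cos_sq (α * Real.pi)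
  rw [mul_comm] at h2
  have : |Real.cos (α * Real.pi)| < 1 := by
    rw [← sq_lt_one_iff_abs_lt_one]
    nlinarith
  unfold lampertiConst
  linarith

theorem lampertiConst_le_one (α : ℝ) : lampertiConst α ≤ 1 := by
  unfold lampertiConst
  linarith [abs_nonneg (Real.cos (α * Real.pi))]

/-- The cross term is at least -|cos(απ)| · 2ur, and 2ur ≤ u² + r². -/
theorem quadForm_ge {α u r : ℝ} (hu : 0 ≤ u) (hr : 0 ≤ r) :
    lampertiConst α * (u ^ 2 + r ^ 2) ≤ u ^ 2 + 2 * u * r * Real.cos (α * Real.pi) + r ^ 2 := by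
  unfold lampertiConst
  have h1 := neg_abs_le (Real.cos (α * Real.pi))
  have h2 := abs_nonneg (Real.cos (α * Real.pi))
  have h3 : 0 ≤ u * r := mul_nonneg hu hr
  nlinarith [sq_nonneg (u - r), mul_nonneg h2 (sq_nonneg (u - r)), mul_le_mul_of_nonneg_left h1 h3]

theorem rpow_two_mul_eq {x : ℝ} (hx : 0 ≤ x) (α : ℝ) : x ^ (2 * α) = (x ^ α) ^ 2 := by
  rw [mul_comm, Real.rpow_mul hx, Real.rpow_two]

theorem lampertiDenom_eq {α x r : ℝ} (hx : 0 ≤ x) :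
    lampertiDenom α x r = (x ^ α) ^ 2 + 2 * x ^ α * r * Real.cos (α * Real.pi) + r ^ 2 := by
  rw [lampertiDenom, rpow_two_mul_eq hx]

theorem lampertiDenom_ge {α x r : ℝ} (hx : 0 ≤ x) (hr : 0 ≤ r) :
    lampertiConst α * ((x ^ α) ^ 2 + r ^ 2) ≤ lampertiDenom α x r := by
  rw [lampertiDenom_eq hx]
  exact quadForm_ge (Real.rpow_nonneg hx _) hr

theorem lampertiDenom_pos {α x r : ℝ} (h0 : 0 < α) (h1 : α < 1) (hx : 0 ≤ x) (hr : 0 < r) :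
    0 < lampertiDenom α x r :=
  lt_of_lt_of_le (mul_pos (lampertiConst_pos h0 h1) (by positivity)) (lampertiDenom_ge hx hr.le)

theorem measurable_lampertiDenom (α : ℝ) :
    Measurable fun p : ℝ × ℝ => lampertiDenom α p.1 p.2 := by
  unfold lampertiDenom
  exact (((measurable_fst.pow_const _).add
    ((((measurable_fst.pow_const _).const_mul 2).mul measurable_snd).mul_const _)).add
    (measurable_snd.pow_const _))

/-- The density of `X_α r ^ (1 / α)`. -/
noncomputable def rhoScaled (α r x : ℝ) : ℝ :=
  Real.sin (Real.pi * α) / Real.pi * (x ^ (α - 1) * r / lampertiDenom α x r)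

/-- The distribution function of `X_α r ^ (1 / α)`. -/
noncomputable def cdfScaled (α r x : ℝ) : ℝ :=
  1 - 1 / (Real.pi * α) *
    arccot (Real.cot (Real.pi * α) + x ^ α / r / Real.sin (Real.pi * α))

theorem rhoScaled_one (α : ℝ) : rhoScaled α 1 = rho α := by
  ext x
  rw [rhoScaled, rho, mul_one]

theorem measurable_rhoScaled (α : ℝ) : Measurable fun p : ℝ × ℝ => rhoScaled α p.2 p.1 := by
  unfold rhoScaled
  exact (((measurable_fst.pow_const _).mul measurable_snd).div
    (measurable_lampertiDenom α)).const_mul _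

theorem rhoScaled_nonneg {α x r : ℝ} (h0 : 0 < α) (h1 : α < 1) (hx : 0 ≤ x) (hr : 0 < r) :
    0 ≤ rhoScaled α r x := by
  have := sin_pi_mul_pos h0 h1
  have := lampertiDenom_pos h0 h1 hx hr
  have := Real.pi_pos
  have := Real.rpow_nonneg hx (α - 1)
  unfold rhoScaled
  positivity

theorem arccot_mem_Ioo (y : ℝ) : arccot y ∈ Ioo 0 Real.pi := by
  have h1 := Real.arctan_lt_pi_div_two y
  have h2 := Real.neg_pi_div_two_lt_arctan y
  unfold arccot
  constructor <;> linarith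

theorem arccot_cot {x : ℝ} (hx : x ∈ Ioo 0 Real.pi) : arccot (Real.cot x) = x := by
  rw [arccot, ← Real.tan_inv_eq_cot, ← Real.tan_pi_div_two_sub, Real.arctan_tan]
  · ring
  · linarith [hx.2]
  · linarith [hx.1]

theorem antitone_arccot : Antitone arccot := fun x y h => by
  unfold arccot
  linarith [Real.arctan_mono h]

theorem continuous_arccot : Continuous arccot :=
  continuous_const.sub Real.continuous_arctan

theorem cdfScaled_zero {α : ℝ} (h0 : 0 < α) (h1 : α < 1) (r : ℝ) : cdfScaled α r 0 = 0 := by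
  have hpi := Real.pi_pos
  have hm : Real.pi * α ∈ Ioo 0 Real.pi := ⟨by positivity, by nlinarith⟩
  rw [cdfScaled, Real.zero_rpow h0.ne', zero_div, zero_div, add_zero, arccot_cot hm]
  field_simp
  simp

theorem cdfScaled_nonneg {α r x : ℝ} (h0 : 0 < α) (h1 : α < 1) (hr : 0 < r) (hx : 0 ≤ x) :
    0 ≤ cdfScaled α r x := by
  rw [← cdfScaled_zero h0 h1 r]
  have := sin_pi_mul_pos h0 h1
  have hpi := Real.pi_pos
  unfold cdfScaled
  rw [Real.zero_rpow h0.ne', zero_div, zero_div]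
  gcongr
  apply antitone_arccot
  gcongr
  positivity

theorem cdfScaled_le_one {α r x : ℝ} (h0 : 0 < α) : cdfScaled α r x ≤ 1 := by
  have hpi := Real.pi_pos
  have := (arccot_mem_Ioo (Real.cot (Real.pi * α) + x ^ α / r / Real.sin (Real.pi * α))).1
  have : 0 ≤ 1 / (Real.pi * α) *
    arccot (Real.cot (Real.pi * α) + x ^ α / r / Real.sin (Real.pi * α)) := by positivity
  unfold cdfScaled
  linarith

theorem continuous_cdfScaled {α : ℝ} (h0 : 0 < α) (r : ℝ) : Continuous (cdfScaled α r) := by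
  unfold cdfScaled
  have : Continuous fun x : ℝ => x ^ α := Real.continuous_rpow_const h0.le
  exact continuous_const.sub (continuous_const.mul (continuous_arccot.comp
    (continuous_const.add ((this.div_const _).div_const _))))

theorem measurable_cdfScaled (α x : ℝ) : Measurable fun r => cdfScaled α r x := by
  unfold cdfScaled
  exact measurable_const.sub (measurable_const.mul (continuous_arccot.measurable.comp
    (measurable_const.add ((measurable_const.div measurable_id).div_const _))))

theorem tendsto_cdfScaled_atTop {α r : ℝ} (h0 : 0 < α) (h1 : α < 1) (hr : 0 < r) :
    Tendsto (cdfScaled α r) atTop (𝓝 1) := by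
  have hs := sin_pi_mul_pos h0 h1
  have h2 : Tendsto (fun x : ℝ => Real.cot (Real.pi * α) + x ^ α / r / Real.sin (Real.pi * α))
      atTop atTop :=
    tendsto_atTop_add_const_left _ _
      (((tendsto_rpow_atTop h0).atTop_div_const hr).atTop_div_const hs)
  have h3 : Tendsto arccot atTop (𝓝 0) := by
    have := (tendsto_nhds_of_tendsto_nhdsWithin Real.tendsto_arctan_atTop).const_sub (Real.pi / 2)
    rwa [sub_self] at this
  have h4 := ((h3.comp h2).const_mul (1 / (Real.pi * α))).const_sub 1
  rw [mul_zero, sub_zero] at h4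
  exact h4

theorem hasDerivAt_cdfScaled {α r x : ℝ} (h0 : 0 < α) (h1 : α < 1) (hr : 0 < r) (hx : 0 < x) :
    HasDerivAt (cdfScaled α r) (rhoScaled α r x) x := by
  have hs := sin_pi_mul_pos h0 h1
  have hpi := Real.pi_pos
  have hD := lampertiDenom_pos h0 h1 hx.le hr
  have e1 := ((((Real.hasDerivAt_rpow_const (p := α) (Or.inl hx.ne')).div_const r).div_const
    (Real.sin (Real.pi * α))).const_add (Real.cot (Real.pi * α)))
  have e2 := ((e1.arctan.const_sub (Real.pi / 2)).const_mul (1 / (Real.pi * α))).const_sub 1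
  refine e2.congr_deriv ?_
  have h2 := Real.sin_sq_add_cos_sq (Real.pi * α)
  -- Completing the square with sin² + cos² = 1; this is why the arctangent derivative produces
  -- exactly the denominator of ϱ_α.
  have key : 1 + (Real.cot (Real.pi * α) + x ^ α / r / Real.sin (Real.pi * α)) ^ 2 =
      lampertiDenom α x r / (r ^ 2 * Real.sin (Real.pi * α) ^ 2) := by
    rw [lampertiDenom_eq hx.le, Real.cot_eq_cos_div_sin, mul_comm α]
    field_simp
    linear_combination r ^ 2 * h2
  rw [key, rhoScaled]
  field_simp

theorem lintegral_Ioc_rhoScaled {α r x : ℝ} (h0 : 0 < α) (h1 : α < 1) (hr : 0 < r)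
    (hx : 0 ≤ x) :
    ∫⁻ y in Ioc 0 x, ENNReal.ofReal (rhoScaled α r y) = ENNReal.ofReal (cdfScaled α r x) := by
  rw [lintegral_Ioc_ofReal_deriv hx (continuous_cdfScaled h0 r).continuousOn
    (fun y hy => hasDerivAt_cdfScaled h0 h1 hr hy.1)
    (fun y hy => rhoScaled_nonneg h0 h1 hy.1.le hr), cdfScaled_zero h0 h1, sub_zero]

theorem lintegral_Ioi_rhoScaled {α r : ℝ} (h0 : 0 < α) (h1 : α < 1) (hr : 0 < r) :
    ∫⁻ y in Ioi 0, ENNReal.ofReal (rhoScaled α r y) = 1 := by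
  rw [lintegral_Ioi_ofReal_deriv (continuous_cdfScaled h0 r).continuousWithinAt
    (fun y hy => hasDerivAt_cdfScaled h0 h1 hr hy)
    (fun y hy => rhoScaled_nonneg h0 h1 (le_of_lt hy) hr) (tendsto_cdfScaled_atTop h0 h1 hr),
    cdfScaled_zero h0 h1, sub_zero, ENNReal.ofReal_one]

theorem densityMeasure_apply {f : ℝ → ℝ} {s : Set ℝ} (hs : MeasurableSet s) :
    densityMeasure f s = ∫⁻ x in s ∩ Ioi 0, ENNReal.ofReal (f x) := by
  rw [densityMeasure, withDensity_apply _ hs, Measure.restrict_restrict hs]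

theorem ae_densityMeasure_pos (f : ℝ → ℝ) : ∀ᵐ x ∂densityMeasure f, 0 < x :=
  (withDensity_absolutelyContinuous _ _).ae_le (ae_restrict_mem measurableSet_Ioi)

theorem Iic_inter_Ioi_zero (x : ℝ) : Iic x ∩ Ioi 0 = Ioc 0 x := by
  rw [inter_comm, Ioi_inter_Iic]

theorem isProbabilityMeasure_rho {α : ℝ} (h0 : 0 < α) (h1 : α < 1) :
    IsProbabilityMeasure (densityMeasure (rho α)) := ⟨by
  rw [densityMeasure_apply MeasurableSet.univ, univ_inter, ← rhoScaled_one,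
    lintegral_Ioi_rhoScaled h0 h1 one_pos]⟩

theorem densityMeasure_rho_Iic {α x : ℝ} (h0 : 0 < α) (h1 : α < 1) (hx : 0 ≤ x) :
    densityMeasure (rho α) (Iic x) = ENNReal.ofReal (cdfScaled α 1 x) := by
  rw [densityMeasure_apply measurableSet_Iic, Iic_inter_Ioi_zero, ← rhoScaled_one,
    lintegral_Ioc_rhoScaled h0 h1 one_pos hx]

theorem cdfScaled_one_div {α r x : ℝ} (h0 : 0 < α) (hr : 0 < r) (hx : 0 ≤ x) :
    cdfScaled α 1 (x / r ^ (1 / α)) = cdfScaled α r x := by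
  rw [cdfScaled, cdfScaled, Real.div_rpow hx (Real.rpow_nonneg hr.le _), ← Real.rpow_mul hr.le,
    one_div_mul_cancel h0.ne', Real.rpow_one, div_one]

/-- By 2 x^α r ≤ x^(2α) + r² and ellipticity. The bound does not depend on r, so it serves as a
constant dominating function under H. -/
theorem kernel_le {α x r : ℝ} (h0 : 0 < α) (h1 : α < 1) (hx : 0 < x) (hr : 0 < r) :
    x ^ (α - 1) * r / lampertiDenom α x r ≤ (2 * lampertiConst α)⁻¹ * x⁻¹ := by
  have hc := lampertiConst_pos h0 h1
  have hD := lampertiDenom_pos h0 h1 hx.le hr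
  rw [div_le_iff₀ hD, Real.rpow_sub_one hx.ne']
  have h2 := lampertiDenom_ge (α := α) hx.le hr.le
  have h3 : 2 * (x ^ α * r) ≤ (x ^ α) ^ 2 + r ^ 2 := by nlinarith [sq_nonneg (x ^ α - r)]
  have h4 : x ^ α * r ≤ (2 * lampertiConst α)⁻¹ * lampertiDenom α x r := by
    rw [inv_mul_eq_div, le_div_iff₀ (by positivity)]
    nlinarith
  calc x ^ α / x * r = x⁻¹ * (x ^ α * r) := by ring
    _ ≤ x⁻¹ * ((2 * lampertiConst α)⁻¹ * lampertiDenom α x r) := by gcongr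
    _ = _ := by ring

theorem kernel_nonneg {α x r : ℝ} (h0 : 0 < α) (h1 : α < 1) (hx : 0 < x) (hr : 0 < r) :
    0 ≤ x ^ (α - 1) * r / lampertiDenom α x r := by
  have hD := lampertiDenom_pos h0 h1 hx.le hr
  positivity

theorem measurable_kernel (α x : ℝ) :
    Measurable fun r : ℝ => x ^ (α - 1) * r / lampertiDenom α x r :=
  (measurable_id.const_mul _).div ((measurable_lampertiDenom α).comp measurable_prodMk_left)

theorem integrable_kernel {α x : ℝ} (h0 : 0 < α) (h1 : α < 1) (hx : 0 < x)
    {H : Measure ℝ} [IsFiniteMeasure H] (hH : ∀ᵐ r ∂H, 0 < r) :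
    Integrable (fun r => x ^ (α - 1) * r / lampertiDenom α x r) H := by
  refine Integrable.of_bound (measurable_kernel α x).aestronglyMeasurable
    ((2 * lampertiConst α)⁻¹ * x⁻¹) ?_
  filter_upwards [hH] with r hr
  rw [Real.norm_of_nonneg (kernel_nonneg h0 h1 hx hr)]
  exact kernel_le h0 h1 hx hr

theorem ofReal_rhoMix {α x : ℝ} (h0 : 0 < α) (h1 : α < 1) (hx : 0 < x)
    {H : Measure ℝ} [IsFiniteMeasure H] (hH : ∀ᵐ r ∂H, 0 < r) :
    ENNReal.ofReal (rhoMix α H x) = ∫⁻ r, ENNReal.ofReal (rhoScaled α r x) ∂H := by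
  rw [rhoMix, ← integral_const_mul, ofReal_integral_eq_lintegral_ofReal
    ((integrable_kernel h0 h1 hx hH).const_mul _)]
  · rfl
  · filter_upwards [hH] with r hr
    exact rhoScaled_nonneg h0 h1 hx.le hr

theorem densityMeasure_rhoMix_Ioc {α x : ℝ} (h0 : 0 < α) (h1 : α < 1) (hx : 0 ≤ x)
    {H : Measure ℝ} [IsFiniteMeasure H] (hH : ∀ᵐ r ∂H, 0 < r) :
    densityMeasure (rhoMix α H) (Iic x) = ∫⁻ r, ENNReal.ofReal (cdfScaled α r x) ∂H := by
  rw [densityMeasure_apply measurableSet_Iic, Iic_inter_Ioi_zero,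
    setLIntegral_congr_fun measurableSet_Ioc fun y hy => ofReal_rhoMix h0 h1 hy.1 hH,
    lintegral_lintegral_swap (measurable_rhoScaled α).ennreal_ofReal.aemeasurable]
  refine lintegral_congr_ae ?_
  filter_upwards [hH] with r hr
  exact lintegral_Ioc_rhoScaled h0 h1 hr hx

theorem isProbabilityMeasure_rhoMix {α : ℝ} (h0 : 0 < α) (h1 : α < 1)
    {H : Measure ℝ} [IsProbabilityMeasure H] (hH : ∀ᵐ r ∂H, 0 < r) :
    IsProbabilityMeasure (densityMeasure (rhoMix α H)) := ⟨by
  rw [densityMeasure_apply MeasurableSet.univ, univ_inter,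
    setLIntegral_congr_fun measurableSet_Ioi fun y hy => ofReal_rhoMix h0 h1 hy hH,
    lintegral_lintegral_swap (measurable_rhoScaled α).ennreal_ofReal.aemeasurable]
  rw [← measure_univ (μ := H), ← lintegral_one]
  refine lintegral_congr_ae ?_
  filter_upwards [hH] with r hr
  exact lintegral_Ioi_rhoScaled h0 h1 hr⟩

theorem measurable_mul_rpow (α : ℝ) : Measurable fun p : ℝ × ℝ => p.1 * p.2 ^ (1 / α) :=
  measurable_fst.mul (measurable_snd.pow_const _)

theorem prod_rho_le {α x : ℝ} (h0 : 0 < α) (h1 : α < 1) (hx : 0 ≤ x)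
    {H : Measure ℝ} [IsProbabilityMeasure H] (hH : ∀ᵐ r ∂H, 0 < r) :
    ((densityMeasure (rho α)).prod H) {p | p.1 * p.2 ^ (1 / α) ≤ x} =
      ∫⁻ r, ENNReal.ofReal (cdfScaled α r x) ∂H := by
  have := isProbabilityMeasure_rho h0 h1
  rw [Measure.prod_apply_symm (measurableSet_le (measurable_mul_rpow α) measurable_const)]
  refine lintegral_congr_ae ?_
  filter_upwards [hH] with r hr
  have hp : 0 < r ^ (1 / α) := Real.rpow_pos_of_pos hr _
  have : (fun y => (y, r)) ⁻¹' {p : ℝ × ℝ | p.1 * p.2 ^ (1 / α) ≤ x} = Iic (x / r ^ (1 / α)) := by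
    ext y
    exact (le_div_iff₀ hp).symm
  rw [this, densityMeasure_rho_Iic h0 h1 (by positivity), cdfScaled_one_div h0 hr hx]

/-- `ϱ_{α,H}` is the density of `X_α R ^ (1 / α)`. -/
theorem densityMeasure_rhoMix_eq_map {α : ℝ} (h0 : 0 < α) (h1 : α < 1)
    {H : Measure ℝ} [IsProbabilityMeasure H] (hH : ∀ᵐ r ∂H, 0 < r) :
    densityMeasure (rhoMix α H) =
      ((densityMeasure (rho α)).prod H).map fun p => p.1 * p.2 ^ (1 / α) := by
  have := isProbabilityMeasure_rho h0 h1
  have := isProbabilityMeasure_rhoMix h0 h1 hH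
  have hm := measurable_mul_rpow α
  have := Measure.isProbabilityMeasure_map (μ := (densityMeasure (rho α)).prod H) hm.aemeasurable
  refine Measure.ext_of_Iic _ _ fun x => ?_
  rw [Measure.map_apply hm measurableSet_Iic]
  rcases le_or_gt 0 x with hx | hx
  · rw [densityMeasure_rhoMix_Ioc h0 h1 hx hH]
    exact (prod_rho_le h0 h1 hx hH).symm
  · have e1 : densityMeasure (rhoMix α H) (Iic x) = 0 := by
      rw [measure_eq_zero_iff_ae_notMem]
      filter_upwards [ae_densityMeasure_pos (rhoMix α H)] with y hy hy'
      exact absurd (hy.trans_le hy') hx.not_gt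
    have e2 : ((densityMeasure (rho α)).prod H) ((fun p => p.1 * p.2 ^ (1 / α)) ⁻¹' Iic x) = 0 := by
      rw [measure_eq_zero_iff_ae_notMem]
      filter_upwards [Measure.quasiMeasurePreserving_fst.ae (ae_densityMeasure_pos (rho α)),
        Measure.quasiMeasurePreserving_snd.ae hH] with p hp1 hp2 hp
      have : 0 < p.1 * p.2 ^ (1 / α) := mul_pos hp1 (Real.rpow_pos_of_pos hp2 _)
      exact absurd (this.trans_le hp) hx.not_gt
    rw [e1, e2]

theorem integral_cdfScaled_eq {α x : ℝ} (h0 : 0 < α) (h1 : α < 1) (hx : 0 ≤ x)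
    {H : Measure ℝ} [IsProbabilityMeasure H] (hH : ∀ᵐ r ∂H, 0 < r) :
    upsilon α H x = ∫ r, cdfScaled α r x ∂H := by
  rw [upsilon, measureReal_def, prod_rho_le h0 h1 hx hH, integral_eq_lintegral_of_nonneg_ae _
    (measurable_cdfScaled α x).aestronglyMeasurable]
  filter_upwards [hH] with r hr
  exact cdfScaled_nonneg h0 h1 hr hx

theorem integrable_cdfScaled {α x : ℝ} (h0 : 0 < α) (h1 : α < 1) (hx : 0 ≤ x)
    {H : Measure ℝ} [IsFiniteMeasure H] (hH : ∀ᵐ r ∂H, 0 < r) :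
    Integrable (fun r => cdfScaled α r x) H := by
  refine Integrable.of_bound (measurable_cdfScaled α x).aestronglyMeasurable 1 ?_
  filter_upwards [hH] with r hr
  rw [Real.norm_of_nonneg (cdfScaled_nonneg h0 h1 hr hx)]
  exact cdfScaled_le_one h0

theorem upsilon_eq_arccot {α x : ℝ} (h0 : 0 < α) (h1 : α < 1) (hx : 0 ≤ x)
    {H : Measure ℝ} [IsProbabilityMeasure H] (hH : ∀ᵐ r ∂H, 0 < r) :
    upsilon α H x = 1 - 1 / (Real.pi * α) *
      ∫ r, arccot (Real.cot (Real.pi * α) + x ^ α / r / Real.sin (Real.pi * α)) ∂H := by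
  have hα : Real.pi * α ≠ 0 := (mul_pos Real.pi_pos h0).ne'
  have e : ∀ r, arccot (Real.cot (Real.pi * α) + x ^ α / r / Real.sin (Real.pi * α)) =
      Real.pi * α * (1 - cdfScaled α r x) := fun r => by
    rw [cdfScaled]
    field_simp
    ring
  simp_rw [e]
  rw [integral_const_mul, integral_sub (integrable_const _) (integrable_cdfScaled h0 h1 hx hH),
    integral_cdfScaled_eq h0 h1 hx hH]
  field_simp
  simp

theorem upsilon_eq_measureReal {α x : ℝ} (h0 : 0 < α) (h1 : α < 1)
    {H : Measure ℝ} [IsProbabilityMeasure H] (hH : ∀ᵐ r ∂H, 0 < r) :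
    (densityMeasure (rhoMix α H)).real (Ioc 0 x) = upsilon α H x := by
  have hae : (Ioc 0 x : Set ℝ) =ᵐ[densityMeasure (rhoMix α H)] Iic x := by
    filter_upwards [ae_densityMeasure_pos (rhoMix α H)] with y hy
    exact propext ⟨fun h => h.2, fun h => ⟨hy, h⟩⟩
  rw [measureReal_congr hae, upsilon, densityMeasure_rhoMix_eq_map h0 h1 hH,
    map_measureReal_apply (measurable_mul_rpow α) measurableSet_Iic]
  rfl

/-! ### Logarithmic potentials in the strip -/

theorem normSq_cexp_add (w : ℂ) (r : ℝ) :
    ‖Complex.exp w + r‖ ^ 2 =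
      Real.exp w.re ^ 2 + 2 * Real.exp w.re * r * Real.cos w.im + r ^ 2 := by
  rw [← Complex.normSq_eq_norm_sq, Complex.normSq_apply]
  simp only [Complex.add_re, Complex.add_im, Complex.exp_re, Complex.exp_im, Complex.ofReal_re,
    Complex.ofReal_im]
  linear_combination Real.exp w.re ^ 2 * Real.sin_sq_add_cos_sq w.im

/-- The cosine decreases in |Im w| on [0, π], so the worst case is the edge |Im w| = βπ, where the
quadratic form estimate applies. -/
theorem normSq_cexp_add_ge {β r : ℝ} {w : ℂ} (hβ : β ≤ 1) (hw : |w.im| ≤ β * Real.pi)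
    (hr : 0 ≤ r) :
    lampertiConst β * (Real.exp w.re ^ 2 + r ^ 2) ≤ ‖Complex.exp w + r‖ ^ 2 := by
  have hpi := Real.pi_pos
  rw [normSq_cexp_add]
  refine (quadForm_ge (Real.exp_pos _).le hr).trans ?_
  have hcos : Real.cos (β * Real.pi) ≤ Real.cos w.im := by
    rw [← Real.cos_abs w.im]
    exact Real.cos_le_cos_of_nonneg_of_le_pi (abs_nonneg _) (by nlinarith) hw
  have : 0 ≤ 2 * Real.exp w.re * r := by positivity
  nlinarith

theorem cexp_add_mem_slitPlane {w : ℂ} {r : ℝ} (hw : |w.im| < Real.pi) (hr : 0 < r) :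
    Complex.exp w + r ∈ Complex.slitPlane := by
  rw [Complex.mem_slitPlane_iff]
  simp only [Complex.add_re, Complex.add_im, Complex.exp_re, Complex.exp_im, Complex.ofReal_re,
    Complex.ofReal_im, add_zero]
  by_cases h : w.im = 0
  · left
    rw [h, Real.cos_zero]
    positivity
  · right
    obtain ⟨h1, h2⟩ := abs_lt.1 hw
    refine mul_ne_zero (Real.exp_pos _).ne' ?_
    rcases lt_or_gt_of_ne h with h | h
    · exact (Real.sin_neg_of_neg_of_neg_pi_lt h h1).ne
    · exact (Real.sin_pos_of_pos_of_lt_pi h h2).ne'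

/-- In the smaller strip |e^w + r| lies between (c/2)(e^(Re w) + r) and e^(Re w) + r, where c is the
ellipticity constant. Thus the real logarithmic moment controls the complex logarithm. -/
theorem abs_log_norm_cexp_add_le {β r : ℝ} {w : ℂ} (hβ0 : 0 < β) (hβ : β < 1)
    (hw : |w.im| ≤ β * Real.pi) (hr : 0 < r) :
    |Real.log ‖Complex.exp w + r‖| ≤
      |Real.log (Real.exp w.re + r)| + |Real.log (lampertiConst β / 2)| := by
  have hc := lampertiConst_pos hβ0 hβ
  have hc1 := lampertiConst_le_one β
  have hu := Real.exp_pos w.re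
  set u := Real.exp w.re with hu'
  have hlow : lampertiConst β / 2 * (u + r) ≤ ‖Complex.exp w + r‖ := by
    refine le_of_sq_le_sq ?_ (norm_nonneg _)
    refine le_trans ?_ (normSq_cexp_add_ge hβ.le hw hr.le)
    rw [← hu']
    have h1 : (u + r) ^ 2 ≤ 2 * (u ^ 2 + r ^ 2) := by nlinarith [sq_nonneg (u - r)]
    have h2 : 0 ≤ u ^ 2 + r ^ 2 := by positivity
    rw [mul_pow]
    have h3 : (lampertiConst β / 2) ^ 2 ≤ lampertiConst β / 2 := by nlinarith
    calc (lampertiConst β / 2) ^ 2 * (u + r) ^ 2 ≤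
        lampertiConst β / 2 * (2 * (u ^ 2 + r ^ 2)) := by gcongr
      _ = _ := by ring
  have hup : ‖Complex.exp w + r‖ ≤ u + r := by
    refine (norm_add_le _ _).trans_eq ?_
    rw [Complex.norm_exp, Complex.norm_real, Real.norm_of_nonneg hr.le]
  have hpos : 0 < lampertiConst β / 2 * (u + r) := by positivity
  have h1 := Real.log_le_log hpos hlow
  have h2 := Real.log_le_log (hpos.trans_le hlow) hup
  rw [Real.log_mul (by positivity) (by positivity)] at h1
  rw [abs_le]
  constructor
  · linarith [neg_abs_le (Real.log (u + r)), neg_abs_le (Real.log (lampertiConst β / 2))]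
  · linarith [le_abs_self (Real.log (u + r)), abs_nonneg (Real.log (lampertiConst β / 2))]

/-- The complex logarithmic potential, in the coordinate `w = log z`. -/
noncomputable def stripPotential (G : Measure ℝ) (w : ℂ) : ℂ :=
  ∫ r, Complex.log (Complex.exp w + r) ∂G

theorem exists_strip_const {w : ℂ} (hw : |w.im| < Real.pi) :
    ∃ β : ℝ, 0 < β ∧ β < 1 ∧ |w.im| < β * Real.pi := by
  have hpi := Real.pi_pos
  obtain ⟨β, h1, h2⟩ := exists_between ((div_lt_one hpi).2 hw)
  exact ⟨β, (div_nonneg (abs_nonneg _) hpi.le).trans_lt h1, h2, (div_lt_iff₀ hpi).1 h1⟩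

theorem measurable_clog_cexp_add (w : ℂ) :
    Measurable fun r : ℝ => Complex.log (Complex.exp w + r) :=
  Complex.measurable_log.comp (by fun_prop)

theorem integrable_clog_cexp_add {G : Measure ℝ} [IsFiniteMeasure G] (hpos : ∀ᵐ y ∂G, 0 < y)
    (hlog : Integrable (fun y => Real.log (1 + y)) G) {w : ℂ} (hw : |w.im| < Real.pi) :
    Integrable (fun r : ℝ => Complex.log (Complex.exp w + r)) G := by
  obtain ⟨β, h0, h1, h2⟩ := exists_strip_const hw
  refine ((((integrable_log_add hpos hlog (Real.exp_pos w.re)).abs).add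
    (integrable_const |Real.log (lampertiConst β / 2)|)).add (integrable_const Real.pi)).mono'
    (measurable_clog_cexp_add w).aestronglyMeasurable ?_
  filter_upwards [hpos] with r hr
  refine (Complex.norm_le_abs_re_add_abs_im _).trans ?_
  rw [Complex.log_re, Complex.log_im]
  exact add_le_add (abs_log_norm_cexp_add_le h0 h1 h2.le hr) (Complex.abs_arg_le_pi _)

/-- On |Im z| < βπ with β < 1 the quotient e^z/(e^z + r) is bounded by c^(-1/2) uniformly in z and
r, c being the ellipticity constant, which permits differentiation under the integral. -/
theorem hasDerivAt_stripPotential {G : Measure ℝ} [IsFiniteMeasure G] (hpos : ∀ᵐ y ∂G, 0 < y)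
    (hlog : Integrable (fun y => Real.log (1 + y)) G) {w : ℂ} (hw : |w.im| < Real.pi) :
    HasDerivAt (stripPotential G) (∫ r : ℝ, Complex.exp w / (Complex.exp w + r) ∂G) w := by
  obtain ⟨β, h0, h1, h2⟩ := exists_strip_const hw
  have hc := lampertiConst_pos h0 h1
  have hopen : IsOpen {z : ℂ | |z.im| < β * Real.pi} :=
    isOpen_lt (by fun_prop) continuous_const
  have hlt : ∀ z ∈ {z : ℂ | |z.im| < β * Real.pi}, |z.im| < Real.pi := fun z hz =>
    lt_trans hz (by nlinarith [Real.pi_pos])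
  refine (hasDerivAt_integral_of_dominated_loc_of_deriv_le (s := {z : ℂ | |z.im| < β * Real.pi})
    (F := fun z (r : ℝ) => Complex.log (Complex.exp z + r))
    (F' := fun z (r : ℝ) => Complex.exp z / (Complex.exp z + r))
    (bound := fun _ => (√(lampertiConst β))⁻¹) (hopen.mem_nhds h2)
    (Eventually.of_forall fun z => (measurable_clog_cexp_add z).aestronglyMeasurable)
    (integrable_clog_cexp_add hpos hlog hw) ?_ ?_ (integrable_const _) ?_).2
  · exact (Measurable.div measurable_const (by fun_prop)).aestronglyMeasurable
  · filter_upwards [hpos] with r hr z hz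
    have h3 := normSq_cexp_add_ge h1.le (le_of_lt hz) hr.le
    have h4 : √(lampertiConst β) * Real.exp z.re ≤ ‖Complex.exp z + r‖ := by
      refine le_of_sq_le_sq ?_ (norm_nonneg _)
      rw [mul_pow, Real.sq_sqrt hc.le]
      nlinarith [sq_nonneg r]
    have h5 : 0 < √(lampertiConst β) * Real.exp z.re :=
      mul_pos (Real.sqrt_pos.2 hc) (Real.exp_pos _)
    rw [norm_div, Complex.norm_exp, div_le_iff₀ (h5.trans_le h4), inv_mul_eq_div,
      le_div_iff₀ (Real.sqrt_pos.2 hc), mul_comm]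
    exact h4
  · filter_upwards [hpos] with r hr z hz
    exact ((Complex.hasDerivAt_exp z).add_const (r : ℂ)).clog
      (cexp_add_mem_slitPlane (hlt z hz) hr)

theorem stripPotential_re {G : Measure ℝ} [IsFiniteMeasure G] (hpos : ∀ᵐ y ∂G, 0 < y)
    (hlog : Integrable (fun y => Real.log (1 + y)) G) {w : ℂ} (hw : |w.im| < Real.pi) :
    (stripPotential G w).re = ∫ r : ℝ, Real.log ‖Complex.exp w + r‖ ∂G := by
  have := integral_re (𝕜 := ℂ) (integrable_clog_cexp_add hpos hlog hw)
  simp only [RCLike.re_to_complex, Complex.log_re] at this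
  exact this.symm

theorem stripPotential_im {G : Measure ℝ} [IsFiniteMeasure G] (hpos : ∀ᵐ y ∂G, 0 < y)
    (hlog : Integrable (fun y => Real.log (1 + y)) G) {w : ℂ} (hw : |w.im| < Real.pi) :
    (stripPotential G w).im = ∫ r : ℝ, Complex.arg (Complex.exp w + r) ∂G := by
  have := integral_im (𝕜 := ℂ) (integrable_clog_cexp_add hpos hlog hw)
  simp only [RCLike.im_to_complex, Complex.log_im] at this
  exact this.symm

theorem stripPotential_ofReal {G : Measure ℝ} (hpos : ∀ᵐ y ∂G, 0 < y) (a : ℝ) :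
    stripPotential G a = ((∫ r : ℝ, Real.log (Real.exp a + r) ∂G : ℝ) : ℂ) := by
  rw [stripPotential, ← integral_complex_ofReal]
  refine integral_congr_ae ?_
  filter_upwards [hpos] with r hr
  rw [← Complex.ofReal_exp, ← Complex.ofReal_add, Complex.ofReal_log (by positivity)]

theorem stripPotential_conj {G : Measure ℝ} (hpos : ∀ᵐ y ∂G, 0 < y) {w : ℂ}
    (hw : |w.im| < Real.pi) :
    stripPotential G ((starRingEnd ℂ) w) = (starRingEnd ℂ) (stripPotential G w) := by
  rw [stripPotential, stripPotential, ← integral_conj]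
  refine integral_congr_ae ?_
  filter_upwards [hpos] with r hr
  rw [Complex.exp_conj, ← Complex.log_conj _
    (Complex.slitPlane_arg_ne_pi (cexp_add_mem_slitPlane hw hr))]
  simp

/-! ### Integration against densities -/

theorem integrable_densityMeasure_iff {f g : ℝ → ℝ} (hf : Measurable f)
    (h0 : ∀ x ∈ Ioi (0 : ℝ), 0 ≤ f x) :
    Integrable g (densityMeasure f) ↔ IntegrableOn (fun x => f x * g x) (Ioi 0) := by
  rw [densityMeasure, integrable_withDensity_iff_integrable_smul' hf.ennreal_ofReal
    (Eventually.of_forall fun x => ENNReal.ofReal_lt_top), IntegrableOn]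
  refine integrable_congr ?_
  filter_upwards [ae_restrict_mem measurableSet_Ioi] with x hx
  rw [ENNReal.toReal_ofReal (h0 x hx), smul_eq_mul]

theorem integral_densityMeasure {f g : ℝ → ℝ} (hf : Measurable f)
    (h0 : ∀ x ∈ Ioi (0 : ℝ), 0 ≤ f x) :
    ∫ x, g x ∂densityMeasure f = ∫ x in Ioi 0, f x * g x := by
  rw [densityMeasure, integral_withDensity_eq_integral_toReal_smul hf.ennreal_ofReal
    (Eventually.of_forall fun x => ENNReal.ofReal_lt_top)]
  refine setIntegral_congr_fun measurableSet_Ioi fun x hx => ?_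
  simp only [ENNReal.toReal_ofReal (h0 x hx), smul_eq_mul]

/-! ### The logarithmic potential of the Lamperti laws -/

theorem measurable_rho (α : ℝ) : Measurable (rho α) := by
  rw [← rhoScaled_one]
  exact (measurable_rhoScaled α).comp measurable_prodMk_right

theorem rho_nonneg {α : ℝ} (h0 : 0 < α) (h1 : α < 1) : ∀ x ∈ Ioi (0 : ℝ), 0 ≤ rho α x := by
  intro x hx
  rw [← rhoScaled_one]
  exact rhoScaled_nonneg h0 h1 (le_of_lt hx) one_pos

theorem abs_im_mul_le {α : ℝ} (h0 : 0 < α) {w : ℂ} (hw : |w.im| ≤ Real.pi) :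
    |((α : ℂ) * w).im| ≤ α * Real.pi := by
  rw [Complex.im_ofReal_mul, abs_mul, abs_of_pos h0]
  gcongr

theorem abs_im_mul_lt {α : ℝ} (h0 : 0 < α) (h1 : α < 1) {w : ℂ} (hw : |w.im| ≤ Real.pi) :
    |((α : ℂ) * w).im| < Real.pi :=
  (abs_im_mul_le h0 hw).trans_lt (by nlinarith [Real.pi_pos])

/-- Multiplication by α < 1 maps the closed strip |Im w| ≤ π into |Im| ≤ απ < π. Hence the bound
persists on the edges, and no boundary limits are needed for functions of α w. -/
theorem norm_cexp_mul_add_ge {α r : ℝ} (h0 : 0 < α) (h1 : α < 1) {w : ℂ} (hw : |w.im| ≤ Real.pi)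
    (hr : 0 ≤ r) :
    √(lampertiConst α) * max (Real.exp (α * w.re)) r ≤ ‖Complex.exp (α * w) + r‖ := by
  refine le_of_sq_le_sq ?_ (norm_nonneg _)
  have hc := lampertiConst_pos h0 h1
  refine le_trans ?_ (normSq_cexp_add_ge h1.le (abs_im_mul_le h0 hw) hr)
  rw [mul_pow, Real.sq_sqrt hc.le, Complex.re_ofReal_mul]
  gcongr
  rcases max_cases (Real.exp (α * w.re)) r with h | h
  · rw [h.1]
    nlinarith [sq_nonneg r]
  · rw [h.1]
    nlinarith [sq_nonneg (Real.exp (α * w.re))]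

theorem normSq_cexp_mul_add {α r u : ℝ} :
    ‖Complex.exp (α * (u + Real.pi * Complex.I)) + r‖ ^ 2 = lampertiDenom α (Real.exp u) r := by
  rw [normSq_cexp_add, lampertiDenom_eq (Real.exp_pos u).le, ← Real.exp_mul]
  simp only [Complex.re_ofReal_mul, Complex.im_ofReal_mul, Complex.add_re, Complex.add_im,
    Complex.ofReal_re, Complex.ofReal_im, Complex.mul_I_re, Complex.mul_I_im]
  rw [mul_comm u α]
  simp

/-- The Stieltjes transform of `ϱ_α`. -/
theorem integral_rho_div {α : ℝ} (h0 : 0 < α) (h1 : α < 1) {s : ℝ} (hs : 0 < s) :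
    ∫ t in Ioi 0, rho α t / (s + t) = s ^ (α - 1) / (1 + s ^ α) := by
  have hpi := Real.pi_pos
  have hc := lampertiConst_pos h0 h1
  have hsc := Real.sqrt_pos.2 hc
  -- This is z^(α-1)/(z^α + 1) with z = e^w. Its size e^((α-1) Re w) on the left half-strip dictates
  -- the rate δ = α; on the right it is O(e^(-Re w)), which is more than enough.
  set k : ℂ → ℂ := fun w => Complex.exp ((α - 1 : ℝ) * w) / (Complex.exp (α * w) + (1 : ℝ)) with hk
  have hne : ∀ w : ℂ, |w.im| ≤ Real.pi → Complex.exp (α * w) + (1 : ℝ) ≠ 0 := fun w hw =>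
    Complex.slitPlane_ne_zero (cexp_add_mem_slitPlane (abs_im_mul_lt h0 h1 hw) one_pos)
  have hb : ∀ w : ℂ, |w.im| ≤ Real.pi → ‖k w‖ ≤
      Real.exp ((α - 1) * w.re) / (√(lampertiConst α) * max (Real.exp (α * w.re)) 1) := by
    intro w hw
    rw [hk, norm_div, Complex.norm_exp, Complex.re_ofReal_mul]
    gcongr
    exact norm_cexp_mul_add_ge h0 h1 hw zero_le_one
  have hz := stieltjes_of_strip (k := k) (C := (√(lampertiConst α))⁻¹) (δ := α) (φ := rho α)
    (by positivity) h0
    (fun w hw => DifferentiableAt.div (by fun_prop) (by fun_prop) (hne w hw))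
    (fun w hw h => by
      refine (hb w hw).trans ?_
      rw [← div_div, div_right_comm, ← one_div, one_div_mul_eq_div]
      gcongr
      rw [div_le_iff₀ (by positivity)]
      refine le_trans ?_ (mul_le_mul_of_nonneg_left (le_max_left _ _) (Real.exp_pos _).le)
      rw [← Real.exp_add]
      exact Real.exp_le_exp.2 (by nlinarith))
    (fun w hw h => by
      refine (hb w hw).trans ?_
      rw [← div_div, div_right_comm, ← one_div, one_div_mul_eq_div]
      gcongr
      rw [div_le_iff₀ (by positivity)]
      refine le_trans ?_ (mul_le_mul_of_nonneg_left (le_max_right _ _) (Real.exp_pos _).le)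
      rw [mul_one])
    (fun u => by
      simp only [hk, map_div₀, map_add, ← Complex.exp_conj, map_mul, Complex.conj_ofReal,
        Complex.conj_I]
      rw [mul_neg]
      simp only [← sub_eq_add_neg])
    (fun u => by
      have hD : lampertiDenom α (Real.exp u) 1 ≠ 0 :=
        (lampertiDenom_pos h0 h1 (Real.exp_pos u).le one_pos).ne'
      have e1 : Complex.exp ((α - 1 : ℝ) * (u + Real.pi * Complex.I)) =
          -((Real.exp u ^ (α - 1) : ℝ) : ℂ) *
            (Real.cos (α * Real.pi) + Real.sin (α * Real.pi) * Complex.I) := by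
        rw [show ((α - 1 : ℝ) * (u + Real.pi * Complex.I) : ℂ) = (u * (α - 1) : ℝ) +
          ((α * Real.pi : ℝ) * Complex.I - Real.pi * Complex.I) by push_cast; ring,
          Complex.exp_add, Complex.exp_sub, Complex.exp_pi_mul_I, ← Complex.ofReal_exp,
          Real.exp_mul, Complex.exp_mul_I, Complex.ofReal_cos, Complex.ofReal_sin]
        ring
      have e2 : Complex.exp (α * (u + Real.pi * Complex.I)) =
          ((Real.exp u ^ α : ℝ) : ℂ) *
            (Real.cos (α * Real.pi) + Real.sin (α * Real.pi) * Complex.I) := by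
        rw [show (α * (u + Real.pi * Complex.I) : ℂ) = (u * α : ℝ) +
          ((α * Real.pi : ℝ) * Complex.I) by push_cast; ring,
          Complex.exp_add, ← Complex.ofReal_exp,
          Real.exp_mul, Complex.exp_mul_I, Complex.ofReal_cos, Complex.ofReal_sin]
      rw [hk]
      simp only
      rw [Complex.div_im, Complex.normSq_eq_norm_sq, normSq_cexp_mul_add, e1, e2, rho]
      simp only [Complex.add_re, Complex.add_im, Complex.mul_re, Complex.mul_im, Complex.neg_re,
        Complex.neg_im, Complex.ofReal_re, Complex.ofReal_im, Complex.I_re, Complex.I_im]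
      rw [mul_comm Real.pi α]
      field_simp
      ring)
    hs
  rw [hz.2]
  simp only [hk]
  rw [← Complex.ofReal_mul, ← Complex.ofReal_mul, ← Complex.ofReal_exp, ← Complex.ofReal_exp,
    ← Complex.ofReal_add, ← Complex.ofReal_div, Complex.ofReal_re, Real.rpow_def_of_pos hs,
    Real.rpow_def_of_pos hs, mul_comm (Real.log s), mul_comm (Real.log s), add_comm]

/-- On (0, 1] the logarithm is bounded; beyond 1 the density is O(y^(-1-α)) while log(1 + y) is
O(y^(α/2)). -/
theorem integrable_log_one_add_rho {α : ℝ} (h0 : 0 < α) (h1 : α < 1) :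
    Integrable (fun y => Real.log (1 + y)) (densityMeasure (rho α)) := by
  have := isProbabilityMeasure_rho h0 h1
  have hs := sin_pi_mul_pos h0 h1
  have hc := lampertiConst_pos h0 h1
  have hpi := Real.pi_pos
  have hm : Measurable fun y => rho α y * Real.log (1 + y) :=
    (measurable_rho α).mul (measurable_log_add 1)
  rw [integrable_densityMeasure_iff (measurable_rho α) (rho_nonneg h0 h1)]
  have hi1 : IntegrableOn (rho α) (Ioi 0) := by
    simpa using (integrable_densityMeasure_iff (g := fun _ => 1) (measurable_rho α)
      (rho_nonneg h0 h1)).1 (integrable_const 1)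
  rw [← Ioc_union_Ioi_eq_Ioi zero_le_one]
  refine IntegrableOn.union ?_ ?_
  · refine ((hi1.mono_set Ioc_subset_Ioi_self).mul_const (Real.log 2)).mono'
      hm.aestronglyMeasurable ?_
    filter_upwards [ae_restrict_mem measurableSet_Ioc] with y hy
    have h2 := rho_nonneg h0 h1 y hy.1
    have h3 : 0 ≤ Real.log (1 + y) := Real.log_nonneg (by linarith [hy.1])
    rw [Real.norm_of_nonneg (mul_nonneg h2 h3)]
    gcongr
    · linarith [hy.1]
    · linarith [hy.2]
  · have hi := (integrableOn_Ioi_rpow_of_lt (by linarith : -1 - α / 2 < -1) one_pos).const_mul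
      (Real.sin (Real.pi * α) / Real.pi * (lampertiConst α)⁻¹ * (2 ^ (α / 2) / (α / 2)))
    refine Integrable.mono' hi hm.aestronglyMeasurable ?_
    filter_upwards [ae_restrict_mem measurableSet_Ioi] with y hy
    have hy1 : 1 < y := hy
    have hy0 : 0 < y := by linarith
    have h2 := rho_nonneg h0 h1 y hy0
    have h3 : 0 ≤ Real.log (1 + y) := Real.log_nonneg (by linarith)
    rw [Real.norm_of_nonneg (mul_nonneg h2 h3)]
    have h4 : Real.log (1 + y) ≤ 2 ^ (α / 2) / (α / 2) * y ^ (α / 2) := by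
      refine (Real.log_le_rpow_div (by linarith) (by linarith : 0 < α / 2)).trans ?_
      rw [div_mul_eq_mul_div, ← Real.mul_rpow (by norm_num) hy0.le]
      gcongr
      linarith
    have hya := Real.rpow_pos_of_pos hy0 α
    have h5 : rho α y ≤ Real.sin (Real.pi * α) / Real.pi *
        ((lampertiConst α)⁻¹ * (y ^ (-1 : ℝ) * (y ^ α)⁻¹)) := by
      unfold rho
      gcongr
      have hD := lampertiDenom_pos h0 h1 hy0.le one_pos
      have hD2 := lampertiDenom_ge (α := α) hy0.le zero_le_one
      rw [div_le_iff₀ hD, Real.rpow_sub_one hy0.ne', Real.rpow_neg_one]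
      have : lampertiConst α * (y ^ α) ^ 2 ≤ lampertiDenom α y 1 := by nlinarith
      calc y ^ α / y = (lampertiConst α)⁻¹ * (y⁻¹ * (y ^ α)⁻¹) *
            (lampertiConst α * (y ^ α) ^ 2) := by field_simp
        _ ≤ _ := by gcongr
    calc rho α y * Real.log (1 + y) ≤ (Real.sin (Real.pi * α) / Real.pi *
          ((lampertiConst α)⁻¹ * (y ^ (-1 : ℝ) * (y ^ α)⁻¹))) *
          (2 ^ (α / 2) / (α / 2) * y ^ (α / 2)) := by gcongr
      _ = _ := by
        have : y ^ (-1 - α / 2) = y ^ (-1 : ℝ) * (y ^ α)⁻¹ * y ^ (α / 2) := by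
          rw [← Real.rpow_neg hy0.le, ← Real.rpow_add hy0, ← Real.rpow_add hy0]
          congr 1
          ring
        rw [this]
        ring

/-- Both sides have derivative s^(α-1)/(1 + s^α), the Stieltjes transform of ϱ_α. The constant is 0
because each side minus log s tends to 0 as s → ∞. -/
theorem integral_log_add_rho {α : ℝ} (h0 : 0 < α) (h1 : α < 1) {s : ℝ} (hs : 0 < s) :
    ∫ y, Real.log (s + y) ∂densityMeasure (rho α) = 1 / α * Real.log (1 + s ^ α) := by
  have := isProbabilityMeasure_rho h0 h1
  have hpos := ae_densityMeasure_pos (rho α)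
  have hlog := integrable_log_one_add_rho h0 h1
  let h : ℝ → ℝ := fun s => ∫ y, Real.log (s + y) ∂densityMeasure (rho α) -
    1 / α * Real.log (1 + s ^ α)
  have hd : ∀ s ∈ Ioi (0 : ℝ), HasDerivAt h 0 s := by
    intro s hs
    have hs0 : 0 < s := hs
    have e1 := hasDerivAt_integral_log_add hpos hlog hs
    have e2 : HasDerivAt (fun s : ℝ => 1 / α * Real.log (1 + s ^ α))
        (1 / α * (α * s ^ (α - 1) / (1 + s ^ α))) s :=
      (((Real.hasDerivAt_rpow_const (Or.inl hs0.ne')).const_add 1).log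
        (by positivity)).const_mul _
    refine (e1.sub e2).congr_deriv ?_
    rw [integral_densityMeasure (measurable_rho α) (rho_nonneg h0 h1)]
    simp_rw [Real.rpow_neg_one, ← div_eq_mul_inv]
    rw [integral_rho_div h0 h1 hs]
    field_simp
    simp
  have hconst : ∀ x ∈ Ioi (0 : ℝ), ∀ y ∈ Ioi (0 : ℝ), h x = h y := fun x hx y hy =>
    (convex_Ioi (0 : ℝ)).is_const_of_fderivWithin_eq_zero (𝕜 := ℝ)
      (fun x hx => (hd x hx).differentiableAt.differentiableWithinAt)
      (fun x hx => by
        rw [fderivWithin_of_isOpen isOpen_Ioi hx]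
        ext
        simp [(hd x hx).deriv]) hx hy
  have hlim : Tendsto h atTop (𝓝 0) := by
    have e1 := tendsto_integral_log_add_sub_log hpos hlog
    have e2 : Tendsto (fun s : ℝ => 1 / α * Real.log (1 + s ^ (-α))) atTop
        (𝓝 (1 / α * Real.log (1 + 0))) :=
      (((tendsto_rpow_neg_atTop h0).const_add 1).log (by norm_num)).const_mul _
    have e3 := e1.sub e2
    rw [add_zero, Real.log_one, mul_zero, sub_zero] at e3
    refine e3.congr' ?_
    filter_upwards [eventually_gt_atTop (0 : ℝ)] with s hs
    have e4 : 1 + s ^ α = s ^ α * (1 + s ^ (-α)) := by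
      rw [mul_add, ← Real.rpow_add hs]
      simp [add_comm]
    simp only [h]
    rw [e4, Real.log_mul (by positivity) (by positivity), Real.log_rpow hs]
    field_simp
    ring
  have : h s = 0 := by
    refine tendsto_nhds_unique (tendsto_const_nhds.congr' ?_) hlim
    filter_upwards [eventually_gt_atTop (0 : ℝ)] with t ht
    exact hconst s hs t ht
  exact sub_eq_zero.1 this

/-- From 1 + ab ≤ (1 + a)(1 + b) and the superadditivity of t ↦ t^(1/α), valid as 1/α ≥ 1. It
carries the logarithmic moment of H over to ϱ_{α,H}. -/
theorem log_one_add_mul_rpow_le {α y r : ℝ} (h0 : 0 < α) (h1 : α < 1) (hy : 0 < y) (hr : 0 < r) :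
    Real.log (1 + y * r ^ (1 / α)) ≤ Real.log (1 + y) + 1 / α * Real.log (1 + r) := by
  have hq := Real.rpow_pos_of_pos hr (1 / α)
  have h2 : 1 + r ^ (1 / α) ≤ (1 + r) ^ (1 / α) := by
    have := Real.add_rpow_le_rpow_add zero_le_one hr.le ((one_le_div h0).2 h1.le)
    rwa [Real.one_rpow] at this
  rw [← Real.log_rpow (by linarith), ← Real.log_mul (by linarith) (by positivity)]
  refine Real.log_le_log (by positivity) ?_
  nlinarith

theorem rhoMix_nonneg {α : ℝ} {H : Measure ℝ} (h0 : 0 < α) (h1 : α < 1) (hH : ∀ᵐ r ∂H, 0 < r) :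
    ∀ x ∈ Ioi (0 : ℝ), 0 ≤ rhoMix α H x := by
  intro x hx
  have := sin_pi_mul_pos h0 h1
  have := Real.pi_pos
  refine mul_nonneg (by positivity) (integral_nonneg_of_ae ?_)
  filter_upwards [hH] with r hr
  exact kernel_nonneg h0 h1 hx hr

section
variable {α : ℝ} {H : Measure ℝ} [IsProbabilityMeasure H]

theorem integrable_log_one_add_rhoMix (h0 : 0 < α) (h1 : α < 1) (hH : ∀ᵐ r ∂H, 0 < r)
    (hlog : Integrable (fun r => Real.log (1 + r)) H) :
    Integrable (fun y => Real.log (1 + y)) (densityMeasure (rhoMix α H)) := by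
  have := isProbabilityMeasure_rho h0 h1
  have hm := measurable_mul_rpow α
  rw [densityMeasure_rhoMix_eq_map h0 h1 hH, integrable_map_measure
    (measurable_log_add 1).aestronglyMeasurable hm.aemeasurable]
  refine (((integrable_log_one_add_rho h0 h1).comp_fst H).add
    ((hlog.comp_snd (densityMeasure (rho α))).const_mul (1 / α))).mono'
    ((measurable_log_add 1).comp hm).aestronglyMeasurable ?_
  filter_upwards [Measure.quasiMeasurePreserving_fst.ae (ae_densityMeasure_pos (rho α)),
        Measure.quasiMeasurePreserving_snd.ae hH] with p hp1 hp2
  have : 0 < p.1 * p.2 ^ (1 / α) := mul_pos hp1 (Real.rpow_pos_of_pos hp2 _)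
  rw [Function.comp_apply, Real.norm_of_nonneg (Real.log_nonneg (by linarith))]
  exact log_one_add_mul_rpow_le h0 h1 hp1 hp2

theorem integral_log_add_mul_rho (h0 : 0 < α) (h1 : α < 1) {s r : ℝ} (hs : 0 < s) (hr : 0 < r) :
    ∫ y, Real.log (s + y * r ^ (1 / α)) ∂densityMeasure (rho α) =
      1 / α * Real.log (s ^ α + r) := by
  have := isProbabilityMeasure_rho h0 h1
  have hpos := ae_densityMeasure_pos (rho α)
  have hq := Real.rpow_pos_of_pos hr (1 / α)
  have h2 : ∫ y, Real.log (s + y * r ^ (1 / α)) ∂densityMeasure (rho α) =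
      ∫ y, (Real.log (r ^ (1 / α)) + Real.log (s / r ^ (1 / α) + y)) ∂densityMeasure (rho α) := by
    refine integral_congr_ae ?_
    filter_upwards [hpos] with y hy
    rw [← Real.log_mul hq.ne' (by positivity)]
    congr 1
    field_simp
  rw [h2, integral_add (integrable_const _)
    (integrable_log_add hpos (integrable_log_one_add_rho h0 h1) (by positivity)),
    integral_log_add_rho h0 h1 (by positivity), Real.log_rpow hr, Real.div_rpow hs.le hq.le,
    ← Real.rpow_mul hr.le, one_div_mul_cancel h0.ne', Real.rpow_one]
  have h3 : s ^ α + r = r * (1 + s ^ α / r) := by field_simp; ring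
  rw [h3, Real.log_mul hr.ne' (by positivity)]
  simp
  ring

theorem integral_log_add_rhoMix (h0 : 0 < α) (h1 : α < 1) (hH : ∀ᵐ r ∂H, 0 < r)
    (hlog : Integrable (fun r => Real.log (1 + r)) H) {s : ℝ} (hs : 0 < s) :
    ∫ y, Real.log (s + y) ∂densityMeasure (rhoMix α H) =
      1 / α * ∫ r, Real.log (s ^ α + r) ∂H := by
  have := isProbabilityMeasure_rho h0 h1
  have := isProbabilityMeasure_rhoMix h0 h1 hH
  have hm := measurable_mul_rpow α
  have hi := integrable_log_add (ae_densityMeasure_pos (rhoMix α H))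
    (integrable_log_one_add_rhoMix h0 h1 hH hlog) hs
  rw [densityMeasure_rhoMix_eq_map h0 h1 hH] at hi ⊢
  replace hi : Integrable (fun p : ℝ × ℝ => Real.log (s + p.1 * p.2 ^ (1 / α)))
      ((densityMeasure (rho α)).prod H) :=
    (integrable_map_measure (measurable_log_add s).aestronglyMeasurable hm.aemeasurable).1 hi
  rw [integral_map hm.aemeasurable (measurable_log_add s).aestronglyMeasurable,
    integral_prod_symm _ hi, ← integral_const_mul]
  refine integral_congr_ae ?_
  filter_upwards [hH] with r hr
  exact integral_log_add_mul_rho h0 h1 hs hr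

/-- The complex logarithmic potential of `ϱ_{α,H}` is that of `H` after `w ↦ α w`. -/
theorem stripPotential_rhoMix (h0 : 0 < α) (h1 : α < 1) (hH : ∀ᵐ r ∂H, 0 < r)
    (hlog : Integrable (fun r => Real.log (1 + r)) H) {w : ℂ} (hw : |w.im| < Real.pi) :
    stripPotential (densityMeasure (rhoMix α H)) w = 1 / α * stripPotential H (α * w) := by
  have := isProbabilityMeasure_rhoMix h0 h1 hH
  have hν := ae_densityMeasure_pos (rhoMix α H)
  have hνlog := integrable_log_one_add_rhoMix h0 h1 hH hlog
  set U : Set ℂ := {z : ℂ | |z.im| < Real.pi} with hU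
  have hUo : IsOpen U := isOpen_lt (by fun_prop) continuous_const
  have hUc : IsPreconnected U := by
    have : U = Complex.imLm ⁻¹' Ioo (-Real.pi) Real.pi := by
      ext z
      simp [hU, abs_lt]
    rw [this]
    exact ((convex_Ioo _ _).linear_preimage Complex.imLm).isPreconnected
  have hA : AnalyticOnNhd ℂ (stripPotential (densityMeasure (rhoMix α H))) U :=
    DifferentiableOn.analyticOnNhd (fun z hz =>
      (hasDerivAt_stripPotential hν hνlog hz).differentiableAt.differentiableWithinAt) hUo
  have hB : AnalyticOnNhd ℂ (fun w => 1 / α * stripPotential H (α * w)) U := by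
    refine DifferentiableOn.analyticOnNhd (fun z hz => ?_) hUo
    have := (hasDerivAt_stripPotential hH hlog
      (abs_im_mul_lt h0 h1 (le_of_lt hz))).differentiableAt
    exact ((this.comp z (by fun_prop)).const_mul _).differentiableWithinAt
  have hreal : ∀ a : ℝ, stripPotential (densityMeasure (rhoMix α H)) a =
      1 / α * stripPotential H (α * a) := by
    intro a
    rw [← Complex.ofReal_mul, stripPotential_ofReal hν, stripPotential_ofReal hH,
      integral_log_add_rhoMix h0 h1 hH hlog (Real.exp_pos a), ← Real.exp_mul, mul_comm a]
    push_cast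
    ring
  -- Identity theorem: both sides are analytic in the open strip and agree on the real axis, where
  -- the points 1/(n + 1) accumulate at 0.
  refine hA.eqOn_of_preconnected_of_frequently_eq hB hUc (z₀ := 0)
    (by simpa [hU] using Real.pi_pos) ?_ hw
  have ht : Tendsto (fun n : ℕ => (((1 : ℝ) / (n + 1) : ℝ) : ℂ)) atTop (𝓝[≠] 0) := by
    refine tendsto_nhdsWithin_iff.2 ⟨?_, Eventually.of_forall fun n => ?_⟩
    · exact (Complex.continuous_ofReal.tendsto 0).comp
        (tendsto_one_div_add_atTop_nhds_zero_nat (𝕜 := ℝ))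
    · simp only [mem_compl_iff, mem_singleton_iff, Complex.ofReal_eq_zero]
      positivity
  exact ht.frequently (Frequently.of_forall fun n => hreal _)

theorem measurable_rhoMix (α : ℝ) (H : Measure ℝ) [SFinite H] : Measurable (rhoMix α H) := by
  unfold rhoMix
  refine Measurable.const_mul ?_ _
  have : Measurable fun p : ℝ × ℝ => p.1 ^ (α - 1) * p.2 / lampertiDenom α p.1 p.2 :=
    ((measurable_fst.pow_const _).mul measurable_snd).div (measurable_lampertiDenom α)
  exact (this.stronglyMeasurable.integral_prod_right' (ν := H)).measurable

theorem bOne_le (h0 : 0 < α) (h1 : α < 1) (hH : ∀ᵐ r ∂H, 0 < r) {x : ℝ} (hx : 0 < x) :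
    bOne α H x ≤ (2 * lampertiConst α)⁻¹ * x⁻¹ := by
  have := integral_mono_ae (integrable_kernel h0 h1 hx hH) (integrable_const _)
    (hH.mono fun r hr => kernel_le h0 h1 hx hr)
  simpa [bOne] using this

/-- Near x the density is bounded and log|x - y| is Lebesgue integrable; away from x the distance
lies between x/2 and (1 + x)(1 + y), so the logarithmic moment suffices. -/
theorem integrable_log_abs_sub_rhoMix (h0 : 0 < α) (h1 : α < 1) (hH : ∀ᵐ r ∂H, 0 < r)
    (hlog : Integrable (fun r => Real.log (1 + r)) H) {x : ℝ} (hx : 0 < x) :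
    Integrable (fun y => Real.log |x - y|) (densityMeasure (rhoMix α H)) := by
  have := isProbabilityMeasure_rhoMix h0 h1 hH
  have hν := ae_densityMeasure_pos (rhoMix α H)
  have hνlog := integrable_log_one_add_rhoMix h0 h1 hH hlog
  have hmeas : Measurable fun y => Real.log |x - y| := by
    simp_rw [Real.log_abs]
    exact Real.measurable_log.comp (by fun_prop)
  set I : Set ℝ := Ioc (x / 2) (3 * x / 2) with hI
  have hIm : MeasurableSet I := measurableSet_Ioc
  have hsplit : (fun y => Real.log |x - y|) =
      I.indicator (fun y => Real.log |x - y|) + Iᶜ.indicator fun y => Real.log |x - y| :=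
    (indicator_self_add_compl _ _).symm
  rw [hsplit]
  refine Integrable.add ?_ ?_
  · rw [integrable_densityMeasure_iff (measurable_rhoMix α H) (rhoMix_nonneg h0 h1 hH)]
    have hli : IntegrableOn (fun y => Real.log |x - y|) I := by
      have h2 : IntervalIntegrable (fun y => Real.log |y|) volume (x / 2) (-(x / 2)) := by
        simp_rw [Real.log_abs]
        exact intervalIntegral.intervalIntegrable_log'
      have h3 := h2.comp_sub_left x
      rw [show x - x / 2 = x / 2 by ring, show x - -(x / 2) = 3 * x / 2 by ring] at h3
      exact (intervalIntegrable_iff_integrableOn_Ioc_of_le (by linarith)).1 h3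
    have hli' := ((integrable_indicator_iff hIm).2 hli).abs.const_mul
      (Real.sin (Real.pi * α) / Real.pi * ((2 * lampertiConst α)⁻¹ * (x / 2)⁻¹))
    refine hli'.integrableOn.mono' ((measurable_rhoMix α H).mul
      (hmeas.indicator hIm)).aestronglyMeasurable ?_
    refine ae_restrict_of_forall_mem measurableSet_Ioi fun y hy => ?_
    by_cases hyI : y ∈ I
    · rw [norm_mul, Real.norm_of_nonneg (rhoMix_nonneg h0 h1 hH y hy), Real.norm_eq_abs]
      refine mul_le_mul_of_nonneg_right ?_ (abs_nonneg _)
      have hb := bOne_le h0 h1 hH hy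
      have hs := sin_pi_mul_pos h0 h1
      have hpi := Real.pi_pos
      have hc := lampertiConst_pos h0 h1
      have hy2 : y⁻¹ ≤ (x / 2)⁻¹ := inv_anti₀ (by linarith) hyI.1.le
      refine mul_le_mul_of_nonneg_left (hb.trans ?_) (by positivity)
      exact mul_le_mul_of_nonneg_left hy2 (by positivity)
    · simp [indicator_of_notMem hyI]
  · refine ((hνlog.add (integrable_const (Real.log (1 + x)))).add
      (integrable_const |Real.log (x / 2)|)).mono' (hmeas.indicator hIm.compl).aestronglyMeasurable ?_
    filter_upwards [hν] with y hy
    have hl1 : 0 ≤ Real.log (1 + y) := Real.log_nonneg (by linarith)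
    have hl2 : 0 ≤ Real.log (1 + x) := Real.log_nonneg (by linarith)
    by_cases hyI : y ∈ I
    · rw [indicator_of_notMem (by simpa using hyI), norm_zero]
      simp only [Pi.add_apply]
      positivity
    · rw [indicator_of_mem (by simpa using hyI), Real.norm_eq_abs]
      have hge : x / 2 ≤ |x - y| := by
        by_contra hlt
        push Not at hlt
        obtain ⟨h3, h4⟩ := abs_lt.1 hlt
        exact hyI ⟨by linarith, by linarith⟩
      have hle : |x - y| ≤ (1 + y) * (1 + x) := by
        rw [abs_le]
        constructor <;> nlinarith
      have h5 := Real.log_le_log (by positivity) hge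
      have h6 := Real.log_le_log (by linarith) hle
      rw [Real.log_mul (by linarith) (by linarith)] at h6
      simp only [Pi.add_apply]
      rw [abs_le]
      constructor
      · linarith [neg_abs_le (Real.log (x / 2))]
      · linarith [abs_nonneg (Real.log (x / 2))]
end

section
variable {α : ℝ} {H : Measure ℝ} [IsProbabilityMeasure H]

theorem stripPotential_mul_re (h0 : 0 < α) (h1 : α < 1) (hH : ∀ᵐ r ∂H, 0 < r)
    (hlog : Integrable (fun r => Real.log (1 + r)) H) (u : ℝ) :
    (stripPotential H (α * (u + Real.pi * Complex.I))).re =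
      1 / 2 * ∫ r, Real.log (lampertiDenom α (Real.exp u) r) ∂H := by
  have him : |(u + Real.pi * Complex.I : ℂ).im| ≤ Real.pi := by simp [abs_of_pos Real.pi_pos]
  rw [stripPotential_re hH hlog (abs_im_mul_lt h0 h1 him), ← integral_const_mul]
  refine integral_congr_ae (Eventually.of_forall fun r => ?_)
  simp only
  rw [← normSq_cexp_mul_add, Real.log_pow]
  push_cast
  ring

/-- The two bounds do not involve Im w, so they dominate the integrand uniformly as the cut is
approached. -/
theorem norm_cexp_add_sandwich {w : ℂ} {y : ℝ} (hy : 0 < y) :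
    |Real.exp w.re - y| ≤ ‖Complex.exp w + y‖ ∧ ‖Complex.exp w + y‖ ≤ Real.exp w.re + y := by
  constructor
  · have := abs_norm_sub_norm_le (Complex.exp w) (-(y : ℂ))
    rwa [Complex.norm_exp, norm_neg, Complex.norm_real, Real.norm_of_nonneg hy.le,
      sub_neg_eq_add] at this
  · have := norm_add_le (Complex.exp w) (y : ℂ)
    rwa [Complex.norm_exp, Complex.norm_real, Real.norm_of_nonneg hy.le] at this

/-- The real potential on (0, ∞) is the limit of the complex one as Im w ↑ π. For ϱ_{α,H} the limit
passes inside by domination; on the side of H it is mere continuity, since α w stays in the open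
strip. -/
theorem logPotential_rhoMix (h0 : 0 < α) (h1 : α < 1) (hH : ∀ᵐ r ∂H, 0 < r)
    (hlog : Integrable (fun r => Real.log (1 + r)) H) {x : ℝ} (hx : 0 < x) :
    logPotential (densityMeasure (rhoMix α H)) x =
      1 / (2 * α) * ∫ r, Real.log (lampertiDenom α x r) ∂H := by
  have := isProbabilityMeasure_rhoMix h0 h1 hH
  have hν := ae_densityMeasure_pos (rhoMix α H)
  have hνlog := integrable_log_one_add_rhoMix h0 h1 hH hlog
  have hpi := Real.pi_pos
  obtain ⟨a, rfl⟩ : ∃ a, x = Real.exp a := ⟨Real.log x, (Real.exp_log hx).symm⟩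
  have hne : ∀ᵐ y ∂densityMeasure (rhoMix α H), y ≠ Real.exp a := by
    have hac : densityMeasure (rhoMix α H) ≪ volume :=
      (withDensity_absolutelyContinuous _ _).trans Measure.restrict_le_self.absolutelyContinuous
    exact hac.ae_le (Measure.ae_ne volume _)
  have him : ∀ᶠ φ : ℝ in 𝓝[<] Real.pi, |(a + φ * Complex.I : ℂ).im| < Real.pi := by
    filter_upwards [Ioo_mem_nhdsLT hpi] with φ hφ
    simpa [abs_of_pos hφ.1] using hφ.2
  have hL : Tendsto (fun φ : ℝ => ∫ y, Real.log ‖Complex.exp (a + φ * Complex.I) + y‖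
      ∂densityMeasure (rhoMix α H)) (𝓝[<] Real.pi)
      (𝓝 (logPotential (densityMeasure (rhoMix α H)) (Real.exp a))) := by
    refine tendsto_integral_filter_of_dominated_convergence
      (fun y => |(Real.log |Real.exp a - y|)| + |Real.log (Real.exp a + y)|)
      (Eventually.of_forall fun φ => ?_) (Eventually.of_forall fun φ => ?_)
      ((integrable_log_abs_sub_rhoMix h0 h1 hH hlog hx).abs.add
        (integrable_log_add hν hνlog hx).abs) ?_
    · exact (Real.measurable_log.comp (by fun_prop)).aestronglyMeasurable
    · filter_upwards [hν, hne] with y hy hy'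
      obtain ⟨h2, h3⟩ := norm_cexp_add_sandwich (w := a + φ * Complex.I) hy
      have hre : (a + φ * Complex.I : ℂ).re = a := by simp
      rw [hre] at h2 h3
      have h4 : 0 < |Real.exp a - y| := abs_pos.2 (sub_ne_zero.2 hy'.symm)
      have h5 := Real.log_le_log h4 h2
      have h6 := Real.log_le_log (h4.trans_le h2) h3
      rw [Real.norm_eq_abs, abs_le]
      constructor
      · linarith [neg_abs_le (Real.log (|Real.exp a - y|)),
          abs_nonneg (Real.log (Real.exp a + y))]
      · linarith [abs_nonneg (Real.log (|Real.exp a - y|)),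
          le_abs_self (Real.log (Real.exp a + y))]
    · filter_upwards [hν, hne] with y hy hy'
      have h2 : ‖Complex.exp (a + Real.pi * Complex.I) + y‖ = |Real.exp a - y| := by
        rw [cexp_add_pi_mul_I, ← Complex.ofReal_neg, ← Complex.ofReal_add, Complex.norm_real,
          Real.norm_eq_abs, abs_sub_comm]
        congr 1
        ring
      have h3 : ContinuousAt (fun φ : ℝ => Real.log ‖Complex.exp (a + φ * Complex.I) + y‖)
          Real.pi := by
        refine ContinuousAt.log (by fun_prop) ?_
        rw [h2]
        exact (abs_pos.2 (sub_ne_zero.2 hy'.symm)).ne'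
      have h4 := h3.tendsto
      rw [h2] at h4
      exact h4.mono_left nhdsWithin_le_nhds
  have hR : Tendsto (fun φ : ℝ => (1 / α * stripPotential H (α * (a + φ * Complex.I)) : ℂ).re)
      (𝓝[<] Real.pi) (𝓝 (1 / α * stripPotential H (α * (a + Real.pi * Complex.I)) : ℂ).re) := by
    have h2 : |(a + Real.pi * Complex.I : ℂ).im| ≤ Real.pi := by simp [abs_of_pos hpi]
    have h3 := (hasDerivAt_stripPotential hH hlog (abs_im_mul_lt h0 h1 h2)).continuousAt
    have h4 : ContinuousAt (fun φ : ℝ => stripPotential H (α * (a + φ * Complex.I))) Real.pi :=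
      ContinuousAt.comp (f := fun φ : ℝ => (α * (a + φ * Complex.I) : ℂ)) h3 (by fun_prop)
    have h5 := Complex.continuous_re.continuousAt.comp (h4.const_mul (1 / α : ℂ))
    exact h5.tendsto.mono_left nhdsWithin_le_nhds
  have heq := tendsto_nhds_unique (hL.congr' (by
    filter_upwards [him] with φ hφ
    rw [← stripPotential_rhoMix h0 h1 hH hlog hφ, stripPotential_re hν hνlog hφ])) hR
  rw [heq, show (1 / α : ℂ) = ((1 / α : ℝ) : ℂ) by push_cast; rfl, Complex.re_ofReal_mul,
    stripPotential_mul_re h0 h1 hH hlog]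
  field_simp

theorem logS_eq_logPotential (h0 : 0 < α) (h1 : α < 1) (hH : ∀ᵐ r ∂H, 0 < r) (x : ℝ) :
    logS α H x = logPotential (densityMeasure (rhoMix α H)) x := by
  have hm := measurable_mul_rpow α
  have hmeas : Measurable fun y => Real.log |x - y| := by
    simp_rw [Real.log_abs]
    exact Real.measurable_log.comp (by fun_prop)
  rw [logPotential, densityMeasure_rhoMix_eq_map h0 h1 hH,
    integral_map hm.aemeasurable hmeas.aestronglyMeasurable, logS]

theorem logS_eq (h0 : 0 < α) (h1 : α < 1) (hH : ∀ᵐ r ∂H, 0 < r)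
    (hlog : Integrable (fun r => Real.log (1 + r)) H) {x : ℝ} (hx : 0 < x) :
    logS α H x = 1 / (2 * α) * ∫ r, Real.log (lampertiDenom α x r) ∂H := by
  rw [logS_eq_logPotential h0 h1 hH, logPotential_rhoMix h0 h1 hH hlog hx]

theorem crDelta_rhoMix (h0 : 0 < α) (h1 : α < 1) (hH : ∀ᵐ r ∂H, 0 < r) (θ x : ℝ) :
    crDelta (α * θ) (densityMeasure (rhoMix α H)) x =
      1 / Real.pi * Real.sin (Real.pi * θ * α * upsilon α H x) *
        Real.exp (-(θ * α) * logS α H x) := by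
  rw [crDelta, upsilon_eq_measureReal h0 h1 hH, ← logS_eq_logPotential h0 h1 hH]
  congr 3 <;> ring

end

/-- With t = cot(πα) + v/(r sin(πα)), v = e^(uα) and ψ = arccot t, the number v e^(iπα) + r is r
sin(πα) √(1 + t²) e^(i(πα - ψ)). So the argument of the logarithm on the edge is πα times the
distribution function of X_α r^(1/α). -/
theorem arg_cexp_mul_add {α r u : ℝ} (h0 : 0 < α) (h1 : α < 1) (hr : 0 < r) :
    Complex.arg (Complex.exp (α * (u + Real.pi * Complex.I)) + r) =
      Real.pi * α * cdfScaled α r (Real.exp u) := by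
  have hpi := Real.pi_pos
  have hs := sin_pi_mul_pos h0 h1
  set v := Real.exp u ^ α with hv
  set S := Real.sin (Real.pi * α) with hS
  set K := Real.cos (Real.pi * α) with hK
  have hSK : S ^ 2 + K ^ 2 = 1 := Real.sin_sq_add_cos_sq _
  set t := Real.cot (Real.pi * α) + v / r / S with ht
  have htS : t * S * r = K * r + v := by
    rw [ht, Real.cot_eq_cos_div_sin, ← hS, ← hK]
    field_simp
  have hψ := arccot_mem_Ioo t
  have hexp : Complex.exp (α * (u + Real.pi * Complex.I)) = (v : ℂ) * (K + S * Complex.I) := by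
    rw [show (α * (u + Real.pi * Complex.I) : ℂ) = (u * α : ℝ) +
      ((Real.pi * α : ℝ) * Complex.I) by push_cast; ring,
      Complex.exp_add, ← Complex.ofReal_exp, Real.exp_mul, Complex.exp_mul_I, hK, hS,
      Complex.ofReal_cos, Complex.ofReal_sin]
  have hψ0 : Real.pi * α * cdfScaled α r (Real.exp u) = Real.pi * α - arccot t := by
    rw [cdfScaled, ← hS, ← hv, ← ht]
    field_simp
  have hsq : 0 < √(1 + t ^ 2) := Real.sqrt_pos.2 (by positivity)
  have hsq2 : √(1 + t ^ 2) ^ 2 = 1 + t ^ 2 := Real.sq_sqrt (by positivity)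
  have hcosψ : Real.cos (arccot t) = t / √(1 + t ^ 2) := by
    rw [arccot, Real.cos_pi_div_two_sub, Real.sin_arctan]
  have hsinψ : Real.sin (arccot t) = 1 / √(1 + t ^ 2) := by
    rw [arccot, Real.sin_pi_div_two_sub, Real.cos_arctan]
  have key : Complex.exp (α * (u + Real.pi * Complex.I)) + r =
      ((r * S * √(1 + t ^ 2) : ℝ) : ℂ) * (Complex.cos ((Real.pi * α - arccot t : ℝ) : ℂ) +
        Complex.sin ((Real.pi * α - arccot t : ℝ) : ℂ) * Complex.I) := by
    rw [hexp, ← Complex.ofReal_cos, ← Complex.ofReal_sin, Real.cos_sub, Real.sin_sub, hcosψ, hsinψ]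
    apply Complex.ext
    · simp only [Complex.add_re, Complex.mul_re, Complex.ofReal_re, Complex.ofReal_im,
        Complex.I_re, Complex.I_im, Complex.add_im, Complex.mul_im]
      simp only [mul_zero, mul_one, zero_mul, sub_zero, add_zero, zero_add]
      field_simp
      linear_combination (-K) * htS - r * hSK
    · simp only [Complex.add_re, Complex.mul_re, Complex.ofReal_re, Complex.ofReal_im,
        Complex.I_re, Complex.I_im, Complex.add_im, Complex.mul_im]
      simp only [mul_zero, mul_one, zero_mul, sub_zero, add_zero, zero_add]
      field_simp
      linear_combination (-1) * htS
  rw [key, Complex.arg_mul_cos_add_sin_mul_I (by positivity) ⟨by nlinarith [hψ.2, mul_pos hpi h0],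
    by nlinarith [hψ.1]⟩, hψ0]

theorem stripPotential_mul_im {α : ℝ} {H : Measure ℝ} [IsProbabilityMeasure H] (h0 : 0 < α)
    (h1 : α < 1) (hH : ∀ᵐ r ∂H, 0 < r)
    (hlog : Integrable (fun r => Real.log (1 + r)) H) (u : ℝ) :
    (stripPotential H (α * (u + Real.pi * Complex.I))).im =
      Real.pi * α * upsilon α H (Real.exp u) := by
  have him : |(u + Real.pi * Complex.I : ℂ).im| ≤ Real.pi := by simp [abs_of_pos Real.pi_pos]
  rw [stripPotential_im hH hlog (abs_im_mul_lt h0 h1 him),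
    integral_cdfScaled_eq h0 h1 (Real.exp_pos u).le hH, ← integral_const_mul]
  refine integral_congr_ae ?_
  filter_upwards [hH] with r hr
  exact arg_cexp_mul_add h0 h1 hr

/-! ### The Stieltjes transform of the Cifarelli–Regazzini function -/

/-- Continuity from above at the null set (-∞, 0]. It quantifies how little H can contribute to a
singularity at z = 0. -/
theorem exists_measureReal_Iio_le {H : Measure ℝ} [IsFiniteMeasure H] (hH : ∀ᵐ r ∂H, 0 < r)
    {η : ℝ} (hη : 0 < η) : ∃ δ : ℝ, 0 < δ ∧ δ ≤ 1 ∧ H.real (Iio δ) ≤ η := by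
  have hI : ⋂ n : ℕ, Iio (1 / ((n : ℝ) + 1)) = Iic 0 := by
    ext x
    simp only [mem_iInter, mem_Iio, mem_Iic]
    constructor
    · intro h
      exact ge_of_tendsto' (tendsto_one_div_add_atTop_nhds_zero_nat (𝕜 := ℝ)) fun n => (h n).le
    · intro h n
      exact h.trans_lt (by positivity)
  have h0 : H (Iic 0) = 0 := by
    rw [measure_eq_zero_iff_ae_notMem]
    filter_upwards [hH] with r hr h
    exact absurd hr (not_lt.2 h)
  have ht := tendsto_measure_iInter_atTop (μ := H) (s := fun n : ℕ => Iio (1 / ((n : ℝ) + 1)))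
    (fun n => measurableSet_Iio.nullMeasurableSet)
    (fun m n hmn => Iio_subset_Iio (one_div_le_one_div_of_le (by positivity) (by gcongr)))
    ⟨0, measure_ne_top _ _⟩
  rw [hI, h0] at ht
  obtain ⟨n, hn⟩ := (ht.eventually_le_const (ENNReal.ofReal_pos.2 hη)).exists
  refine ⟨1 / ((n : ℝ) + 1), by positivity, ?_, ENNReal.toReal_le_of_le_ofReal hη.le hn⟩
  rw [div_le_one (by positivity)]
  linarith [n.cast_nonneg (α := ℝ)]

/-- The generalized Stieltjes transform `exp (-θ ∫ log (z ^ α + r) H(dr))` with `z = e ^ w`. -/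
noncomputable def stripTransform (α θ : ℝ) (H : Measure ℝ) (w : ℂ) : ℂ :=
  Complex.exp (-θ * stripPotential H (α * w))

theorem norm_stripTransform (α θ : ℝ) (H : Measure ℝ) (w : ℂ) :
    ‖stripTransform α θ H w‖ = Real.exp (-θ * (stripPotential H (α * w)).re) := by
  rw [stripTransform, Complex.norm_exp, ← Complex.ofReal_neg, Complex.re_ofReal_mul]

section
variable {α θ : ℝ} {H : Measure ℝ} [IsProbabilityMeasure H]

/-- Used for Re w ≥ 0: it makes the transform decay like |z|^(-αθ). -/
theorem re_stripPotential_ge (h0 : 0 < α) (h1 : α < 1) (hH : ∀ᵐ r ∂H, 0 < r)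
    (hlog : Integrable (fun r => Real.log (1 + r)) H) {w : ℂ} (hw : |w.im| ≤ Real.pi) :
    Real.log √(lampertiConst α) + α * w.re ≤ (stripPotential H (α * w)).re := by
  have hw' := abs_im_mul_lt h0 h1 hw
  have hc := Real.sqrt_pos.2 (lampertiConst_pos h0 h1)
  have hi := (integrable_clog_cexp_add hH hlog hw').re
  simp only [RCLike.re_to_complex, Complex.log_re] at hi
  rw [stripPotential_re hH hlog hw']
  have := integral_mono_ae (integrable_const (Real.log √(lampertiConst α) + α * w.re)) hi (by
    filter_upwards [hH] with r hr
    have h2 := norm_cexp_mul_add_ge h0 h1 hw hr.le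
    have h3 : √(lampertiConst α) * Real.exp (α * w.re) ≤ ‖Complex.exp (α * w) + r‖ :=
      (mul_le_mul_of_nonneg_left (le_max_left _ _) hc.le).trans h2
    have h4 := Real.log_le_log (by positivity) h3
    rwa [Real.log_mul hc.ne' (Real.exp_pos _).ne', Real.log_exp] at h4)
  simpa using this

/-- When log is not H-integrable at 0 the potential may tend to -∞ as Re w → -∞, but slowly: only
the mass of H below δ sees the factor α Re w, and δ is chosen so that this mass is at most ε/α. The
transform is thus O(|z|^(-εθ)) at 0 for every ε > 0. -/
theorem exists_re_stripPotential_ge (h0 : 0 < α) (h1 : α < 1) (hH : ∀ᵐ r ∂H, 0 < r)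
    (hlog : Integrable (fun r => Real.log (1 + r)) H) {ε : ℝ} (hε : 0 < ε) :
    ∃ C : ℝ, ∀ w : ℂ, |w.im| ≤ Real.pi → w.re ≤ 0 →
      ε * w.re - C ≤ (stripPotential H (α * w)).re := by
  obtain ⟨δ, hδ0, hδ1, hδ⟩ := exists_measureReal_Iio_le hH (div_pos hε h0)
  have hc := Real.sqrt_pos.2 (lampertiConst_pos h0 h1)
  refine ⟨-(Real.log √(lampertiConst α) + Real.log δ), fun w hw hre => ?_⟩
  have hw' := abs_im_mul_lt h0 h1 hw
  have hi := (integrable_clog_cexp_add hH hlog hw').re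
  simp only [RCLike.re_to_complex, Complex.log_re] at hi
  rw [stripPotential_re hH hlog hw']
  have hi2 : Integrable (fun r => (Iio δ).indicator (fun _ => α * w.re) r) H :=
    (integrable_const _).indicator measurableSet_Iio
  have hmono := integral_mono_ae
    (hi2.add (integrable_const (Real.log √(lampertiConst α) + Real.log δ))) hi (by
    filter_upwards [hH] with r hr
    have h2 := norm_cexp_mul_add_ge h0 h1 hw hr.le
    have hm : 0 < max (Real.exp (α * w.re)) r := lt_max_of_lt_right hr
    have h4 := Real.log_le_log (by positivity) h2
    rw [Real.log_mul hc.ne' hm.ne'] at h4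
    have hlδ : Real.log δ ≤ 0 := Real.log_nonpos hδ0.le hδ1
    have h5 : (Iio δ).indicator (fun _ => α * w.re) r + Real.log δ ≤
        Real.log (max (Real.exp (α * w.re)) r) := by
      by_cases hr2 : r ∈ Iio δ
      · rw [indicator_of_mem hr2]
        have := Real.log_le_log (Real.exp_pos _) (le_max_left (Real.exp (α * w.re)) r)
        rw [Real.log_exp] at this
        linarith
      · rw [indicator_of_notMem hr2, zero_add]
        exact Real.log_le_log hδ0 ((not_lt.1 hr2).trans (le_max_right _ _))
    simp only [Pi.add_apply]
    linarith)
  simp only [Pi.add_apply] at hmono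
  rw [integral_add hi2 (integrable_const _), integral_indicator measurableSet_Iio] at hmono
  simp only [integral_const, smul_eq_mul, measureReal_restrict_apply_univ, probReal_univ,
    one_mul] at hmono
  have h6 : ε * w.re ≤ H.real (Iio δ) * (α * w.re) := by
    have : H.real (Iio δ) * α ≤ ε := (le_div_iff₀ h0).1 hδ
    nlinarith
  linarith

/-- On the upper edge the real part of the potential of H is α 𝒮 and its imaginary part πα Υ, so Δ
is the boundary density of the transform. -/
theorem crDelta_exp_eq (h0 : 0 < α) (h1 : α < 1) (hH : ∀ᵐ r ∂H, 0 < r)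
    (hlog : Integrable (fun r => Real.log (1 + r)) H) (u : ℝ) :
    crDelta (α * θ) (densityMeasure (rhoMix α H)) (Real.exp u) =
      -(1 / Real.pi) * (stripTransform α θ H (u + Real.pi * Complex.I)).im := by
  rw [crDelta_rhoMix h0 h1 hH, stripTransform, ← Complex.ofReal_neg, Complex.exp_im,
    Complex.re_ofReal_mul, Complex.im_ofReal_mul, stripPotential_mul_re h0 h1 hH hlog,
    stripPotential_mul_im h0 h1 hH hlog, logS_eq h0 h1 hH hlog (Real.exp_pos u)]
  have e1 : -(θ * α) * (1 / (2 * α) * ∫ r, Real.log (lampertiDenom α (Real.exp u) r) ∂H) =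
      -θ * (1 / 2 * ∫ r, Real.log (lampertiDenom α (Real.exp u) r) ∂H) := by
    field_simp
  have e2 : -θ * (Real.pi * α * upsilon α H (Real.exp u)) =
      -(Real.pi * θ * α * upsilon α H (Real.exp u)) := by ring
  rw [e1, e2, Real.sin_neg]
  ring

theorem exists_abs_crDelta_le (h0 : 0 < α) (h1 : α < 1) (hθ : 0 < θ) (hH : ∀ᵐ r ∂H, 0 < r)
    (hlog : Integrable (fun r => Real.log (1 + r)) H) {ε : ℝ} (hε : 0 < ε) :
    ∃ C : ℝ, 0 ≤ C ∧ ∀ t ∈ Ioc (0 : ℝ) 1,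
      |crDelta (α * θ) (densityMeasure (rhoMix α H)) t| ≤ C * t ^ (-ε) := by
  obtain ⟨C, hC⟩ := exists_re_stripPotential_ge h0 h1 hH hlog (div_pos hε hθ)
  refine ⟨1 / Real.pi * Real.exp (θ * C), by positivity, fun t ht => ?_⟩
  obtain ⟨u, rfl⟩ : ∃ u, t = Real.exp u := ⟨Real.log t, (Real.exp_log ht.1).symm⟩
  rw [crDelta_exp_eq h0 h1 hH hlog, abs_mul, abs_neg, abs_of_pos (by positivity), mul_assoc]
  refine mul_le_mul_of_nonneg_left ((Complex.abs_im_le_norm _).trans ?_) (by positivity)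
  have := hC (u + Real.pi * Complex.I) (by simp [abs_of_pos Real.pi_pos])
    (by simpa using Real.exp_le_one_iff.1 ht.2)
  rw [norm_stripTransform, ← Real.exp_mul, ← Real.exp_add]
  refine Real.exp_le_exp.2 ?_
  simp only [Complex.add_re, Complex.ofReal_re, Complex.re_ofReal_mul, Complex.I_re, mul_zero,
    add_zero] at this
  have h2 := mul_le_mul_of_nonneg_left this hθ.le
  have h3 : θ * (ε / θ * u - C) = ε * u - θ * C := by field_simp
  linarith

/-- The Stieltjes transform of the Cifarelli–Regazzini function of `ϱ_{α,H}`. -/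
theorem stieltjes_crDelta (h0 : 0 < α) (h1 : α < 1) (hθ : 0 < θ) (hH : ∀ᵐ r ∂H, 0 < r)
    (hlog : Integrable (fun r => Real.log (1 + r)) H) {s : ℝ} (hs : 0 < s) :
    IntegrableOn (fun t => crDelta (α * θ) (densityMeasure (rhoMix α H)) t / (s + t)) (Ioi 0) ∧
      ∫ t in Ioi 0, crDelta (α * θ) (densityMeasure (rhoMix α H)) t / (s + t) =
        Real.exp (-(α * θ) * ∫ y, Real.log (s + y) ∂densityMeasure (rhoMix α H)) := by
  obtain ⟨C, hC⟩ := exists_re_stripPotential_ge h0 h1 hH hlog (div_pos (half_pos one_pos) hθ)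
  set B := max (Real.exp (-θ * Real.log √(lampertiConst α))) (Real.exp (θ * C)) with hB
  -- For Re w ≥ 0 the decay rate is αθ. For Re w ≤ 0 the bound was taken with ε = 1/(2θ), giving
  -- growth e^(-Re w / 2); capping δ at 1/2 makes this at most e^((δ-1) Re w).
  set δ := min (α * θ) (1 / 2) with hδ
  have hδ0 : 0 < δ := lt_min (mul_pos h0 hθ) (by norm_num)
  have hδ1 : δ ≤ α * θ := min_le_left _ _
  have hδ2 : δ ≤ 1 / 2 := min_le_right _ _
  have hz := stieltjes_of_strip (k := stripTransform α θ H) (C := B) (δ := δ)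
    (φ := crDelta (α * θ) (densityMeasure (rhoMix α H))) (by positivity) hδ0
    (fun w hw => by
      have := (hasDerivAt_stripPotential hH hlog (abs_im_mul_lt h0 h1 hw)).differentiableAt
      exact ((this.comp w (by fun_prop)).const_mul _).cexp)
    (fun w hw h => by
      rw [norm_stripTransform]
      have h2 := mul_le_mul_of_nonneg_left (re_stripPotential_ge h0 h1 hH hlog hw) hθ.le
      calc Real.exp (-θ * (stripPotential H (α * w)).re) ≤
            Real.exp (-θ * Real.log √(lampertiConst α) + -δ * w.re) :=
              Real.exp_le_exp.2 (by nlinarith)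
        _ ≤ _ := by
          rw [Real.exp_add]
          exact mul_le_mul_of_nonneg_right (le_max_left _ _) (Real.exp_pos _).le)
    (fun w hw h => by
      rw [norm_stripTransform]
      have h2 := mul_le_mul_of_nonneg_left (hC w hw h) hθ.le
      have h3 : θ * (1 / 2 / θ * w.re - C) = 1 / 2 * w.re - θ * C := by field_simp
      calc Real.exp (-θ * (stripPotential H (α * w)).re) ≤
            Real.exp (θ * C + (δ - 1) * w.re) := Real.exp_le_exp.2 (by nlinarith)
        _ ≤ _ := by
          rw [Real.exp_add]
          exact mul_le_mul_of_nonneg_right (le_max_right _ _) (Real.exp_pos _).le)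
    (fun u => by
      have e : (u - Real.pi * Complex.I : ℂ) = (starRingEnd ℂ) (u + Real.pi * Complex.I) := by
        simp [sub_eq_add_neg]
      have him : |(u + Real.pi * Complex.I : ℂ).im| ≤ Real.pi := by simp [abs_of_pos Real.pi_pos]
      rw [stripTransform, stripTransform, ← Complex.exp_conj, e, map_mul, map_neg,
        Complex.conj_ofReal, ← stripPotential_conj hH (abs_im_mul_lt h0 h1 him), map_mul,
        Complex.conj_ofReal])
    (fun u => crDelta_exp_eq h0 h1 hH hlog u) hs
  refine ⟨hz.1, ?_⟩
  rw [hz.2, stripTransform, ← Complex.ofReal_mul, stripPotential_ofReal hH,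
    integral_log_add_rhoMix h0 h1 hH hlog hs, ← Complex.ofReal_neg, ← Complex.ofReal_mul,
    ← Complex.ofReal_exp, Complex.ofReal_re, mul_comm α (Real.log s), Real.exp_mul (Real.log s),
    Real.exp_log hs]
  congr 1
  field_simp
end

/-! ### Inversion of the generalized Stieltjes transform by an Abel integral -/

/-- The quotient (x - t)/(s + x) has derivative (s + t)/(s + x)², so its p-th power over p (s + t)
is a primitive. This identity links transforms of order p + 1 to the ordinary Stieltjes kernel. -/
theorem lintegral_abel_kernel {p s t : ℝ} (hp : 0 < p) (hst : 0 < s + t) :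
    ∫⁻ x in Ioi t, ENNReal.ofReal ((s + x) ^ (-(p + 1)) * (x - t) ^ (p - 1)) =
      ENNReal.ofReal (1 / (p * (s + t))) := by
  have hmul : 0 < p * (s + t) := by positivity
  have hpos : ∀ x ∈ Ici t, 0 < s + x := fun x hx => by
    have : t ≤ x := hx
    linarith
  rw [lintegral_Ioi_ofReal_deriv (g := fun x => ((x - t) / (s + x)) ^ p / (p * (s + t)))
    (l := 1 / (p * (s + t)))]
  · simp [Real.zero_rpow hp.ne']
  · have h1 : ContinuousAt (fun x : ℝ => (x - t) / (s + x)) t :=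
      ContinuousAt.div (by fun_prop) (by fun_prop) hst.ne'
    exact ((h1.rpow_const (Or.inr hp.le)).div_const _).continuousWithinAt
  · intro x hx
    have hxt : 0 < x - t := sub_pos.2 hx
    have hsx := hpos x (Ioi_subset_Ici_self hx)
    have e1 := ((hasDerivAt_id' x).sub_const t).div ((hasDerivAt_id' x).const_add s) hsx.ne'
    have e2 := (e1.rpow_const (p := p) (Or.inl (div_pos hxt hsx).ne')).div_const (p * (s + t))
    refine e2.congr_deriv ?_
    simp only [Pi.div_apply]
    have e3 : 1 * (s + x) - (x - t) * 1 = s + t := by ring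
    rw [e3, Real.div_rpow hxt.le hsx.le, Real.rpow_neg hsx.le, Real.rpow_sub_one hsx.ne',
      Real.rpow_add_one hsx.ne']
    have := (Real.rpow_pos_of_pos hsx p).ne'
    field_simp
  · intro x hx
    exact mul_nonneg (Real.rpow_nonneg (hpos x (Ioi_subset_Ici_self hx)).le _)
      (Real.rpow_nonneg (sub_nonneg.2 (le_of_lt hx)) _)
  · have h1 : Tendsto (fun x : ℝ => 1 - (s + t) / (s + x)) atTop (𝓝 (1 - 0)) :=
      (tendsto_const_nhds.div_atTop (tendsto_atTop_add_const_left _ _ tendsto_id)).const_sub 1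
    have h2 := (h1.rpow_const (p := p) (Or.inl (by norm_num))).div_const (p * (s + t))
    rw [sub_zero, Real.one_rpow] at h2
    refine h2.congr' ?_
    filter_upwards [eventually_ge_atTop t] with x hx
    have := (hpos x hx).ne'
    congr 2
    field_simp
    ring

/-- The Abel integral of order `p` of a nonnegative function. -/
noncomputable def abelIntegral (p : ℝ) (a : ℝ → ENNReal) (x : ℝ) : ENNReal :=
  ∫⁻ t in Ioc 0 x, ENNReal.ofReal ((x - t) ^ (p - 1)) * a t

theorem measurableSet_triangle : MeasurableSet {q : ℝ × ℝ | q.2 ∈ Ioc 0 q.1} :=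
  (measurableSet_lt measurable_const measurable_snd).inter
    (measurableSet_le measurable_snd measurable_fst)

theorem measurable_abel_kernel (p : ℝ) {a : ℝ → ENNReal} (ha : Measurable a) :
    Measurable fun q : ℝ × ℝ => ({q : ℝ × ℝ | q.2 ∈ Ioc 0 q.1}).indicator
      (fun q => ENNReal.ofReal ((q.1 - q.2) ^ (p - 1)) * a q.2) q := by
  refine Measurable.indicator ?_ measurableSet_triangle
  exact (Measurable.ennreal_ofReal ((measurable_fst.sub measurable_snd).pow_const _)).mul
    (ha.comp measurable_snd)

theorem abelIntegral_eq (p : ℝ) (a : ℝ → ENNReal) (x : ℝ) :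
    abelIntegral p a x = ∫⁻ t, ({q : ℝ × ℝ | q.2 ∈ Ioc 0 q.1}).indicator
      (fun q => ENNReal.ofReal ((q.1 - q.2) ^ (p - 1)) * a q.2) (x, t) := by
  rw [abelIntegral, ← lintegral_indicator measurableSet_Ioc]
  rfl

theorem measurable_abelIntegral (p : ℝ) {a : ℝ → ENNReal} (ha : Measurable a) :
    Measurable (abelIntegral p a) := by
  simp_rw [funext (abelIntegral_eq p a)]
  exact (measurable_abel_kernel p ha).lintegral_prod_right'

/-- Tonelli on the triangle 0 < t ≤ x followed by the kernel identity. -/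
theorem lintegral_abelIntegral {p s : ℝ} (hp : 0 < p) (hs : 0 < s) {a : ℝ → ENNReal}
    (ha : Measurable a) :
    ∫⁻ x in Ioi 0, ENNReal.ofReal ((s + x) ^ (-(p + 1))) * abelIntegral p a x =
      ∫⁻ t in Ioi 0, ENNReal.ofReal (1 / (p * (s + t))) * a t := by
  have hm := measurable_abel_kernel p ha
  have hw : Measurable fun x : ℝ => ENNReal.ofReal ((s + x) ^ (-(p + 1))) :=
    (measurable_add_rpow s _).ennreal_ofReal
  simp_rw [abelIntegral_eq]
  have hc : ∀ x : ℝ, ENNReal.ofReal ((s + x) ^ (-(p + 1))) *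
      ∫⁻ t, ({q : ℝ × ℝ | q.2 ∈ Ioc 0 q.1}).indicator
        (fun q => ENNReal.ofReal ((q.1 - q.2) ^ (p - 1)) * a q.2) (x, t) =
      ∫⁻ t, ENNReal.ofReal ((s + x) ^ (-(p + 1))) * ({q : ℝ × ℝ | q.2 ∈ Ioc 0 q.1}).indicator
        (fun q => ENNReal.ofReal ((q.1 - q.2) ^ (p - 1)) * a q.2) (x, t) := fun x =>
    (lintegral_const_mul _ (hm.comp measurable_prodMk_left)).symm
  simp_rw [hc]
  rw [lintegral_lintegral_swap ((hw.comp measurable_fst).mul hm).aemeasurable,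
    ← lintegral_indicator measurableSet_Ioi]
  refine lintegral_congr fun t => ?_
  by_cases ht : t ∈ Ioi (0 : ℝ)
  · have ht0 : 0 < t := ht
    have hk : Measurable fun x : ℝ =>
        ENNReal.ofReal ((s + x) ^ (-(p + 1)) * (x - t) ^ (p - 1)) :=
      ((measurable_add_rpow s _).mul ((measurable_id.sub_const t).pow_const _)).ennreal_ofReal
    rw [indicator_of_mem ht, ← lintegral_abel_kernel hp (by linarith : 0 < s + t),
      ← lintegral_mul_const _ hk,
      ← lintegral_indicator measurableSet_Ioi, ← lintegral_indicator measurableSet_Ioi]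
    refine lintegral_congr_ae ?_
    -- The triangle contains the diagonal x = t while the kernel identity runs over x > t; the
    -- difference is a null set.
    filter_upwards [Measure.ae_ne volume t] with x hx
    by_cases hxt : t < x
    · rw [indicator_of_mem (show x ∈ Ioi (0 : ℝ) from ht0.trans hxt),
        indicator_of_mem (show x ∈ Ioi t from hxt),
        indicator_of_mem (show (x, t) ∈ {q : ℝ × ℝ | q.2 ∈ Ioc 0 q.1} from ⟨ht0, hxt.le⟩),
        ENNReal.ofReal_mul (Real.rpow_nonneg (by linarith) _), mul_assoc]
    · rw [indicator_of_notMem (show x ∉ Ioi t from hxt)]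
      have : (x, t) ∉ {q : ℝ × ℝ | q.2 ∈ Ioc 0 q.1} := fun h =>
        hxt (lt_of_le_of_ne h.2 (Ne.symm hx))
      by_cases hx0 : x ∈ Ioi (0 : ℝ)
      · rw [indicator_of_mem hx0, indicator_of_notMem this, mul_zero]
      · rw [indicator_of_notMem hx0]
  · rw [indicator_of_notMem ht, lintegral_eq_zero_iff (by
      exact hw.mul (hm.comp measurable_prodMk_right))]
    refine Eventually.of_forall fun x => ?_
    have : (x, t) ∉ {q : ℝ × ℝ | q.2 ∈ Ioc 0 q.1} := fun h => ht h.1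
    simp only [indicator_of_notMem this, mul_zero, Pi.zero_apply]

/-- Integration by parts in the form of Tonelli: for fixed m the integral of (s + x)^(-(p+1)) over x
> m is (s + m)^(-p)/p. -/
theorem lintegral_rpow_mul_cdf {p s : ℝ} (hp : 0 < p) (hs : 0 < s) {D : Measure ℝ}
    [IsFiniteMeasure D] (hD : ∀ᵐ x ∂D, 0 < x) :
    ∫⁻ x in Ioi 0, ENNReal.ofReal ((s + x) ^ (-(p + 1))) * D (Iic x) =
      ENNReal.ofReal (1 / p) * ∫⁻ m, ENNReal.ofReal ((s + m) ^ (-p)) ∂D := by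
  have hw : Measurable fun x : ℝ => ENNReal.ofReal ((s + x) ^ (-(p + 1))) :=
    (measurable_add_rpow s _).ennreal_ofReal
  have hset : MeasurableSet {q : ℝ × ℝ | q.2 ≤ q.1} :=
    measurableSet_le measurable_snd measurable_fst
  have h1 : ∀ x : ℝ, ENNReal.ofReal ((s + x) ^ (-(p + 1))) * D (Iic x) =
      ∫⁻ m, ({q : ℝ × ℝ | q.2 ≤ q.1}).indicator
        (fun q => ENNReal.ofReal ((s + q.1) ^ (-(p + 1)))) (x, m) ∂D := by
    intro x
    rw [← setLIntegral_const, ← lintegral_indicator measurableSet_Iic]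
    rfl
  have hm : Measurable fun q : ℝ × ℝ => ({q : ℝ × ℝ | q.2 ≤ q.1}).indicator
      (fun q => ENNReal.ofReal ((s + q.1) ^ (-(p + 1)))) q :=
    (hw.comp measurable_fst).indicator hset
  simp_rw [h1]
  rw [lintegral_lintegral_swap hm.aemeasurable, ← lintegral_const_mul _
    (measurable_add_rpow s _).ennreal_ofReal]
  refine lintegral_congr_ae ?_
  filter_upwards [hD] with m hm0
  have h2 : ∫⁻ x in Ioi m, ENNReal.ofReal ((s + x) ^ (-(p + 1))) =
      ENNReal.ofReal (0 - -(1 / p) * (s + m) ^ (-p)) := by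
    rw [lintegral_Ioi_ofReal_deriv (g := fun x => -(1 / p) * (s + x) ^ (-p)) (l := 0)]
    · exact (ContinuousAt.mul continuousAt_const (ContinuousAt.rpow_const (by fun_prop)
        (Or.inl (by linarith)))).continuousWithinAt
    · intro x hx
      have hx' : m < x := hx
      have h3 : HasDerivAt (fun x => -(1 / p) * (s + x) ^ (-p))
          (-(1 / p) * (1 * -p * (s + x) ^ (-p - 1))) x :=
        (((hasDerivAt_id' x).const_add s).rpow_const (Or.inl (by linarith))).const_mul _
      refine h3.congr_deriv ?_
      rw [neg_add']
      field_simp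
    · intro x hx
      have hx' : m < x := hx
      exact Real.rpow_nonneg (by linarith) _
    · have h3 := ((tendsto_rpow_neg_atTop hp).comp
        (tendsto_atTop_add_const_left atTop s tendsto_id)).const_mul (-(1 / p))
      rw [mul_zero] at h3
      exact h3
  rw [← ENNReal.ofReal_mul (by positivity), show 1 / p * (s + m) ^ (-p) =
    0 - -(1 / p) * (s + m) ^ (-p) by ring, ← h2, ← lintegral_indicator measurableSet_Ioi,
    ← lintegral_indicator measurableSet_Ioi]
  refine lintegral_congr_ae ?_
  filter_upwards [Measure.ae_ne volume m] with x hx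
  by_cases hxm : m < x
  · rw [indicator_of_mem (show x ∈ Ioi (0 : ℝ) from hm0.trans hxm),
      indicator_of_mem (show x ∈ Ioi m from hxm),
      indicator_of_mem (show (x, m) ∈ {q : ℝ × ℝ | q.2 ≤ q.1} from hxm.le)]
  · rw [indicator_of_notMem (show x ∉ Ioi m from hxm)]
    have : (x, m) ∉ {q : ℝ × ℝ | q.2 ≤ q.1} := fun h =>
      hxm (lt_of_le_of_ne h (Ne.symm hx))
    by_cases hx0 : x ∈ Ioi (0 : ℝ)
    · rw [indicator_of_mem hx0, indicator_of_notMem this]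
    · rw [indicator_of_notMem hx0]

/-- If the Stieltjes transform of `Δ` is the transform of order `p` of `D`, then the
distribution function of `D` is the Abel integral of `Δ`, almost everywhere. -/
theorem ae_cdf_add_abelIntegral {p : ℝ} (hp : 0 < p) {D : Measure ℝ} [IsFiniteMeasure D]
    (hD : ∀ᵐ x ∂D, 0 < x) {Δ : ℝ → ℝ} (hΔ : Measurable Δ)
    (hst : ∀ s, 0 < s → IntegrableOn (fun t => Δ t / (s + t)) (Ioi 0) ∧
      ∫ t in Ioi 0, Δ t / (s + t) = ∫ x, (s + x) ^ (-p) ∂D) :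
    ∀ᵐ x ∂volume.restrict (Ioi 0), D (Iic x) +
      abelIntegral p (fun t => ENNReal.ofReal (-Δ t)) x =
      abelIntegral p (fun t => ENNReal.ofReal (Δ t)) x := by
  have hΔn : Measurable fun t => -Δ t := hΔ.neg
  have hmp : Measurable (abelIntegral p fun t => ENNReal.ofReal (Δ t)) :=
    measurable_abelIntegral p hΔ.ennreal_ofReal
  have hmn : Measurable (abelIntegral p fun t => ENNReal.ofReal (-Δ t)) :=
    measurable_abelIntegral p hΔn.ennreal_ofReal
  have hmD : Measurable fun x => D (Iic x) :=
    Monotone.measurable fun x y h => measure_mono (Iic_subset_Iic.2 h)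
  have hsum : Measurable fun x => D (Iic x) +
      abelIntegral p (fun t => ENNReal.ofReal (-Δ t)) x := hmD.add hmn
  have hD0 : ∀ᵐ x ∂D, 0 ≤ x := hD.mono fun x hx => hx.le
  have hw : ∀ s : ℝ, Measurable fun x : ℝ => ENNReal.ofReal ((s + x) ^ (-(p + 1))) := fun s =>
    (measurable_add_rpow s _).ennreal_ofReal
  have fin : ∀ s, 0 < s → ∀ f : ℝ → ℝ, (∀ t, |f t| ≤ |Δ t|) → ∀ (_ : Measurable f),
      ∫⁻ t in Ioi 0, ENNReal.ofReal (1 / (p * (s + t))) * ENNReal.ofReal (f t) ≠ ⊤ := by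
    intro s hs f hf hfm
    have hi : IntegrableOn (fun t => (1 / p) * (f t / (s + t))) (Ioi 0) := by
      refine Integrable.const_mul ((hst s hs).1.abs.mono'
        (by exact (hfm.div (by fun_prop)).aestronglyMeasurable) ?_) _
      filter_upwards with t
      rw [Real.norm_eq_abs, abs_div, abs_div]
      exact div_le_div_of_nonneg_right (hf t) (abs_nonneg _)
    refine ne_top_of_le_ne_top hi.2.ne ?_
    refine setLIntegral_mono_ae' measurableSet_Ioi (Eventually.of_forall fun t ht => ?_)
    have ht0 : (0 : ℝ) < t := ht
    rw [← ENNReal.ofReal_mul (by positivity), ← ofReal_norm]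
    refine ENNReal.ofReal_le_ofReal ((le_abs_self _).trans_eq ?_)
    rw [Real.norm_eq_abs]
    congr 1
    field_simp
  have hpt : ∀ s, 0 < s → ∀ f : ℝ → ℝ, ∀ t ∈ Ioi (0 : ℝ),
      ENNReal.ofReal (1 / (p * (s + t))) * ENNReal.ofReal (f t) =
        ENNReal.ofReal (1 / p) * ENNReal.ofReal (f t / (s + t)) := by
    intro s hs f t ht
    have ht0 : (0 : ℝ) < t := ht
    rw [← ENNReal.ofReal_mul (by positivity), ← ENNReal.ofReal_mul (by positivity)]
    congr 1
    field_simp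
  -- Δ may change sign, so its negative part is moved to the side of D; every integral is then one
  -- of a nonnegative function.
  have key : ∀ s, 0 < s →
      ENNReal.ofReal (1 / p) * ∫⁻ m, ENNReal.ofReal ((s + m) ^ (-p)) ∂D +
        ∫⁻ t in Ioi 0, ENNReal.ofReal (1 / (p * (s + t))) * ENNReal.ofReal (-Δ t) =
      ∫⁻ t in Ioi 0, ENNReal.ofReal (1 / (p * (s + t))) * ENNReal.ofReal (Δ t) := by
    intro s hs
    obtain ⟨hi, he⟩ := hst s hs
    have hDi := integrable_rpow_neg_add hD0 hp.le (integrable_one_add_rpow hD hp.le) hs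
    have hDn : 0 ≤ᵐ[D] fun x => (s + x) ^ (-p) := by
      filter_upwards [hD] with x hx
      exact Real.rpow_nonneg (by linarith) _
    have hmeas : ∀ f : ℝ → ℝ, Measurable f →
        Measurable fun t => ENNReal.ofReal (f t / (s + t)) := fun f hf =>
      (hf.div (by fun_prop)).ennreal_ofReal
    rw [setLIntegral_congr_fun measurableSet_Ioi (hpt s hs _),
      setLIntegral_congr_fun measurableSet_Ioi (hpt s hs _),
      lintegral_const_mul _ (hmeas _ hΔ), lintegral_const_mul _ (hmeas _ hΔn), ← mul_add]
    congr 1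
    rw [← ofReal_integral_eq_lintegral_ofReal hDi hDn, ← he,
      integral_eq_lintegral_pos_part_sub_lintegral_neg_part hi]
    have f1 : ∫⁻ t in Ioi 0, ENNReal.ofReal (Δ t / (s + t)) ≠ ⊤ :=
      ne_top_of_le_ne_top hi.2.ne (lintegral_mono fun t => Real.ofReal_le_enorm _)
    have f2 : ∫⁻ t in Ioi 0, ENNReal.ofReal (-Δ t / (s + t)) ≠ ⊤ :=
      ne_top_of_le_ne_top hi.2.ne (lintegral_mono fun t => by
        rw [← enorm_neg, ← neg_div]
        exact Real.ofReal_le_enorm _)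
    simp_rw [← neg_div]
    -- Subtraction in `ENNReal` is truncated; it can be undone because the Stieltjes integral of Δ
    -- is nonnegative, being a transform of D.
    have hge : (∫⁻ t in Ioi 0, ENNReal.ofReal (-Δ t / (s + t))).toReal ≤
        (∫⁻ t in Ioi 0, ENNReal.ofReal (Δ t / (s + t))).toReal := by
      have h3 : 0 ≤ ∫ t in Ioi 0, Δ t / (s + t) := he ▸ integral_nonneg_of_ae hDn
      rw [integral_eq_lintegral_pos_part_sub_lintegral_neg_part hi] at h3
      simp_rw [← neg_div] at h3
      linarith
    rw [ENNReal.ofReal_sub _ ENNReal.toReal_nonneg, ENNReal.ofReal_toReal f1,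
      ENNReal.ofReal_toReal f2, tsub_add_cancel_of_le ((ENNReal.toReal_le_toReal f2 f1).1 hge)]
  -- Both sides of the claim are densities of measures on (0, ∞) with the same transform of order p
  -- + 1; equality of the measures gives equality of densities almost everywhere.
  have e : (volume.restrict (Ioi 0)).withDensity (fun x => D (Iic x) +
        abelIntegral p (fun t => ENNReal.ofReal (-Δ t)) x) =
      (volume.restrict (Ioi 0)).withDensity (abelIntegral p fun t => ENNReal.ofReal (Δ t)) := by
    have tr : ∀ (f : ℝ → ENNReal), Measurable f → ∀ s : ℝ,
        ∫⁻ x, ENNReal.ofReal ((s + x) ^ (-(p + 1))) ∂(volume.restrict (Ioi 0)).withDensity f =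
        ∫⁻ x in Ioi 0, ENNReal.ofReal ((s + x) ^ (-(p + 1))) * f x := fun f hf s => by
      rw [lintegral_withDensity_eq_lintegral_mul _ hf (hw s)]
      simp_rw [Pi.mul_apply, mul_comm]
    have hpos : ∀ f : ℝ → ENNReal, ∀ᵐ x ∂(volume.restrict (Ioi (0 : ℝ))).withDensity f, 0 ≤ x :=
      fun f => (withDensity_absolutelyContinuous _ _).ae_le
        ((ae_restrict_mem measurableSet_Ioi).mono fun x hx => le_of_lt hx)
    have hL : ∀ s, 0 < s → ∫⁻ x in Ioi 0, ENNReal.ofReal ((s + x) ^ (-(p + 1))) *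
        (D (Iic x) + abelIntegral p (fun t => ENNReal.ofReal (-Δ t)) x) =
        ∫⁻ x in Ioi 0, ENNReal.ofReal ((s + x) ^ (-(p + 1))) *
          abelIntegral p (fun t => ENNReal.ofReal (Δ t)) x := by
      intro s hs
      simp_rw [mul_add]
      have hl : Measurable fun x => ENNReal.ofReal ((s + x) ^ (-(p + 1))) * D (Iic x) :=
        (hw s).mul hmD
      rw [lintegral_add_left hl, lintegral_rpow_mul_cdf hp hs hD,
        lintegral_abelIntegral hp hs hΔn.ennreal_ofReal,
        lintegral_abelIntegral hp hs hΔ.ennreal_ofReal, key s hs]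
    refine Measure.ext_of_lintegral_rpow_neg_add (by linarith : 0 < p + 1) (hpos _) (hpos _) ?_ ?_
    · rw [tr _ hsum, hL 1 one_pos, lintegral_abelIntegral hp one_pos hΔ.ennreal_ofReal]
      exact fin 1 one_pos Δ (fun t => le_rfl) hΔ
    · intro s hs
      rw [tr _ hsum, tr _ hmp, hL s hs]
  exact (withDensity_eq_iff_of_sigmaFinite hsum.aemeasurable hmp.aemeasurable).1 e

/-! ### Regularity of Abel integrals -/

theorem intervalIntegrable_sub_rpow {p : ℝ} (hp : 0 < p) (x a b : ℝ) :
    IntervalIntegrable (fun t => (x - t) ^ (p - 1)) volume a b := by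
  have h := (intervalIntegral.intervalIntegrable_rpow' (a := x - a) (b := x - b)
    (by linarith : -1 < p - 1)).comp_sub_left x
  simpa using h

theorem integral_sub_rpow {p δ x : ℝ} (hp : 0 < p) :
    ∫ t in δ..x, (x - t) ^ (p - 1) = (x - δ) ^ p / p := by
  rw [intervalIntegral.integral_comp_sub_left (fun t => t ^ (p - 1)) x,
    integral_rpow (Or.inl (by linarith)), sub_self, sub_add_cancel, Real.zero_rpow hp.ne', sub_zero]

theorem intervalIntegrable_abel {p a x : ℝ} (hp : 0 < p) {g : ℝ → ℝ}
    (hg : ContinuousOn g (Ioi 0)) (ha : 0 < a) (hax : a ≤ x) :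
    IntervalIntegrable (fun t => (x - t) ^ (p - 1) * g t) volume a x :=
  (intervalIntegrable_sub_rpow hp x a x).mul_continuousOn (hg.mono (by
    rw [uIcc_of_le hax]
    exact fun t ht => ha.trans_le ht.1))

/-- Cut at x/2: to the left the kernel is continuous and g integrable, to the right g is continuous
and the kernel integrable. -/
theorem intervalIntegrable_abel_zero {p x : ℝ} (hp : 0 < p) {g : ℝ → ℝ}
    (hg : ContinuousOn g (Ioi 0)) (hi : ∀ y, 0 < y → IntervalIntegrable g volume 0 y)
    (hx : 0 ≤ x) : IntervalIntegrable (fun t => (x - t) ^ (p - 1) * g t) volume 0 x := by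
  rcases hx.eq_or_lt with rfl | hx
  · exact IntervalIntegrable.refl
  refine IntervalIntegrable.trans (b := x / 2) ?_
    (intervalIntegrable_abel hp hg (by positivity) (by linarith))
  refine (hi (x / 2) (by positivity)).continuousOn_mul ?_
  rw [uIcc_of_le (by positivity)]
  refine ContinuousOn.rpow_const (by fun_prop) fun t ht => Or.inl ?_
  linarith [ht.2]

/-- For y near x > δ and t ≤ δ the distance y - t stays in [(x - δ)/2, 2x], away from the
singularity of the kernel, so the kernel can be differentiated and Δ need only be integrable. -/
theorem hasDerivAt_integral_sub_rpow {p δ x : ℝ} {Δ : ℝ → ℝ} (hδ : 0 < δ) (hx : δ < x)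
    (hi : IntervalIntegrable Δ volume 0 δ) :
    HasDerivAt (fun y => ∫ t in (0 : ℝ)..δ, (y - t) ^ (p - 1) * Δ t)
      ((p - 1) * ∫ t in (0 : ℝ)..δ, (x - t) ^ (p - 2) * Δ t) x := by
  have hη : 0 < (x - δ) / 2 := by linarith
  obtain ⟨C, hC⟩ := (isCompact_Icc (a := (x - δ) / 2) (b := 2 * x)).exists_bound_of_continuousOn
    (f := fun v : ℝ => (p - 1) * v ^ (p - 2))
    (continuousOn_const.mul (ContinuousOn.rpow_const continuousOn_id fun v hv =>
      Or.inl (hη.trans_le hv.1).ne'))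
  have hball : ∀ y ∈ Metric.ball x ((x - δ) / 2), ∀ t ∈ uIoc 0 δ, y - t ∈ Icc ((x - δ) / 2) (2 * x) := by
    intro y hy t ht
    rw [uIoc_of_le hδ.le] at ht
    rw [Metric.mem_ball, Real.dist_eq, abs_lt] at hy
    constructor <;> linarith [ht.1, ht.2, hy.1, hy.2]
  have hm : ∀ y q : ℝ, AEStronglyMeasurable (fun t => (y - t) ^ q * Δ t)
      (volume.restrict (uIoc 0 δ)) := fun y q =>
    (((measurable_const.sub measurable_id).pow_const _).aestronglyMeasurable).mul
      (intervalIntegrable_iff.1 hi).aestronglyMeasurable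
  have h := intervalIntegral.hasDerivAt_integral_of_dominated_loc_of_deriv_le (μ := volume)
    (F := fun y t => (y - t) ^ (p - 1) * Δ t) (F' := fun y t => (p - 1) * (y - t) ^ (p - 2) * Δ t)
    (x₀ := x) (s := Metric.ball x ((x - δ) / 2)) (bound := fun t => C * |Δ t|) (a := 0) (b := δ)
    (Metric.ball_mem_nhds x hη) (Eventually.of_forall fun y => hm y _) ?_ ?_ ?_
    (hi.abs.const_mul C) ?_
  · refine h.2.congr_deriv ?_
    rw [← intervalIntegral.integral_const_mul]
    simp_rw [mul_assoc]
  · refine hi.continuousOn_mul ?_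
    rw [uIcc_of_le hδ.le]
    exact ContinuousOn.rpow_const (by fun_prop) fun t ht => Or.inl (by linarith [ht.2])
  · simpa only [mul_assoc] using (hm x (p - 2)).const_mul (p - 1)
  · refine Eventually.of_forall fun t ht y hy => ?_
    rw [norm_mul]
    exact mul_le_mul_of_nonneg_right (hC _ (hball y hy t ht)) (norm_nonneg _)
  · refine Eventually.of_forall fun t ht y hy => ?_
    have h2 := (hball y hy t ht).1
    have h3 := (((hasDerivAt_id' y).sub_const t).rpow_const (p := p - 1)
      (Or.inl (hη.trans_le h2).ne')).mul_const (Δ t)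
    refine h3.congr_deriv ?_
    rw [one_mul, sub_sub, show (1 : ℝ) + 1 = 2 by norm_num]

/-- The kernel may be singular at t = y, so the substitution u = y - t moves the dependence on y
into the function. There Lipschitz domination by K u^(p-1) works for every p > 0. -/
theorem hasDerivAt_abel_right {p δ x : ℝ} (hp : 0 < p) {Δ d : ℝ → ℝ}
    (hΔ : ∀ t, 0 < t → HasDerivAt Δ (d t) t) (hd : ContinuousOn d (Ioi 0)) (hδ : 0 < δ)
    (hx : δ < x) :
    HasDerivAt (fun y => ∫ t in δ..y, (y - t) ^ (p - 1) * (Δ t - Δ δ))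
      (∫ t in δ..x, (x - t) ^ (p - 1) * d t) x := by
  have hL0 : 0 ≤ x + 1 := by linarith
  obtain ⟨K, hK⟩ := (isCompact_Icc (a := δ) (b := x + 1)).exists_bound_of_continuousOn
    (hd.mono fun t ht => hδ.trans_le ht.1)
  have hK0 : 0 ≤ K := (norm_nonneg _).trans (hK δ ⟨le_rfl, by linarith⟩)
  -- Subtracting Δ(δ) allows a continuous extension by zero to the left of δ. The result is
  -- Lipschitz up to x + 1 and differentiable except possibly at the kink δ.
  set D : ℝ → ℝ := fun t => Δ (max t δ) - Δ δ with hD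
  have hΔc : ContinuousOn Δ (Ioi 0) := fun t ht => (hΔ t ht).continuousAt.continuousWithinAt
  have hDc : Continuous D := by
    refine (hΔc.comp_continuous (by fun_prop) fun t => ?_).sub continuous_const
    exact hδ.trans_le (le_max_right _ _)
  have hDlip : ∀ a b, a ≤ x + 1 → b ≤ x + 1 → |D a - D b| ≤ K * |a - b| := by
    intro a b ha hb
    have h1 := (convex_Icc δ (x + 1)).norm_image_sub_le_of_norm_hasDerivWithin_le
      (fun t ht => (hΔ t (hδ.trans_le ht.1)).hasDerivWithinAt) hK
      (x := max b δ) (y := max a δ) ⟨le_max_right _ _, max_le hb (by linarith)⟩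
      ⟨le_max_right _ _, max_le ha (by linarith)⟩
    have h2 : |max a δ - max b δ| ≤ |a - b| := by
      simpa using abs_max_sub_max_le_max a δ b δ
    simp only [hD, sub_sub_sub_cancel_right]
    exact h1.trans (mul_le_mul_of_nonneg_left h2 hK0)
  have hDl : ∀ t, t < δ → HasDerivAt D 0 t := by
    intro t ht
    refine (hasDerivAt_const t (0 : ℝ)).congr_of_eventuallyEq ?_
    filter_upwards [Iio_mem_nhds ht] with s hs
    simp [hD, max_eq_right (le_of_lt (mem_Iio.1 hs))]
  have hDr : ∀ t, δ < t → HasDerivAt D (d t) t := by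
    intro t ht
    refine ((hΔ t (hδ.trans ht)).sub_const (Δ δ)).congr_of_eventuallyEq ?_
    filter_upwards [Ioi_mem_nhds ht] with s hs
    simp [hD, max_eq_left (le_of_lt (mem_Ioi.1 hs))]
  -- The upper limit x + 1 is common to all y in the unit ball about x; this is harmless because g(y
  -- - u) vanishes once u > y - δ.
  have hsub : ∀ (g : ℝ → ℝ) (y : ℝ), y ∈ Metric.ball x 1 → δ < y → (∀ t, t < δ → g t = 0) →
      IntervalIntegrable (fun u => u ^ (p - 1) * g (y - u)) volume 0 (y - δ) →
      ∫ u in (0 : ℝ)..(x + 1), u ^ (p - 1) * g (y - u) = ∫ t in δ..y, (y - t) ^ (p - 1) * g t := by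
    intro g y hy hyδ hg hi
    rw [Metric.mem_ball, Real.dist_eq, abs_lt] at hy
    have e1 : ∫ u in (0 : ℝ)..(y - δ), u ^ (p - 1) * g (y - u) =
        ∫ t in δ..y, (y - t) ^ (p - 1) * g t := by
      have := intervalIntegral.integral_comp_sub_left (a := δ) (b := y)
        (fun u => u ^ (p - 1) * g (y - u)) y
      simp only [sub_self, sub_sub_cancel] at this
      exact this.symm
    have e2 : ∀ u ∈ uIoc (y - δ) (x + 1), u ^ (p - 1) * g (y - u) = 0 := by
      intro u hu
      rw [uIoc_of_le (by linarith)] at hu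
      rw [hg _ (by linarith [hu.1]), mul_zero]
    have hi2 : IntervalIntegrable (fun u => u ^ (p - 1) * g (y - u)) volume (y - δ) (x + 1) :=
      (IntervalIntegrable.congr (f := fun _ => (0 : ℝ)) (fun u hu => (e2 u hu).symm)) (by simp)
    rw [← intervalIntegral.integral_add_adjacent_intervals hi hi2, e1,
      intervalIntegral.integral_congr_ae (g := fun _ => 0)
        (Eventually.of_forall fun u hu => e2 u hu)]
    simp
  have hu : ∀ a b : ℝ, IntervalIntegrable (fun u : ℝ => u ^ (p - 1)) volume a b := fun a b =>
    intervalIntegral.intervalIntegrable_rpow' (by linarith)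
  have hFi : ∀ y a b, IntervalIntegrable (fun u => u ^ (p - 1) * D (y - u)) volume a b :=
    fun y a b => (hu a b).mul_continuousOn (by fun_prop)
  have main := intervalIntegral.hasDerivAt_integral_of_dominated_loc_of_lip (μ := volume)
    (F := fun y u => u ^ (p - 1) * D (y - u)) (F' := fun u => u ^ (p - 1) * deriv D (x - u))
    (x₀ := x) (s := Metric.ball x 1) (bound := fun u => K * u ^ (p - 1)) (a := 0) (b := x + 1)
    (Metric.ball_mem_nhds x one_pos)
    (Eventually.of_forall fun y =>
      (intervalIntegrable_iff.1 (hFi y 0 (x + 1))).aestronglyMeasurable)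
    (hFi x _ _) ?_ ?_ ((hu _ _).const_mul K) ?_
  · have hx0 : x ∈ Metric.ball x 1 := Metric.mem_ball_self one_pos
    have e1 := hsub (deriv D) x hx0 hx (fun t ht => (hDl t ht).deriv) (main.1.mono_set (by
      rw [uIcc_of_le (by linarith), uIcc_of_le hL0]
      exact Icc_subset_Icc_right (by linarith)))
    have e2 : ∫ t in δ..x, (x - t) ^ (p - 1) * deriv D t = ∫ t in δ..x, (x - t) ^ (p - 1) * d t := by
      refine intervalIntegral.integral_congr_ae (Eventually.of_forall fun t ht => ?_)
      rw [uIoc_of_le hx.le] at ht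
      rw [(hDr t ht.1).deriv]
    rw [← e2, ← e1]
    refine main.2.congr_of_eventuallyEq ?_
    filter_upwards [Metric.ball_mem_nhds x one_pos, Ioi_mem_nhds hx] with y hy hyδ
    rw [hsub D y hy hyδ (fun t ht => by simp [hD, max_eq_right ht.le]) (hFi _ _ _)]
    refine intervalIntegral.integral_congr_ae (Eventually.of_forall fun t ht => ?_)
    rw [uIoc_of_le (le_of_lt hyδ)] at ht
    simp [hD, max_eq_left ht.1.le]
  · exact ((measurable_id.pow_const _).mul
      ((measurable_deriv D).comp (measurable_const.sub measurable_id))).aestronglyMeasurable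
  · refine Eventually.of_forall fun u hu' => LipschitzOnWith.of_dist_le_mul fun a ha b hb => ?_
    rw [uIoc_of_le hL0] at hu'
    rw [Metric.mem_ball, Real.dist_eq, abs_lt] at ha hb
    have h0 : 0 ≤ u ^ (p - 1) := Real.rpow_nonneg hu'.1.le _
    have h1 : |D (a - u) - D (b - u)| ≤ K * |a - b| := by
      rw [← sub_sub_sub_cancel_right a b u]
      exact hDlip (a - u) (b - u) (by linarith [hu'.1]) (by linarith [hu'.1])
    rw [Real.dist_eq, Real.dist_eq, Real.coe_nnabs, ← mul_sub, abs_mul, abs_of_nonneg h0,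
      abs_of_nonneg (mul_nonneg hK0 h0)]
    calc u ^ (p - 1) * |D (a - u) - D (b - u)| ≤ u ^ (p - 1) * (K * |a - b|) :=
          mul_le_mul_of_nonneg_left h1 h0
      _ = _ := by ring
  -- The only exceptional u is the one for which x - u hits the kink.
  · filter_upwards [Measure.ae_ne volume (x - δ)] with u hu1 _
    have h1 : HasDerivAt D (deriv D (x - u)) (x - u) := by
      rcases lt_or_gt_of_ne (show x - u ≠ δ from fun h => hu1 (by linarith)) with h | h
      · exact (hDl _ h).differentiableAt.hasDerivAt
      · exact (hDr _ h).differentiableAt.hasDerivAt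
    exact (h1.comp_sub_const x u).const_mul _

/-- The derivative of the Abel integral of a continuously differentiable function. -/
theorem hasDerivAt_abel {p δ x : ℝ} (hp : 0 < p) {Δ d : ℝ → ℝ}
    (hΔ : ∀ t, 0 < t → HasDerivAt Δ (d t) t) (hd : ContinuousOn d (Ioi 0))
    (hi : ∀ y, 0 < y → IntervalIntegrable Δ volume 0 y) (hδ : 0 < δ) (hx : δ < x) :
    HasDerivAt (fun y => ∫ t in (0 : ℝ)..y, (y - t) ^ (p - 1) * Δ t)
      ((∫ t in δ..x, (x - t) ^ (p - 1) * d t) + (x - δ) ^ (p - 1) * Δ δ +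
        (p - 1) * ∫ t in (0 : ℝ)..δ, (x - t) ^ (p - 2) * Δ t) x := by
  have hΔc : ContinuousOn Δ (Ioi 0) := fun t ht => (hΔ t ht).continuousAt.continuousWithinAt
  have h1 := hasDerivAt_abel_right hp hΔ hd hδ hx
  have h2 := hasDerivAt_integral_sub_rpow (p := p) hδ hx (hi δ hδ)
  -- This restores the constant Δ(δ) subtracted on [δ, y], using that the kernel integrates to (y -
  -- δ)^p / p.
  have h3 : HasDerivAt (fun y => (y - δ) ^ p / p * Δ δ) ((x - δ) ^ (p - 1) * Δ δ) x := by
    have := ((((hasDerivAt_id' x).sub_const δ).rpow_const (p := p)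
      (Or.inl (sub_pos.2 hx).ne')).div_const p).mul_const (Δ δ)
    refine this.congr_deriv ?_
    field_simp
  refine ((h1.add h3).add h2).congr_of_eventuallyEq ?_
  filter_upwards [Ioi_mem_nhds hx] with y hy
  have hy' : δ < y := hy
  have i1 := intervalIntegrable_abel_zero hp hΔc hi (hδ.trans hy').le
  have i2 := intervalIntegrable_abel hp hΔc hδ hy'.le
  have i3 : IntervalIntegrable (fun t => (y - t) ^ (p - 1) * Δ t) volume 0 δ :=
    i1.mono_set (by
      rw [uIcc_of_le hδ.le, uIcc_of_le (hδ.trans hy').le]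
      exact Icc_subset_Icc_right hy'.le)
  simp only [Pi.add_apply]
  rw [← intervalIntegral.integral_add_adjacent_intervals i3 i2]
  simp_rw [mul_sub]
  rw [intervalIntegral.integral_sub i2 ((intervalIntegrable_sub_rpow hp y _ _).mul_const _),
    intervalIntegral.integral_mul_const, integral_sub_rpow hp]
  ring

/-! ### Distribution functions: densities and the pointwise Abel formula -/

theorem measureReal_Iic_eq_zero {D : Measure ℝ} (hD : ∀ᵐ x ∂D, 0 < x) {x : ℝ}
    (hx : x ≤ 0) : D.real (Iic x) = 0 := by
  rw [measureReal_def, (measure_eq_zero_iff_ae_notMem (s := Iic x)).2, ENNReal.toReal_zero]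
  filter_upwards [hD] with y hy hy'
  exact absurd hy (not_lt.2 (le_trans hy' hx))

theorem continuousWithinAt_measureReal_Iic (D : Measure ℝ) [IsProbabilityMeasure D] (x : ℝ) :
    ContinuousWithinAt (fun y => D.real (Iic y)) (Ici x) x := by
  have h := (cdf D).right_continuous x
  have e : (fun y => D.real (Iic y)) = cdf D := funext fun y => (cdf_eq_real D y).symm
  rwa [e]

theorem monotone_measureReal_Iic (D : Measure ℝ) [IsProbabilityMeasure D] :
    Monotone fun y => D.real (Iic y) := fun _ _ h =>
  measureReal_mono (Iic_subset_Iic.2 h)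

/-- A law on `(0, ∞)` whose distribution function is differentiable there has its derivative as a
density. -/
theorem eq_densityMeasure_of_hasDerivAt {D : Measure ℝ} [IsProbabilityMeasure D]
    (hD : ∀ᵐ x ∂D, 0 < x) {f : ℝ → ℝ}
    (hf : ∀ x, 0 < x → HasDerivAt (fun y => D.real (Iic y)) (f x) x) :
    (∀ x, 0 < x → 0 ≤ f x) ∧ D = densityMeasure f := by
  have h0 : ∀ x, 0 < x → 0 ≤ f x := fun x hx => by
    rw [← (hf x hx).deriv]
    exact (monotone_measureReal_Iic D).deriv_nonneg
  refine ⟨h0, Measure.ext_of_Iic _ _ fun x => ?_⟩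
  rw [densityMeasure_apply measurableSet_Iic, Iic_inter_Ioi_zero, ← ofReal_measureReal]
  rcases le_or_gt x 0 with hx | hx
  · rw [measureReal_Iic_eq_zero hD hx, Ioc_eq_empty (not_lt.2 hx)]
    simp
  · rw [lintegral_Ioc_ofReal_deriv hx.le (g := fun y => D.real (Iic y)) ?_
      (fun y hy => hf y hy.1) (fun y hy => h0 y hy.1), measureReal_Iic_eq_zero hD le_rfl, sub_zero]
    intro y hy
    rcases hy.1.eq_or_lt with rfl | hy0
    · exact (continuousWithinAt_measureReal_Iic D 0).mono Icc_subset_Ici_self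
    · exact (hf y hy0).continuousAt.continuousWithinAt

/-- The distribution function as an Abel integral: pointwise version. -/
theorem measureReal_Iic_eq_abel {p : ℝ} (hp : 0 < p) {D : Measure ℝ} [IsProbabilityMeasure D]
    (hD : ∀ᵐ x ∂D, 0 < x) {Δ d : ℝ → ℝ} (hm : Measurable Δ)
    (hΔ : ∀ t, 0 < t → HasDerivAt Δ (d t) t) (hd : ContinuousOn d (Ioi 0))
    (hi : ∀ y, 0 < y → IntervalIntegrable Δ volume 0 y)
    (hst : ∀ s, 0 < s → IntegrableOn (fun t => Δ t / (s + t)) (Ioi 0) ∧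
      ∫ t in Ioi 0, Δ t / (s + t) = ∫ x, (s + x) ^ (-p) ∂D) {x : ℝ} (hx : 0 ≤ x) :
    D.real (Iic x) = ∫ t in (0 : ℝ)..x, (x - t) ^ (p - 1) * Δ t := by
  have hΔc : ContinuousOn Δ (Ioi 0) := fun t ht => (hΔ t ht).continuousAt.continuousWithinAt
  rcases hx.eq_or_lt with rfl | hx
  · rw [measureReal_Iic_eq_zero hD le_rfl, intervalIntegral.integral_same]
  have hae : ∀ᵐ y : ℝ, y ∈ Ioi (0 : ℝ) →
      D.real (Iic y) = ∫ t in (0 : ℝ)..y, (y - t) ^ (p - 1) * Δ t := by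
    rw [← ae_restrict_iff' measurableSet_Ioi]
    filter_upwards [ae_cdf_add_abelIntegral hp hD hm hst, ae_restrict_mem measurableSet_Ioi]
      with y hy hy0
    have hy0' : (0 : ℝ) < y := hy0
    have hii := intervalIntegrable_abel_zero hp hΔc hi hy0'.le
    rw [intervalIntegrable_iff_integrableOn_Ioc_of_le hy0'.le] at hii
    have e1 : ∀ t ∈ Ioc 0 y, ENNReal.ofReal ((y - t) ^ (p - 1) * Δ t) =
        ENNReal.ofReal ((y - t) ^ (p - 1)) * ENNReal.ofReal (Δ t) := fun t ht =>
      ENNReal.ofReal_mul (Real.rpow_nonneg (sub_nonneg.2 ht.2) _)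
    have e2 : ∀ t ∈ Ioc 0 y, ENNReal.ofReal (-((y - t) ^ (p - 1) * Δ t)) =
        ENNReal.ofReal ((y - t) ^ (p - 1)) * ENNReal.ofReal (-Δ t) := fun t ht => by
      rw [← mul_neg]
      exact ENNReal.ofReal_mul (Real.rpow_nonneg (sub_nonneg.2 ht.2) _)
    rw [intervalIntegral.integral_of_le hy0'.le,
      integral_eq_lintegral_pos_part_sub_lintegral_neg_part hii,
      setLIntegral_congr_fun measurableSet_Ioc e1, setLIntegral_congr_fun measurableSet_Ioc e2]
    have f2 : abelIntegral p (fun t => ENNReal.ofReal (-Δ t)) y ≠ ⊤ := by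
      rw [abelIntegral, ← setLIntegral_congr_fun measurableSet_Ioc e2]
      exact ne_top_of_le_ne_top hii.2.ne (lintegral_mono fun t => by
        rw [← enorm_neg]
        exact Real.ofReal_le_enorm _)
    have := congrArg ENNReal.toReal hy
    rw [ENNReal.toReal_add (measure_ne_top _ _) f2] at this
    rw [measureReal_def]
    exact eq_sub_of_add_eq this
  -- Both sides are right-continuous at x. If they agreed nowhere on some interval (x, u), the
  -- almost everywhere equality would fail on a set of positive measure.
  have hc1 : Tendsto (fun y => D.real (Iic y)) (𝓝[>] x) (𝓝 (D.real (Iic x))) :=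
    (continuousWithinAt_measureReal_Iic D x).mono_left (nhdsWithin_mono _ Ioi_subset_Ici_self)
  have hc2 : Tendsto (fun y => ∫ t in (0 : ℝ)..y, (y - t) ^ (p - 1) * Δ t) (𝓝[>] x)
      (𝓝 (∫ t in (0 : ℝ)..x, (x - t) ^ (p - 1) * Δ t)) :=
    (hasDerivAt_abel hp hΔ hd hi (half_pos hx) (half_lt_self hx)).continuousAt.tendsto.mono_left
      nhdsWithin_le_nhds
  refine tendsto_nhds_unique_of_frequently_eq hc1 hc2 ?_
  intro hev
  obtain ⟨u, hu, hsub⟩ := mem_nhdsGT_iff_exists_Ioo_subset.1 hev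
  have h1 : volume (Ioo x u) = 0 := by
    rw [measure_eq_zero_iff_ae_notMem]
    filter_upwards [hae] with y hy hyu
    exact hsub hyu (hy (hx.trans hyu.1))
  rw [Real.volume_Ioo, ENNReal.ofReal_eq_zero] at h1
  have : x < u := hu
  linarith

/-! ### The derivative of the Cifarelli–Regazzini function of `ϱ_{α,H}` -/

theorem measurable_crDelta (θ : ℝ) (G : Measure ℝ) [IsFiniteMeasure G] :
    Measurable (crDelta θ G) := by
  have h1 : Measurable fun t => G.real (Ioc 0 t) :=
    Monotone.measurable fun s t h => measureReal_mono (Ioc_subset_Ioc_right h)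
  have h2 : Measurable (logPotential G) := by
    have : Measurable fun q : ℝ × ℝ => Real.log |q.1 - q.2| := by
      simp_rw [Real.log_abs]
      exact Real.measurable_log.comp (measurable_fst.sub measurable_snd)
    exact (this.stronglyMeasurable.integral_prod_right').measurable
  unfold crDelta
  fun_prop

/-- The kernel of `bTwo` is bounded. -/
theorem kernelTwo_le {α x r : ℝ} (h0 : 0 < α) (h1 : α < 1) (hx : 0 < x) (hr : 0 < r) :
    x ^ (2 * α - 1) / lampertiDenom α x r ≤ (lampertiConst α)⁻¹ * x⁻¹ := by
  have hc := lampertiConst_pos h0 h1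
  have hD := lampertiDenom_pos h0 h1 hx.le hr
  have h2 := lampertiDenom_ge (α := α) hx.le hr.le
  rw [div_le_iff₀ hD, Real.rpow_sub_one hx.ne', mul_comm 2 α, Real.rpow_mul hx.le, Real.rpow_two]
  have h4 : (x ^ α) ^ 2 ≤ (lampertiConst α)⁻¹ * lampertiDenom α x r := by
    rw [inv_mul_eq_div, le_div_iff₀ hc]
    nlinarith [sq_nonneg r]
  calc (x ^ α) ^ 2 / x = x⁻¹ * (x ^ α) ^ 2 := by ring
    _ ≤ x⁻¹ * ((lampertiConst α)⁻¹ * lampertiDenom α x r) := by gcongr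
    _ = _ := by ring

theorem kernelTwo_nonneg {α x r : ℝ} (h0 : 0 < α) (h1 : α < 1) (hx : 0 < x) (hr : 0 < r) :
    0 ≤ x ^ (2 * α - 1) / lampertiDenom α x r := by
  have hD := lampertiDenom_pos h0 h1 hx.le hr
  positivity

theorem measurable_kernelTwo (α x : ℝ) :
    Measurable fun r : ℝ => x ^ (2 * α - 1) / lampertiDenom α x r :=
  measurable_const.div ((measurable_lampertiDenom α).comp measurable_prodMk_left)

theorem hasDerivAt_lampertiDenom {α x r : ℝ} (hx : 0 < x) :
    HasDerivAt (fun y => lampertiDenom α y r)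
      (2 * α * (x ^ (2 * α - 1) + Real.cos (α * Real.pi) * (x ^ (α - 1) * r))) x := by
  have h1 := Real.hasDerivAt_rpow_const (p := 2 * α) (Or.inl hx.ne')
  have h2 := (((Real.hasDerivAt_rpow_const (p := α) (Or.inl hx.ne')).const_mul 2).mul_const
    r).mul_const (Real.cos (α * Real.pi))
  refine ((h1.add h2).add_const (r ^ 2)).congr_deriv ?_
  ring

theorem continuous_lampertiDenom {α : ℝ} (h0 : 0 < α) (r : ℝ) :
    Continuous fun x => lampertiDenom α x r := by
  have h1 : Continuous fun x : ℝ => x ^ α := Real.continuous_rpow_const h0.le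
  have h2 : Continuous fun x : ℝ => x ^ (2 * α) := Real.continuous_rpow_const (by positivity)
  unfold lampertiDenom
  fun_prop

theorem continuousAt_kernel {α x r : ℝ} (h0 : 0 < α) (h1 : α < 1) (hx : 0 < x) (hr : 0 < r) :
    ContinuousAt (fun y => y ^ (α - 1) * r / lampertiDenom α y r) x :=
  ((Real.continuousAt_rpow_const _ _ (Or.inl hx.ne')).mul_const r).div
    (continuous_lampertiDenom h0 r).continuousAt (lampertiDenom_pos h0 h1 hx.le hr).ne'

theorem continuousAt_kernelTwo {α x r : ℝ} (h0 : 0 < α) (h1 : α < 1) (hx : 0 < x) (hr : 0 < r) :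
    ContinuousAt (fun y => y ^ (2 * α - 1) / lampertiDenom α y r) x :=
  (Real.continuousAt_rpow_const _ _ (Or.inl hx.ne')).div
    (continuous_lampertiDenom h0 r).continuousAt (lampertiDenom_pos h0 h1 hx.le hr).ne'

theorem bOne_nonneg {α x : ℝ} {H : Measure ℝ} (h0 : 0 < α) (h1 : α < 1) (hx : 0 < x) (hH : ∀ᵐ r ∂H, 0 < r) :
    0 ≤ bOne α H x :=
  integral_nonneg_of_ae (hH.mono fun _ hr => kernel_nonneg h0 h1 hx hr)

theorem bTwo_nonneg {α x : ℝ} {H : Measure ℝ} (h0 : 0 < α) (h1 : α < 1) (hx : 0 < x) (hH : ∀ᵐ r ∂H, 0 < r) :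
    0 ≤ bTwo α H x :=
  integral_nonneg_of_ae (hH.mono fun _ hr => kernelTwo_nonneg h0 h1 hx hr)

theorem inv_le_two_mul_inv {x y : ℝ} (hx : 0 < x) (hy : x / 2 < y) : y⁻¹ ≤ 2 * x⁻¹ := by
  rw [show 2 * x⁻¹ = (x / 2)⁻¹ by field_simp]
  exact inv_anti₀ (by positivity) hy.le

section
variable {α : ℝ} {H : Measure ℝ} [IsProbabilityMeasure H]

theorem integrable_kernelTwo {x : ℝ} (h0 : 0 < α) (h1 : α < 1) (hx : 0 < x)
    (hH : ∀ᵐ r ∂H, 0 < r) :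
    Integrable (fun r => x ^ (2 * α - 1) / lampertiDenom α x r) H := by
  refine Integrable.of_bound (measurable_kernelTwo α x).aestronglyMeasurable
    ((lampertiConst α)⁻¹ * x⁻¹) ?_
  filter_upwards [hH] with r hr
  rw [Real.norm_of_nonneg (kernelTwo_nonneg h0 h1 hx hr)]
  exact kernelTwo_le h0 h1 hx hr

theorem continuousOn_bOne (h0 : 0 < α) (h1 : α < 1) (hH : ∀ᵐ r ∂H, 0 < r) :
    ContinuousOn (bOne α H) (Ioi 0) := by
  intro x hx
  have hx : 0 < x := hx
  have hc := lampertiConst_pos h0 h1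
  refine ContinuousAt.continuousWithinAt (continuousAt_of_dominated
    (bound := fun _ => (2 * lampertiConst α)⁻¹ * (2 * x⁻¹))
    (Eventually.of_forall fun y => (measurable_kernel α y).aestronglyMeasurable) ?_
    (integrable_const _) (hH.mono fun r hr => continuousAt_kernel h0 h1 hx hr))
  filter_upwards [Ioi_mem_nhds (half_lt_self hx)] with y hy
  have hy0 : 0 < y := (half_pos hx).trans hy
  filter_upwards [hH] with r hr
  rw [Real.norm_of_nonneg (kernel_nonneg h0 h1 hy0 hr)]
  exact (kernel_le h0 h1 hy0 hr).trans
    (mul_le_mul_of_nonneg_left (inv_le_two_mul_inv hx hy) (by positivity))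

theorem continuousOn_bTwo (h0 : 0 < α) (h1 : α < 1) (hH : ∀ᵐ r ∂H, 0 < r) :
    ContinuousOn (bTwo α H) (Ioi 0) := by
  intro x hx
  have hx : 0 < x := hx
  have hc := lampertiConst_pos h0 h1
  refine ContinuousAt.continuousWithinAt (continuousAt_of_dominated
    (bound := fun _ => (lampertiConst α)⁻¹ * (2 * x⁻¹))
    (Eventually.of_forall fun y => (measurable_kernelTwo α y).aestronglyMeasurable) ?_
    (integrable_const _) (hH.mono fun r hr => continuousAt_kernelTwo h0 h1 hx hr))
  filter_upwards [Ioi_mem_nhds (half_lt_self hx)] with y hy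
  have hy0 : 0 < y := (half_pos hx).trans hy
  filter_upwards [hH] with r hr
  rw [Real.norm_of_nonneg (kernelTwo_nonneg h0 h1 hy0 hr)]
  exact (kernelTwo_le h0 h1 hy0 hr).trans
    (mul_le_mul_of_nonneg_left (inv_le_two_mul_inv hx hy) (by positivity))

theorem hasDerivAt_upsilon {x : ℝ} (h0 : 0 < α) (h1 : α < 1) (hx : 0 < x)
    (hH : ∀ᵐ r ∂H, 0 < r) :
    HasDerivAt (upsilon α H) (Real.sin (Real.pi * α) / Real.pi * bOne α H x) x := by
  have hc := lampertiConst_pos h0 h1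
  have hs := div_pos (sin_pi_mul_pos h0 h1) Real.pi_pos
  have h := (hasDerivAt_integral_of_dominated_loc_of_deriv_le (μ := H)
    (F := fun y r => cdfScaled α r y) (F' := fun y r => rhoScaled α r y) (x₀ := x)
    (s := Ioi (x / 2)) (bound := fun _ => Real.sin (Real.pi * α) / Real.pi *
      ((2 * lampertiConst α)⁻¹ * (2 * x⁻¹)))
    (Ioi_mem_nhds (half_lt_self hx))
    (Eventually.of_forall fun y => (measurable_cdfScaled α y).aestronglyMeasurable)
    (integrable_cdfScaled h0 h1 hx.le hH)
    ((measurable_kernel α x).const_mul _).aestronglyMeasurable ?_ (integrable_const _) ?_).2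
  · have e : ∫ r, rhoScaled α r x ∂H = Real.sin (Real.pi * α) / Real.pi * bOne α H x := by
      rw [bOne, ← integral_const_mul]
      rfl
    rw [← e]
    refine h.congr_of_eventuallyEq ?_
    filter_upwards [Ioi_mem_nhds hx] with y hy
    exact integral_cdfScaled_eq h0 h1 (le_of_lt (mem_Ioi.1 hy)) hH
  · filter_upwards [hH] with r hr y hy
    have hy0 : 0 < y := (half_pos hx).trans hy
    rw [Real.norm_of_nonneg (rhoScaled_nonneg h0 h1 hy0.le hr)]
    exact mul_le_mul_of_nonneg_left ((kernel_le h0 h1 hy0 hr).trans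
      (mul_le_mul_of_nonneg_left (inv_le_two_mul_inv hx hy) (by positivity))) hs.le
  · filter_upwards [hH] with r hr y hy
    exact hasDerivAt_cdfScaled h0 h1 hr ((half_pos hx).trans hy)

theorem integrable_log_lampertiDenom {x : ℝ} (h0 : 0 < α) (h1 : α < 1) (hx : 0 < x)
    (hH : ∀ᵐ r ∂H, 0 < r) (hlog : Integrable (fun r => Real.log (1 + r)) H) :
    Integrable (fun r => Real.log (lampertiDenom α x r)) H := by
  obtain ⟨u, rfl⟩ : ∃ u, x = Real.exp u := ⟨Real.log x, (Real.exp_log hx).symm⟩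
  have him : |(u + Real.pi * Complex.I : ℂ).im| ≤ Real.pi := by simp [abs_of_pos Real.pi_pos]
  have h := (integrable_clog_cexp_add hH hlog (abs_im_mul_lt h0 h1 him)).re.const_mul 2
  simp only [RCLike.re_to_complex, Complex.log_re] at h
  simp_rw [← normSq_cexp_mul_add, Real.log_pow]
  exact_mod_cast h

/-- The closed form (1/2α) ∫ log of the denominator is differentiated instead of the potential,
whose integrand log|x - y| is singular. -/
theorem hasDerivAt_logS {x : ℝ} (h0 : 0 < α) (h1 : α < 1) (hx : 0 < x) (hH : ∀ᵐ r ∂H, 0 < r)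
    (hlog : Integrable (fun r => Real.log (1 + r)) H) :
    HasDerivAt (logS α H) (bTwo α H x + Real.cos (Real.pi * α) * bOne α H x) x := by
  have hc := lampertiConst_pos h0 h1
  have hm : ∀ y, Measurable fun r => lampertiDenom α y r := fun y =>
    (measurable_lampertiDenom α).comp measurable_prodMk_left
  set F' : ℝ → ℝ → ℝ := fun y r => 2 * α * (y ^ (2 * α - 1) / lampertiDenom α y r +
    Real.cos (Real.pi * α) * (y ^ (α - 1) * r / lampertiDenom α y r)) with hF'
  have h := (hasDerivAt_integral_of_dominated_loc_of_deriv_le (μ := H)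
    (F := fun y r => Real.log (lampertiDenom α y r)) (F' := F') (x₀ := x)
    (s := Ioi (x / 2)) (bound := fun _ => 2 * α * ((lampertiConst α)⁻¹ * (2 * x⁻¹) +
      (2 * lampertiConst α)⁻¹ * (2 * x⁻¹)))
    (Ioi_mem_nhds (half_lt_self hx))
    (Eventually.of_forall fun y => (Real.measurable_log.comp (hm y)).aestronglyMeasurable)
    (integrable_log_lampertiDenom h0 h1 hx hH hlog)
    ((((measurable_kernelTwo α x).add ((measurable_kernel α x).const_mul _)).const_mul
      _).aestronglyMeasurable) ?_ (integrable_const _) ?_).2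
  · have e : 1 / (2 * α) * ∫ r, F' x r ∂H =
        bTwo α H x + Real.cos (Real.pi * α) * bOne α H x := by
      rw [hF']
      simp only
      rw [integral_const_mul, integral_add (integrable_kernelTwo h0 h1 hx hH)
        ((integrable_kernel h0 h1 hx hH).const_mul _), integral_const_mul, bOne, bTwo]
      field_simp
    rw [← e]
    refine (h.const_mul _).congr_of_eventuallyEq ?_
    filter_upwards [Ioi_mem_nhds hx] with y hy
    exact logS_eq h0 h1 hH hlog hy
  · filter_upwards [hH] with r hr y hy
    have hy0 : 0 < y := (half_pos hx).trans hy
    have b1 := (kernelTwo_le h0 h1 hy0 hr).trans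
      (mul_le_mul_of_nonneg_left (inv_le_two_mul_inv hx hy) (by positivity))
    have b2 := (kernel_le h0 h1 hy0 hr).trans
      (mul_le_mul_of_nonneg_left (inv_le_two_mul_inv hx hy) (by positivity))
    have n1 := kernelTwo_nonneg h0 h1 hy0 hr
    have n2 := kernel_nonneg h0 h1 hy0 hr
    rw [hF', norm_mul, Real.norm_of_nonneg (by positivity : 0 ≤ 2 * α)]
    refine mul_le_mul_of_nonneg_left ((norm_add_le _ _).trans ?_) (by positivity)
    rw [norm_mul, Real.norm_of_nonneg n1, Real.norm_of_nonneg n2, Real.norm_eq_abs]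
    refine add_le_add b1 (le_trans ?_ b2)
    exact mul_le_of_le_one_left n2 (Real.abs_cos_le_one _)
  · filter_upwards [hH] with r hr y hy
    have hy0 : 0 < y := (half_pos hx).trans hy
    have hD := lampertiDenom_pos h0 h1 hy0.le hr
    refine ((hasDerivAt_lampertiDenom hy0).log hD.ne').congr_deriv ?_
    rw [hF', mul_comm α Real.pi]
    field_simp

theorem hasDerivAt_crDelta {x : ℝ} (h0 : 0 < α) (h1 : α < 1) (θ : ℝ) (hx : 0 < x)
    (hH : ∀ᵐ r ∂H, 0 < r) (hlog : Integrable (fun r => Real.log (1 + r)) H) :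
    HasDerivAt (crDelta (α * θ) (densityMeasure (rhoMix α H))) (dFun α θ H x) x := by
  have hU := (hasDerivAt_upsilon h0 h1 hx hH).const_mul (Real.pi * θ * α)
  have hS := (hasDerivAt_logS h0 h1 hx hH hlog).const_mul (-(θ * α))
  have h := (hU.sin.const_mul (1 / Real.pi)).mul hS.exp
  rw [show crDelta (α * θ) (densityMeasure (rhoMix α H)) = _ from
    funext fun y => crDelta_rhoMix h0 h1 hH θ y]
  refine h.congr_deriv ?_
  -- The derivative of Υ contributes sin(πα) B₁ and that of 𝒮 contributes cos(πα) B₁; the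
  -- subtraction formula merges them into a single sine.
  have e : Real.sin (Real.pi * α * (1 - θ * upsilon α H x)) =
      Real.sin (Real.pi * α) * Real.cos (Real.pi * θ * α * upsilon α H x) -
        Real.cos (Real.pi * α) * Real.sin (Real.pi * θ * α * upsilon α H x) := by
    rw [← Real.sin_sub]
    congr 1
    ring
  rw [dFun, e]
  have := Real.pi_ne_zero
  field_simp
  ring

theorem continuousOn_dFun (h0 : 0 < α) (h1 : α < 1) (θ : ℝ) (hH : ∀ᵐ r ∂H, 0 < r)
    (hlog : Integrable (fun r => Real.log (1 + r)) H) :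
    ContinuousOn (dFun α θ H) (Ioi 0) := by
  have hU : ContinuousOn (upsilon α H) (Ioi 0) := fun x hx =>
    (hasDerivAt_upsilon h0 h1 hx hH).continuousAt.continuousWithinAt
  have hS : ContinuousOn (logS α H) (Ioi 0) := fun x hx =>
    (hasDerivAt_logS h0 h1 hx hH hlog).continuousAt.continuousWithinAt
  have hB1 := continuousOn_bOne h0 h1 hH
  have hB2 := continuousOn_bTwo h0 h1 hH
  unfold dFun
  fun_prop

/-- Near 0 the bound |Δ(t)| ≤ C t^(-1/2) is enough, with no assumption on log r; elsewhere Δ is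
continuous. -/
theorem intervalIntegrable_crDelta {θ : ℝ} (h0 : 0 < α) (h1 : α < 1) (hθ : 0 < θ)
    (hH : ∀ᵐ r ∂H, 0 < r) (hlog : Integrable (fun r => Real.log (1 + r)) H) {y : ℝ}
    (hy : 0 < y) :
    IntervalIntegrable (crDelta (α * θ) (densityMeasure (rhoMix α H))) volume 0 y := by
  have := isProbabilityMeasure_rhoMix h0 h1 hH
  obtain ⟨C, hC0, hC⟩ := exists_abs_crDelta_le h0 h1 hθ hH hlog (half_pos one_pos)
  have hc : ContinuousOn (crDelta (α * θ) (densityMeasure (rhoMix α H))) (Ioi 0) := fun t ht =>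
    (hasDerivAt_crDelta h0 h1 θ ht hH hlog).continuousAt.continuousWithinAt
  refine IntervalIntegrable.trans (b := 1) ?_ (ContinuousOn.intervalIntegrable
    (hc.mono fun t ht => (lt_min one_pos hy).trans_le ht.1))
  refine ((intervalIntegral.intervalIntegrable_rpow' (r := -(1 / 2))
    (by norm_num)).const_mul C).mono_fun' (measurable_crDelta _ _).aestronglyMeasurable ?_
  rw [uIoc_of_le zero_le_one]
  filter_upwards [ae_restrict_mem measurableSet_Ioc] with t ht
  exact hC t ht

end

/-! ### Consequences for the mean functional of `ϱ_{α,H}` -/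

section
variable {α θ : ℝ} {H : Measure ℝ} [IsProbabilityMeasure H]

theorem measureReal_dirichletMean_Iic (h0 : 0 < α) (h1 : α < 1) (hθ : 0 < θ)
    (hH : ∀ᵐ r ∂H, 0 < r) (hlog : Integrable (fun r => Real.log (1 + r)) H) {x : ℝ}
    (hx : 0 ≤ x) :
    (dirichletMean (α * θ) (densityMeasure (rhoMix α H))).real (Iic x) =
      ∫ t in (0 : ℝ)..x,
        (x - t) ^ (α * θ - 1) * crDelta (α * θ) (densityMeasure (rhoMix α H)) t := by
  have := isProbabilityMeasure_rhoMix h0 h1 hH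
  have hν := ae_densityMeasure_pos (rhoMix α H)
  have hνlog := integrable_log_one_add_rhoMix h0 h1 hH hlog
  have hp := mul_pos h0 hθ
  have := isProbabilityMeasure_dirichletMean hp hν hνlog
  refine measureReal_Iic_eq_abel hp (ae_dirichletMean_pos hp hν hνlog) (measurable_crDelta _ _)
    (fun t ht => hasDerivAt_crDelta h0 h1 θ ht hH hlog) (continuousOn_dFun h0 h1 θ hH hlog)
    (fun y hy => intervalIntegrable_crDelta h0 h1 hθ hH hlog hy) (fun s hs => ?_) hx
  rw [integral_dirichletMean_rpow hp hν hνlog hs]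
  exact stieltjes_crDelta h0 h1 hθ hH hlog hs

/-- After the scale b^(1/α) is extracted, the Markov–Krein identity for ϱ_α gives (1 + s^α/b)^(-θ),
and the extracted power is b^(-θ). This converts order αθ at s into order θ at s^α. -/
theorem lintegral_dirichletMean_rho_mul {s b : ℝ} (h0 : 0 < α) (h1 : α < 1) (hθ : 0 < θ)
    (hs : 0 < s) (hb : 0 < b) :
    ∫⁻ a, ENNReal.ofReal ((s + a * b ^ (1 / α)) ^ (-(α * θ)))
      ∂dirichletMean (α * θ) (densityMeasure (rho α)) =
      ENNReal.ofReal ((s ^ α + b) ^ (-θ)) := by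
  have := isProbabilityMeasure_rho h0 h1
  have hν := ae_densityMeasure_pos (rho α)
  have hνlog := integrable_log_one_add_rho h0 h1
  have hp := mul_pos h0 hθ
  have hc : 0 < b ^ (1 / α) := Real.rpow_pos_of_pos hb _
  have hcα : (b ^ (1 / α)) ^ α = b := by
    rw [← Real.rpow_mul hb.le, one_div_mul_cancel h0.ne', Real.rpow_one]
  have e1 : ∀ᵐ a ∂dirichletMean (α * θ) (densityMeasure (rho α)),
      ENNReal.ofReal ((s + a * b ^ (1 / α)) ^ (-(α * θ))) =
        ENNReal.ofReal (b ^ (-θ)) * ENNReal.ofReal ((s / b ^ (1 / α) + a) ^ (-(α * θ))) := by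
    filter_upwards [ae_dirichletMean_pos hp hν hνlog] with a ha
    rw [← ENNReal.ofReal_mul (by positivity)]
    congr 1
    have e2 : b ^ (-θ) = (b ^ (1 / α)) ^ (-(α * θ)) := by
      rw [← Real.rpow_mul hb.le]
      congr 1
      field_simp
    rw [e2, ← Real.mul_rpow hc.le (by positivity)]
    congr 1
    field_simp
  rw [lintegral_congr_ae e1, lintegral_const_mul _ (measurable_add_rpow _ _).ennreal_ofReal,
    lintegral_dirichletMean_rpow hp hν hνlog (by positivity),
    integral_log_add_rho h0 h1 (by positivity), ← ENNReal.ofReal_mul (by positivity),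
    Real.div_rpow hs.le hc.le, hcα]
  congr 1
  have hpos : 0 < 1 + s ^ α / b := by positivity
  have e3 : -(α * θ) * (1 / α * Real.log (1 + s ^ α / b)) = Real.log (1 + s ^ α / b) * -θ := by
    field_simp
  rw [e3, ← Real.rpow_def_of_pos hpos, ← Real.mul_rpow hb.le hpos.le]
  congr 1
  field_simp
  ring

/-- Conditionally on M_θ(H) = b the product has transform (s^α + b)^(-θ). Averaging over b and
applying Markov–Krein to H gives exp(-θ ∫ log(s^α + r) H(dr)), the transform of the left side. -/
theorem dirichletMean_rhoMix_eq_map (h0 : 0 < α) (h1 : α < 1) (hθ : 0 < θ)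
    (hH : ∀ᵐ r ∂H, 0 < r) (hlog : Integrable (fun r => Real.log (1 + r)) H) :
    dirichletMean (α * θ) (densityMeasure (rhoMix α H)) =
      ((dirichletMean (α * θ) (densityMeasure (rho α))).prod (dirichletMean θ H)).map
        (fun p : ℝ × ℝ => p.1 * p.2 ^ (1 / α)) := by
  have := isProbabilityMeasure_rho h0 h1
  have := isProbabilityMeasure_rhoMix h0 h1 hH
  have hν := ae_densityMeasure_pos (rhoMix α H)
  have hνlog := integrable_log_one_add_rhoMix h0 h1 hH hlog
  have hρ := ae_densityMeasure_pos (rho α)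
  have hρlog := integrable_log_one_add_rho h0 h1
  have hp := mul_pos h0 hθ
  have := isProbabilityMeasure_dirichletMean hp hν hνlog
  have := isProbabilityMeasure_dirichletMean hp hρ hρlog
  have := isProbabilityMeasure_dirichletMean hθ hH hlog
  have hm := measurable_mul_rpow α
  refine Measure.ext_of_lintegral_rpow_neg_add hp
    ((ae_dirichletMean_pos hp hν hνlog).mono fun x hx => hx.le) ?_ ?_ fun s hs => ?_
  · rw [ae_map_iff hm.aemeasurable measurableSet_Ici]
    filter_upwards [Measure.quasiMeasurePreserving_fst.ae (ae_dirichletMean_pos hp hρ hρlog),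
      Measure.quasiMeasurePreserving_snd.ae (ae_dirichletMean_pos hθ hH hlog)] with q hq1 hq2
    exact mul_nonneg hq1.le (Real.rpow_nonneg hq2.le _)
  · rw [lintegral_dirichletMean_rpow hp hν hνlog one_pos]
    exact ENNReal.ofReal_ne_top
  · have hmeas : Measurable fun x : ℝ => ENNReal.ofReal ((s + x) ^ (-(α * θ))) :=
      (measurable_add_rpow _ _).ennreal_ofReal
    have hmeas2 : Measurable fun q : ℝ × ℝ =>
        ENNReal.ofReal ((s + q.1 * q.2 ^ (1 / α)) ^ (-(α * θ))) := hmeas.comp hm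
    rw [lintegral_map hmeas hm, lintegral_prod_symm _ hmeas2.aemeasurable,
      lintegral_congr_ae ((ae_dirichletMean_pos hθ hH hlog).mono fun b hb =>
        lintegral_dirichletMean_rho_mul h0 h1 hθ hs hb),
      lintegral_dirichletMean_rpow hθ hH hlog (Real.rpow_pos_of_pos hs _),
      lintegral_dirichletMean_rpow hp hν hνlog hs, integral_log_add_rhoMix h0 h1 hH hlog hs]
    congr 2
    field_simp

theorem dirichletMean_one_eq (h0 : 0 < α) (h1 : α < 1) (hH : ∀ᵐ r ∂H, 0 < r)
    (hlog : Integrable (fun r => Real.log (1 + r)) H) :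
    dirichletMean 1 (densityMeasure (rhoMix α H)) =
      densityMeasure (crDelta 1 (densityMeasure (rhoMix α H))) := by
  have := isProbabilityMeasure_rhoMix h0 h1 hH
  have hν := ae_densityMeasure_pos (rhoMix α H)
  have hνlog := integrable_log_one_add_rhoMix h0 h1 hH hlog
  have := isProbabilityMeasure_dirichletMean one_pos hν hνlog
  -- The choice θ = 1/α makes αθ = 1, so the Abel kernel is constant and the distribution function
  -- is a plain primitive of Δ.
  have hθ : 0 < 1 / α := by positivity
  have e : α * (1 / α) = 1 := mul_one_div_cancel h0.ne'
  have hc := fun {x : ℝ} => measureReal_dirichletMean_Iic (x := x) h0 h1 hθ hH hlog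
  have hi := fun {y : ℝ} => intervalIntegrable_crDelta (y := y) h0 h1 hθ hH hlog
  have hd := fun {x : ℝ} (hx : 0 < x) => hasDerivAt_crDelta h0 h1 (1 / α) hx hH hlog
  rw [e] at hc hi hd
  simp only [sub_self, Real.rpow_zero, one_mul] at hc
  refine (eq_densityMeasure_of_hasDerivAt (ae_dirichletMean_pos one_pos hν hνlog)
    fun x hx => ?_).2
  have h2 := intervalIntegral.integral_hasDerivAt_right (hi hx)
    ((measurable_crDelta _ _).stronglyMeasurable.stronglyMeasurableAtFilter) (hd hx).continuousAt
  refine h2.congr_of_eventuallyEq ?_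
  filter_upwards [Ioi_mem_nhds hx] with y hy
  exact hc (le_of_lt (mem_Ioi.1 hy))

theorem hasDerivAt_measureReal_dirichletMean {δ x : ℝ} (h0 : 0 < α) (h1 : α < 1) (hθ : 0 < θ)
    (hH : ∀ᵐ r ∂H, 0 < r) (hlog : Integrable (fun r => Real.log (1 + r)) H) (hδ : 0 < δ)
    (hx : δ < x) :
    HasDerivAt (fun y => (dirichletMean (α * θ) (densityMeasure (rhoMix α H))).real (Iic y))
      ((∫ t in δ..x, (x - t) ^ (α * θ - 1) * dFun α θ H t) +
        (x - δ) ^ (α * θ - 1) * crDelta (α * θ) (densityMeasure (rhoMix α H)) δ +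
        (α * θ - 1) * ∫ t in (0 : ℝ)..δ, (x - t) ^ (α * θ - 2) *
          crDelta (α * θ) (densityMeasure (rhoMix α H)) t) x := by
  refine (hasDerivAt_abel (mul_pos h0 hθ)
    (fun t ht => hasDerivAt_crDelta h0 h1 θ ht hH hlog) (continuousOn_dFun h0 h1 θ hH hlog)
    (fun y hy => intervalIntegrable_crDelta h0 h1 hθ hH hlog hy) hδ hx).congr_of_eventuallyEq ?_
  filter_upwards [Ioi_mem_nhds (hδ.trans hx)] with y hy
  exact measureReal_dirichletMean_Iic h0 h1 hθ hH hlog (le_of_lt (mem_Ioi.1 hy))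

/-- The density, as an integral that is improper at `0`. -/
theorem exists_density_dirichletMean (h0 : 0 < α) (h1 : α < 1) (hθ : 0 < θ)
    (hH : ∀ᵐ r ∂H, 0 < r) (hlog : Integrable (fun r => Real.log (1 + r)) H)
    (hlim : Tendsto (crDelta (α * θ) (densityMeasure (rhoMix α H))) (𝓝[>] 0) (𝓝 0)) :
    ∃ f : ℝ → ℝ, (∀ x, 0 < x → 0 ≤ f x ∧
        Tendsto (fun ε => ∫ t in ε..x, (x - t) ^ (α * θ - 1) * dFun α θ H t)
          (𝓝[>] 0) (𝓝 (f x))) ∧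
      dirichletMean (α * θ) (densityMeasure (rhoMix α H)) = densityMeasure f := by
  have := isProbabilityMeasure_rhoMix h0 h1 hH
  have hν := ae_densityMeasure_pos (rhoMix α H)
  have hνlog := integrable_log_one_add_rhoMix h0 h1 hH hlog
  have hp := mul_pos h0 hθ
  have := isProbabilityMeasure_dirichletMean hp hν hνlog
  set N := fun y => (dirichletMean (α * θ) (densityMeasure (rhoMix α H))).real (Iic y) with hN
  have hder := fun {δ x : ℝ} => hasDerivAt_measureReal_dirichletMean (δ := δ) (x := x) h0 h1 hθ hH
    hlog
  obtain ⟨hf0, hfeq⟩ := eq_densityMeasure_of_hasDerivAt (ae_dirichletMean_pos hp hν hνlog)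
    (f := deriv N) fun x hx => (hder (half_pos hx) (half_lt_self hx)).differentiableAt.hasDerivAt
  refine ⟨deriv N, fun x hx => ⟨hf0 x hx, ?_⟩, hfeq⟩
  -- The formula for the derivative holds for every cut δ. As the cut tends to 0, the integral over
  -- [0, δ] vanishes by integrability and the boundary term by the hypothesis on Δ, so the integral
  -- of d over [δ, x] converges to the density.
  have hi : IntervalIntegrable (fun t => (x - t) ^ (α * θ - 2) *
      crDelta (α * θ) (densityMeasure (rhoMix α H)) t) volume 0 (x / 2) := by
    refine (intervalIntegrable_crDelta h0 h1 hθ hH hlog (half_pos hx)).continuousOn_mul ?_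
    rw [uIcc_of_le (half_pos hx).le]
    exact ContinuousOn.rpow_const (by fun_prop) fun t ht => Or.inl (by linarith [ht.2])
  have t1 : Tendsto (fun ε => ∫ t in (0 : ℝ)..ε, (x - t) ^ (α * θ - 2) *
      crDelta (α * θ) (densityMeasure (rhoMix α H)) t) (𝓝[>] 0) (𝓝 0) := by
    have := intervalIntegral.continuousWithinAt_primitive (b₀ := 0) (b₁ := 0) (b₂ := x / 2)
      (a := 0) (μ := volume) (f := fun t => (x - t) ^ (α * θ - 2) *
      crDelta (α * θ) (densityMeasure (rhoMix α H)) t) (by simp)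
      (by simpa [max_eq_right (half_pos hx).le] using hi)
    have h2 := this.tendsto
    rw [intervalIntegral.integral_same] at h2
    refine h2.mono_left ?_
    rw [← nhdsWithin_Ioo_eq_nhdsGT (half_pos hx)]
    exact nhdsWithin_mono _ Ioo_subset_Icc_self
  have t2 : Tendsto (fun ε => (x - ε) ^ (α * θ - 1) *
      crDelta (α * θ) (densityMeasure (rhoMix α H)) ε) (𝓝[>] 0) (𝓝 0) := by
    have hc : ContinuousAt (fun ε : ℝ => (x - ε) ^ (α * θ - 1)) 0 :=
      ContinuousAt.rpow_const (by fun_prop) (Or.inl (by simpa using hx.ne'))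
    have := (hc.tendsto.mono_left nhdsWithin_le_nhds).mul hlim
    rwa [mul_zero] at this
  have t3 := (tendsto_const_nhds (x := deriv N x) (f := 𝓝[>] (0 : ℝ))).sub
    (t2.add (t1.const_mul (α * θ - 1)))
  rw [mul_zero, add_zero, sub_zero] at t3
  refine t3.congr' ?_
  filter_upwards [Ioo_mem_nhdsGT hx] with ε hε
  rw [hN, (hder hε.1 hε.2).deriv]
  ring

end

/-! ### The case of an integrable logarithm -/

section
variable {α θ : ℝ} {H : Measure ℝ} [IsProbabilityMeasure H]

theorem continuousOn_upsilon (h0 : 0 < α) (h1 : α < 1) (hH : ∀ᵐ r ∂H, 0 < r) :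
    ContinuousOn (upsilon α H) (Ici 0) := by
  have h : ContinuousOn (fun x => ∫ r, cdfScaled α r x ∂H) (Ici 0) := by
    refine continuousOn_of_dominated (bound := fun _ => 1)
      (fun x _ => (measurable_cdfScaled α x).aestronglyMeasurable) (fun x hx => ?_)
      (integrable_const _)
      (Eventually.of_forall fun r => (continuous_cdfScaled h0 r).continuousOn)
    filter_upwards [hH] with r hr
    rw [Real.norm_of_nonneg (cdfScaled_nonneg h0 h1 hr hx)]
    exact cdfScaled_le_one h0
  exact h.congr fun x hx => integral_cdfScaled_eq h0 h1 hx hH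

theorem upsilon_zero (h0 : 0 < α) (h1 : α < 1) (hH : ∀ᵐ r ∂H, 0 < r) : upsilon α H 0 = 0 := by
  rw [← upsilon_eq_measureReal h0 h1 hH, Ioc_self, measureReal_empty]

theorem lampertiDenom_le {x r : ℝ} (hx : 0 ≤ x) (hr : 0 ≤ r) :
    lampertiDenom α x r ≤ (x ^ α + r) ^ 2 := by
  rw [lampertiDenom_eq hx]
  have h2 : 0 ≤ x ^ α * r := mul_nonneg (Real.rpow_nonneg hx _) hr
  nlinarith [Real.cos_le_one (α * Real.pi)]

/-- The logarithmic potential extends continuously to `0` if `log` is integrable. -/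
theorem continuousOn_integral_log_lampertiDenom (h0 : 0 < α) (h1 : α < 1)
    (hH : ∀ᵐ r ∂H, 0 < r) (hlog : Integrable (fun r => Real.log (1 + r)) H)
    (hlogH : Integrable Real.log H) (X : ℝ) :
    ContinuousOn (fun x => ∫ r, Real.log (lampertiDenom α x r) ∂H) (Icc 0 X) := by
  have hc := lampertiConst_pos h0 h1
  -- The dominating function is read off from c r² ≤ denominator ≤ ((X^α + 1)(1 + r))² for 0 ≤ x ≤
  -- X, with c the ellipticity constant. The lower bound is where integrability of log r enters.
  refine continuousOn_of_dominated (bound := fun r => (|Real.log (lampertiConst α)| +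
      2 * |Real.log r|) + (2 * |Real.log (X ^ α + 1)| + 2 * |Real.log (1 + r)|))
    (fun x _ => (Real.measurable_log.comp
      ((measurable_lampertiDenom α).comp measurable_prodMk_left)).aestronglyMeasurable)
    (fun x hx => ?_)
    (((integrable_const _).add (hlogH.abs.const_mul 2)).add
      ((integrable_const _).add (hlog.abs.const_mul 2))) ?_
  · filter_upwards [hH] with r hr
    have hD := lampertiDenom_pos h0 h1 hx.1 hr
    have hX : x ^ α ≤ X ^ α := Real.rpow_le_rpow hx.1 hx.2 h0.le
    have hx0 : 0 ≤ x ^ α := Real.rpow_nonneg hx.1 _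
    have hlo : lampertiConst α * r ^ 2 ≤ lampertiDenom α x r := by
      nlinarith [lampertiDenom_ge (α := α) hx.1 hr.le, sq_nonneg (x ^ α)]
    have hup : lampertiDenom α x r ≤ ((X ^ α + 1) * (1 + r)) ^ 2 := by
      refine (lampertiDenom_le hx.1 hr.le).trans (pow_le_pow_left₀ (by positivity) ?_ 2)
      nlinarith [mul_nonneg (hx0.trans hX) hr.le]
    have h2 := Real.log_le_log (by positivity) hlo
    have h3 := Real.log_le_log hD hup
    have hXpos : 0 < X ^ α + 1 := by linarith
    rw [Real.log_mul hc.ne' (by positivity), Real.log_pow] at h2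
    rw [Real.log_pow, Real.log_mul hXpos.ne' (by positivity)] at h3
    push_cast at h2 h3
    rw [Real.norm_eq_abs, abs_le]
    constructor <;> linarith [neg_abs_le (Real.log (lampertiConst α)), neg_abs_le (Real.log r),
      abs_nonneg (Real.log (X ^ α + 1)), abs_nonneg (Real.log (1 + r)),
      abs_nonneg (Real.log (lampertiConst α)), abs_nonneg (Real.log r),
      le_abs_self (Real.log (X ^ α + 1)), le_abs_self (Real.log (1 + r))]
  · filter_upwards [hH] with r hr
    exact ContinuousOn.log (continuous_lampertiDenom h0 r).continuousOn fun x hx =>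
      (lampertiDenom_pos h0 h1 hx.1 hr).ne'

theorem exists_exp_logS_le (h0 : 0 < α) (h1 : α < 1) (θ : ℝ) (hH : ∀ᵐ r ∂H, 0 < r)
    (hlog : Integrable (fun r => Real.log (1 + r)) H) (hlogH : Integrable Real.log H) (X : ℝ) :
    ∃ C : ℝ, ∀ x ∈ Ioc 0 X, Real.exp (-(θ * α) * logS α H x) ≤ C := by
  obtain ⟨C, hC⟩ := (isCompact_Icc (a := 0) (b := X)).exists_bound_of_continuousOn
    (((continuousOn_integral_log_lampertiDenom h0 h1 hH hlog hlogH X).const_smul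
      (1 / (2 * α))).const_smul (-(θ * α))).rexp
  refine ⟨C, fun x hx => ?_⟩
  rw [logS_eq h0 h1 hH hlog hx.1]
  exact (le_abs_self _).trans (hC x ⟨hx.1.le, hx.2⟩)

/-- The exponential factor stays bounded near 0, while the sine tends to 0 because Υ is continuous
with Υ(0) = 0. -/
theorem tendsto_crDelta_zero (h0 : 0 < α) (h1 : α < 1) (θ : ℝ) (hH : ∀ᵐ r ∂H, 0 < r)
    (hlog : Integrable (fun r => Real.log (1 + r)) H) (hlogH : Integrable Real.log H) :
    Tendsto (crDelta (α * θ) (densityMeasure (rhoMix α H))) (𝓝[>] 0) (𝓝 0) := by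
  obtain ⟨C, hC⟩ := exists_exp_logS_le h0 h1 θ hH hlog hlogH 1
  have hU : Tendsto (upsilon α H) (𝓝[>] 0) (𝓝 0) := by
    have := (continuousOn_upsilon h0 h1 hH 0 self_mem_Ici).tendsto
    rw [upsilon_zero h0 h1 hH] at this
    exact this.mono_left (nhdsWithin_mono _ Ioi_subset_Ici_self)
  have h2 : Tendsto (fun x => |1 / Real.pi * Real.sin (Real.pi * θ * α * upsilon α H x)| * C)
      (𝓝[>] 0) (𝓝 0) := by
    have h3 : Continuous fun y : ℝ => |1 / Real.pi * Real.sin (Real.pi * θ * α * y)| * C := by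
      fun_prop
    have h4 := (h3.tendsto 0).comp hU
    simpa [Function.comp_def] using h4
  refine squeeze_zero_norm' ?_ h2
  filter_upwards [Ioc_mem_nhdsGT (zero_lt_one' ℝ)] with x hx
  rw [crDelta_rhoMix h0 h1 hH, norm_mul, Real.norm_eq_abs, Real.norm_of_nonneg (Real.exp_pos _).le]
  exact mul_le_mul_of_nonneg_left (hC x hx) (abs_nonneg _)

/-- Up to a positive constant this is the nonnegative derivative of Υ, which is continuous on [0,
X]. -/
theorem integrableOn_bOne (h0 : 0 < α) (h1 : α < 1) (hH : ∀ᵐ r ∂H, 0 < r) (X : ℝ) :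
    IntegrableOn (bOne α H) (Ioc 0 X) := by
  have hs := div_pos (sin_pi_mul_pos h0 h1) Real.pi_pos
  have h : IntegrableOn (fun x => Real.sin (Real.pi * α) / Real.pi * bOne α H x) (Ioc 0 X) :=
    intervalIntegral.integrableOn_deriv_of_nonneg
      ((continuousOn_upsilon h0 h1 hH).mono Icc_subset_Ici_self)
      (fun x hx => hasDerivAt_upsilon h0 h1 hx.1 hH)
      (fun x hx => mul_nonneg hs.le (bOne_nonneg h0 h1 hx.1 hH))
  refine (h.const_mul (Real.sin (Real.pi * α) / Real.pi)⁻¹).congr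
    (Eventually.of_forall fun x => ?_)
  simp only
  rw [inv_mul_cancel_left₀ hs.ne']

/-- The derivative of 𝒮 is B₂ + cos(πα) B₁; subtracting the right multiple of Υ leaves B₂ ≥ 0 as the
derivative of a function continuous on [0, X]. The closed form of 𝒮 is used because its continuity
at 0 is known. -/
theorem integrableOn_bTwo (h0 : 0 < α) (h1 : α < 1) (hH : ∀ᵐ r ∂H, 0 < r)
    (hlog : Integrable (fun r => Real.log (1 + r)) H) (hlogH : Integrable Real.log H) (X : ℝ) :
    IntegrableOn (bTwo α H) (Ioc 0 X) := by
  have hs := sin_pi_mul_pos h0 h1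
  have hc : ContinuousOn (fun x => 1 / (2 * α) * (∫ r, Real.log (lampertiDenom α x r) ∂H) -
      Real.cos (Real.pi * α) * (Real.pi / Real.sin (Real.pi * α)) * upsilon α H x) (Icc 0 X) :=
    ((continuousOn_integral_log_lampertiDenom h0 h1 hH hlog hlogH X).const_smul (1 / (2 * α))).sub
      (continuousOn_const.mul ((continuousOn_upsilon h0 h1 hH).mono Icc_subset_Ici_self))
  refine intervalIntegral.integrableOn_deriv_of_nonneg hc (fun x hx => ?_)
    (fun x hx => bTwo_nonneg h0 h1 hx.1 hH)
  have h := (hasDerivAt_logS h0 h1 hx.1 hH hlog).sub ((hasDerivAt_upsilon h0 h1 hx.1 hH).const_mul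
    (Real.cos (Real.pi * α) * (Real.pi / Real.sin (Real.pi * α))))
  have hpi := Real.pi_ne_zero
  refine (h.congr_of_eventuallyEq ?_).congr_deriv ?_
  · filter_upwards [Ioi_mem_nhds hx.1] with y hy
    simp only [Pi.sub_apply]
    rw [logS_eq h0 h1 hH hlog hy]
  · field_simp
    ring

theorem intervalIntegrable_dFun (h0 : 0 < α) (h1 : α < 1) (θ : ℝ) (hH : ∀ᵐ r ∂H, 0 < r)
    (hlog : Integrable (fun r => Real.log (1 + r)) H) (hlogH : Integrable Real.log H) {X : ℝ}
    (hX : 0 < X) : IntervalIntegrable (dFun α θ H) volume 0 X := by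
  obtain ⟨C, hC⟩ := exists_exp_logS_le h0 h1 θ hH hlog hlogH X
  rw [intervalIntegrable_iff_integrableOn_Ioc_of_le hX.le]
  refine (((integrableOn_bOne h0 h1 hH X).add
    (integrableOn_bTwo h0 h1 hH hlog hlogH X)).const_mul (|α * θ / Real.pi| * C)).mono'
    (((continuousOn_dFun h0 h1 θ hH hlog).mono fun t ht => ht.1).aestronglyMeasurable
      measurableSet_Ioc) ?_
  filter_upwards [ae_restrict_mem measurableSet_Ioc] with x hx
  have b1 := bOne_nonneg h0 h1 hx.1 hH
  have b2 := bTwo_nonneg h0 h1 hx.1 hH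
  rw [dFun, norm_mul, norm_mul, Real.norm_eq_abs, Real.norm_of_nonneg (Real.exp_pos _).le]
  refine mul_le_mul (mul_le_mul_of_nonneg_left (hC x hx) (abs_nonneg _)) ?_ (norm_nonneg _)
    (mul_nonneg (abs_nonneg _) ((Real.exp_pos _).le.trans (hC x hx)))
  refine (norm_sub_le _ _).trans (add_le_add ?_ ?_)
  · rw [norm_mul, Real.norm_eq_abs, Real.norm_of_nonneg b1]
    exact mul_le_of_le_one_left b1 (Real.abs_sin_le_one _)
  · rw [norm_mul, Real.norm_eq_abs, Real.norm_of_nonneg b2]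
    exact mul_le_of_le_one_left b2 (Real.abs_sin_le_one _)

/-- The density, as an absolutely convergent integral. -/
theorem dirichletMean_eq_of_integrable_log (h0 : 0 < α) (h1 : α < 1) (hθ : 0 < θ)
    (hH : ∀ᵐ r ∂H, 0 < r) (hlog : Integrable (fun r => Real.log (1 + r)) H)
    (hlogH : Integrable Real.log H) :
    (∀ x : ℝ, 0 < x →
      IntervalIntegrable (fun t => (x - t) ^ (α * θ - 1) * dFun α θ H t) volume 0 x) ∧
    dirichletMean (α * θ) (densityMeasure (rhoMix α H)) =
      densityMeasure fun x => ∫ t in (0 : ℝ)..x, (x - t) ^ (α * θ - 1) * dFun α θ H t := by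
  have hi : ∀ x : ℝ, 0 < x →
      IntervalIntegrable (fun t => (x - t) ^ (α * θ - 1) * dFun α θ H t) volume 0 x := fun x hx =>
    intervalIntegrable_abel_zero (mul_pos h0 hθ) (continuousOn_dFun h0 h1 θ hH hlog)
      (fun y hy => intervalIntegrable_dFun h0 h1 θ hH hlog hlogH hy) hx.le
  refine ⟨hi, ?_⟩
  obtain ⟨f, hf, he⟩ := exists_density_dirichletMean h0 h1 hθ hH hlog
    (tendsto_crDelta_zero h0 h1 θ hH hlog hlogH)
  rw [he, densityMeasure, densityMeasure]
  refine withDensity_congr_ae ?_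
  filter_upwards [ae_restrict_mem measurableSet_Ioi] with x hx
  have hx0 : (0 : ℝ) < x := hx
  congr 1
  -- The improper integral at 0 agrees with the absolutely convergent one by continuity of the
  -- primitive in its lower limit.
  refine tendsto_nhds_unique (hf x hx).2 ?_
  have hc := intervalIntegral.continuousOn_primitive_interval' (μ := volume) (hi x hx0)
    right_mem_uIcc
  rw [uIcc_of_le hx0.le] at hc
  have h2 := (hc 0 ⟨le_rfl, hx0.le⟩).tendsto.neg
  simp_rw [← intervalIntegral.integral_symm] at h2
  refine h2.mono_left ?_
  rw [← nhdsWithin_Ioo_eq_nhdsGT hx0]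
  exact nhdsWithin_mono _ Ioo_subset_Icc_self

end

theorem theorem5p1 (α θ : ℝ) (hα₀ : 0 < α) (hα₁ : α < 1) (hθ : 0 < θ)
    (H : Measure ℝ) [IsProbabilityMeasure H] (hHpos : H (Iic 0) = 0)
    (hHlog : Integrable (fun r => Real.log (1 + r)) H) :
    -- the identity in law for independent factors
    dirichletMean (α * θ) (densityMeasure (rhoMix α H)) =
      ((dirichletMean (α * θ) (densityMeasure (rho α))).prod (dirichletMean θ H)).map
        (fun p : ℝ × ℝ => p.1 * p.2 ^ (1 / α)) ∧
    -- the Cifarelli–Regazzini formula for the cdf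
    (∀ x : ℝ, 0 ≤ x →
      IntervalIntegrable
        (fun t => (x - t) ^ (α * θ - 1) * crDelta (α * θ) (densityMeasure (rhoMix α H)) t)
        volume 0 x ∧
      (dirichletMean (α * θ) (densityMeasure (rhoMix α H))).real (Iic x) =
        ∫ t in (0 : ℝ)..x,
          (x - t) ^ (α * θ - 1) * crDelta (α * θ) (densityMeasure (rhoMix α H)) t) ∧
    -- the explicit form of `Δ`
    (∀ x : ℝ, 0 < x →
      crDelta (α * θ) (densityMeasure (rhoMix α H)) x =
        1 / Real.pi * Real.sin (Real.pi * θ * α * upsilon α H x) *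
          Real.exp (-(θ * α) * logS α H x) ∧
      upsilon α H x = 1 - 1 / (Real.pi * α) *
        ∫ r, arccot (Real.cot (Real.pi * α) + x ^ α / r / Real.sin (Real.pi * α)) ∂H ∧
      logS α H x = 1 / (2 * α) * ∫ r, Real.log (lampertiDenom α x r) ∂H) ∧
    -- for total mass one, `Δ` itself is the density
    dirichletMean 1 (densityMeasure (rhoMix α H)) =
      densityMeasure (crDelta 1 (densityMeasure (rhoMix α H))) ∧
    -- `d` is the derivative of `Δ`
    (∀ x : ℝ, 0 < x →
      HasDerivAt (crDelta (α * θ) (densityMeasure (rhoMix α H))) (dFun α θ H x) x) ∧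
    -- the density, as an integral that is improper at `0`
    (Tendsto (crDelta (α * θ) (densityMeasure (rhoMix α H))) (𝓝[>] 0) (𝓝 0) →
      ∃ f : ℝ → ℝ,
        (∀ x : ℝ, 0 < x → 0 ≤ f x ∧
          (∀ ε ∈ Ioo 0 x,
            IntervalIntegrable (fun t => (x - t) ^ (α * θ - 1) * dFun α θ H t) volume ε x) ∧
          Tendsto (fun ε => ∫ t in ε..x, (x - t) ^ (α * θ - 1) * dFun α θ H t)
            (𝓝[>] 0) (𝓝 (f x))) ∧
        dirichletMean (α * θ) (densityMeasure (rhoMix α H)) = densityMeasure f) ∧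
    -- the density, as an absolutely convergent integral
    (Integrable Real.log H →
      Tendsto (crDelta (α * θ) (densityMeasure (rhoMix α H))) (𝓝[>] 0) (𝓝 0) ∧
      (∀ x : ℝ, 0 < x →
        IntervalIntegrable (fun t => (x - t) ^ (α * θ - 1) * dFun α θ H t) volume 0 x) ∧
      dirichletMean (α * θ) (densityMeasure (rhoMix α H)) =
        densityMeasure fun x => ∫ t in (0 : ℝ)..x, (x - t) ^ (α * θ - 1) * dFun α θ H t) := by
  have hH : ∀ᵐ r ∂H, 0 < r := by
    filter_upwards [measure_eq_zero_iff_ae_notMem.1 hHpos] with r hr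
    exact not_le.1 hr
  have hp := mul_pos hα₀ hθ
  have hΔ : ∀ x, 0 < x → HasDerivAt (crDelta (α * θ) (densityMeasure (rhoMix α H)))
      (dFun α θ H x) x := fun x hx => hasDerivAt_crDelta hα₀ hα₁ θ hx hH hHlog
  refine ⟨dirichletMean_rhoMix_eq_map hα₀ hα₁ hθ hH hHlog, fun x hx => ⟨?_,
    measureReal_dirichletMean_Iic hα₀ hα₁ hθ hH hHlog hx⟩, fun x hx =>
    ⟨crDelta_rhoMix hα₀ hα₁ hH θ x, upsilon_eq_arccot hα₀ hα₁ hx.le hH,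
      logS_eq hα₀ hα₁ hH hHlog hx⟩, dirichletMean_one_eq hα₀ hα₁ hH hHlog, hΔ, fun hlim => ?_,
    fun hlogH => ⟨tendsto_crDelta_zero hα₀ hα₁ θ hH hHlog hlogH,
      dirichletMean_eq_of_integrable_log hα₀ hα₁ hθ hH hHlog hlogH⟩⟩
  · exact intervalIntegrable_abel_zero hp
      (fun t ht => (hΔ t ht).continuousAt.continuousWithinAt)
      (fun y hy => intervalIntegrable_crDelta hα₀ hα₁ hθ hH hHlog hy) hx
  · obtain ⟨f, hf, he⟩ := exists_density_dirichletMean hα₀ hα₁ hθ hH hHlog hlim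
    exact ⟨f, fun x hx => ⟨(hf x hx).1, fun ε hε =>
      intervalIntegrable_abel hp (continuousOn_dFun hα₀ hα₁ θ hH hHlog) hε.1 hε.2.le,
      (hf x hx).2⟩, he⟩
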